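/- Let $n\ge 0$, $S^1=\mathbb R/\mathbb Z$, and let $X:S^1\times\mathbb R^n\to\mathbb R^n$ be a smooth time-dependent vector field. Let $\mathrm H$ be the sc-Hilbert space with levels $H_m=W^{m,2}(S^1,\mathbb R^n)$, $m\ge 0$; let $\mathrm H^1,\mathrm H^2$ be the shifted scales, $(\mathrm H^k)_m=H_{m+k}$; and give $\mathbb R$ the constant scale. Consider the map $s(\tau,x)=\partial_t x-X(x(\cdot-\tau))$, i.e. $s(\tau,x)(t)=\partial_t x(t)-X_t(x(t-\tau))$, from $\mathbb R\times\mathrm H^1$ to $\mathrm H$, and the section $S(\tau,x)=(\tau,x,s(\tau,x))$ of the trivial bundle $\mathbb R\times\mathrm H^1\times\mathrm H\to\mathbb R\times\mathrm H^1$. **Theorem.** (1) $S$ is an sc-smooth section which is sc-Fredholm, with respect to the splitting $\mathbb R\oplus\mathrm H^1$, at every smooth point $(\tau^*,x^*)\in\mathbb R\times\bigcap_m H_m$. This means that the translated map $f(r,e)=s(\tau^*+r,x^*+e)$, $f:\mathbb R\oplus \mathrm H^1\to\mathrm H$, has the following properties. It is sc-smooth, and: (i) for every $m\ge0$ there is $\epsilon_m>0$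 such that $(r,e)\in\mathbb R\times H_{m+1}$, $\|(r,e)\|\le\epsilon_m$ and $f(r,e)\in H_{m+1}$ imply $e\in H_{m+2}$. (ii) For every $m\ge0$ there is $\epsilon_m>0$ such that for $|r|<\epsilon_m$ the map $f(r,\cdot):\{e\in H_{m+1}:\|e\|<\epsilon_m\}\to H_m$ is differentiable, with differential $D_m(r,e)\in\mathcal L(H_{m+1},H_m)$, and (a) $e\mapsto D_m(r,e)$ is continuous in operator norm, uniformly on $\{|r|<\epsilon_m,\|e\|<\epsilon_m\}$ (for every $\delta>0$ there is $\eta>0$, independent of $r$, such that $\|e-e'\|<\eta$ implies $\|D_m(r,e)-D_m(r,e')\|\le\delta$); (b) if $r_\nu\to0$, $\|e_\nu\|_{H_{m+1}}\le1$ and $\|D_m(r_\nu,0)e_\nu\|_{H_m}\to0$, then $\|D_m(0,0)e_\nu\|_{H_m}\to0$ along a subsequence. (iii) $D_0(0,0)$ is a linear sc-Fredholm operator $\mathrm H^1\to\mathrm H$ (there are splittings $\mathrm H^1=K\oplus Z$ and $\mathrm H=Y\oplus C$ respecting the scales, with $K=\ker D_0(0,0)$ and $C$ finite dimensional and $Y=\operatorname{im}D_0(0,0)$,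 such that the operator is an sc-isomorphism $Z\to Y$); and for all $|r|<\epsilon_0$ the operator $D_0(r,0):H_1\to H_0$ is Fredholm, has the same index as $D_0(0,0)$, and satisfies $\ker D_0(r,0)\subseteq H_2$. (2) The restriction of $S$ to a section of $\mathbb R\times\mathrm H^2\times\mathrm H^1\to\mathbb R\times\mathrm H^2$ is a sc-Fredholm section in the sense of Hofer, Wysocki and Zehnder: it is sc-smooth; it is regularizing (for all $m\ge 0$, $x\in H_{m+2}$ and $s(\tau,x)\in H_{m+2}$ imply $x\in H_{m+3}$); and at every smooth point, translated to $0$, the germ of $s$ becomes, after subtracting a local $\mathrm{sc}^+$-section with the same value at $0$ and conjugating with a strong bundle isomorphism over an sc-diffeomorphism fixing $0$, a basic germ $h:(\mathbb R^a\oplus W,0)\to(\mathbb R^b\oplus W,0)$ for some $a,b\ge 0$ and some sc-Banach space $W$. Here $h$ is a basic germ if its $W$-component has the form $w-B(c,w)$, where for every $m\ge 0$ and $\epsilon>0$ one has $\|B(c,w)-B(c,w')\|_m\le\epsilon\|w-w'\|_m$ for all $(c,w),(c,w')$ sufficiently close to $0$ on level $m$. -/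

import Mathlib

open MeasureTheory Filter Topology
open scoped ContDiff

noncomputable section

namespace DelayScale

/-! ### Scale spaces -/

/-- A sc-Banach space `E₀ ⊇ E₁ ⊇ E₂ ⊇ ⋯`: a nested sequence of Banach spaces (each inclusion being an
injective bounded map) whose inclusions `E_{m+1} ⊆ E_m` are compact and dense. The concrete scales
below consist of Hilbert spaces (products carry the maximum norm, which is equivalent to the Hilbert
sum norm). -/
structure ScBanach where
  /-- the levels `E_m` -/
  level : ℕ → Type
  [normed : ∀ m, NormedAddCommGroup (level m)]
  [space : ∀ m, NormedSpace ℝ (level m)]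
  [complete : ∀ m, CompleteSpace (level m)]
  /-- the inclusions `E_{m+1} ⊆ E_m` -/
  incl : ∀ m, level (m + 1) →L[ℝ] level m
  incl_injective : ∀ m, Function.Injective (incl m)
  incl_compact : ∀ m, IsCompactOperator (incl m)
  incl_dense : ∀ m, DenseRange (incl m)

attribute [instance] ScBanach.normed ScBanach.space ScBanach.complete

namespace ScBanach

/-- The inclusion `E_m ⊆ E_0`. -/
def toZero (E : ScBanach) : ∀ m, E.level m →L[ℝ] E.level 0
  | 0 => ContinuousLinearMap.id ℝ _
  | m + 1 => (E.toZero m).comp (E.incl m)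

/-- The point `x ∈ E₀` lies in the subspace `E_m`. -/
def InLevel (E : ScBanach) (m : ℕ) (x : E.level 0) : Prop := ∃ y : E.level m, E.toZero m y = x

/-- Smooth points: the elements of `E_∞ = ⋂ E_m`. -/
def IsSmoothPoint (E : ScBanach) (x : E.level 0) : Prop := ∀ m, E.InLevel m x

/-- The shifted scale `E¹`, with `(E¹)_m = E_{m+1}`. -/
def up (E : ScBanach) : ScBanach where
  level m := E.level (m + 1)
  incl m := E.incl (m + 1)
  incl_injective m := E.incl_injective (m + 1)
  incl_compact m := E.incl_compact (m + 1)
  incl_dense m := E.incl_dense (m + 1)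

/-- A finite dimensional space with the constant filtration. -/
def const (V : Type) [NormedAddCommGroup V] [NormedSpace ℝ V] [FiniteDimensional ℝ V] :
    ScBanach where
  level _ := V
  complete _ := FiniteDimensional.complete ℝ V
  incl _ := ContinuousLinearMap.id ℝ V
  incl_injective _ := Function.injective_id
  incl_compact _ := by
    have := FiniteDimensional.proper_real V
    exact isCompactOperator_id
  incl_dense _ := Function.surjective_id.denseRange

theorem isCompact_prodMap {A B C D : Type} [NormedAddCommGroup A] [NormedSpace ℝ A]
    [NormedAddCommGroup B] [NormedSpace ℝ B] [NormedAddCommGroup C] [NormedSpace ℝ C]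
    [NormedAddCommGroup D] [NormedSpace ℝ D] {f : A →L[ℝ] B} {g : C →L[ℝ] D}
    (hf : IsCompactOperator f) (hg : IsCompactOperator g) :
    IsCompactOperator (f.prodMap g) := by
  have h1 := (hf.comp_clm (ContinuousLinearMap.fst ℝ A C)).clm_comp (ContinuousLinearMap.inl ℝ B D)
  have h2 := (hg.comp_clm (ContinuousLinearMap.snd ℝ A C)).clm_comp (ContinuousLinearMap.inr ℝ B D)
  have e : (f.prodMap g : A × C → B × D) =
      (ContinuousLinearMap.inl ℝ B D ∘ f ∘ ContinuousLinearMap.fst ℝ A C) +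
        (ContinuousLinearMap.inr ℝ B D ∘ g ∘ ContinuousLinearMap.snd ℝ A C) := by
    funext x
    ext <;> simp
  rw [e]
  exact h1.add h2

/-- The product (direct sum) `E ⊕ F`, with `(E ⊕ F)_m = E_m ⊕ F_m`. -/
def prod (E F : ScBanach) : ScBanach where
  level m := E.level m × F.level m
  incl m := (E.incl m).prodMap (F.incl m)
  incl_injective m := (E.incl_injective m).prodMap (F.incl_injective m)
  incl_compact m := isCompact_prodMap (E.incl_compact m) (F.incl_compact m)
  incl_dense m := (E.incl_dense m).prodMap (F.incl_dense m)

end ScBanach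

/-! ### sc-smoothness

A map between (open subsets of) scale spaces is given by the map on the bottom level; for a map
defined on an open set `U ⊆ E₀` only the values on `U` matter. -/

section ScSmooth

/-- `f : U → F` is sc-continuous: it maps `U ∩ E_m` to `F_m`, continuously, for every `m`. -/
def ScContinuousOn {E F : ScBanach} (U : Set (E.level 0)) (f : E.level 0 → F.level 0) : Prop :=
  ∀ m, ∃ g : E.level m → F.level m,
    (∀ x, E.toZero m x ∈ U → F.toZero m (g x) = f (E.toZero m x)) ∧
    ContinuousOn g (E.toZero m ⁻¹' U)

/-- `Tf : E¹ ⊕ E → F¹ ⊕ F`, `(x, h) ↦ (f x, df(x) h)`, is the tangent map of `f : U → F`, where for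
`x ∈ U ∩ E₁` the sc-differential `df(x) : E₀ → F₀` is a bounded linear operator with
`‖f(x + h) - f(x) - df(x) h‖_{F₀} / ‖h‖_{E₁} → 0` as `h → 0` in `E₁`. -/
def IsTangentMapOn {E F : ScBanach} (U : Set (E.level 0)) (f : E.level 0 → F.level 0)
    (Tf : (E.up.prod E).level 0 → (F.up.prod F).level 0) : Prop :=
  ∃ df : E.level 1 → E.level 0 →L[ℝ] F.level 0,
    ∀ x : E.level 1, E.incl 0 x ∈ U →
      (fun h : E.level 1 => f (E.incl 0 (x + h)) - f (E.incl 0 x) - df x (E.incl 0 h))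
        =o[𝓝 0] (fun h : E.level 1 => h) ∧
      ∀ h : E.level 0, F.incl 0 (Tf (x, h)).1 = f (E.incl 0 x) ∧ (Tf (x, h)).2 = df x h

/-- The tangent domain `TU = (U ∩ E₁) ⊕ E₀` of `U ⊆ E₀`. -/
def tangentDomain {E : ScBanach} (U : Set (E.level 0)) : Set ((E.up.prod E).level 0) :=
  {p | E.incl 0 p.1 ∈ U}

/-- `f : U → F` is of class `sc^k`: for `k = 0` it is sc-continuous; it is `sc^{k+1}` if it is `sc^k`
and has a tangent map which is `sc^k`. -/
def ScContDiffOn : ℕ → ∀ {E F : ScBanach}, Set (E.level 0) → (E.level 0 → F.level 0) → Prop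
  | 0, _, _, U, f => ScContinuousOn U f
  | k + 1, E, F, U, f => ScContDiffOn k U f ∧
      ∃ Tf : (E.up.prod E).level 0 → (F.up.prod F).level 0,
        IsTangentMapOn U f Tf ∧ ScContDiffOn k (tangentDomain U) Tf

/-- `f : U → F` is sc-smooth. -/
def ScSmoothOn {E F : ScBanach} (U : Set (E.level 0)) (f : E.level 0 → F.level 0) : Prop :=
  ∀ k, ScContDiffOn k U f

/-- `f : E → F` is sc-smooth. -/
def ScSmooth {E F : ScBanach} (f : E.level 0 → F.level 0) : Prop := ScSmoothOn Set.univ f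

end ScSmooth

/-! ### Linear sc-Fredholm operators -/

/-- The level `K_m = K ∩ E_m` of a subspace `K ⊆ E₀`. -/
def levelSub {E : ScBanach} (K : Submodule ℝ (E.level 0)) (m : ℕ) : Submodule ℝ (E.level m) :=
  K.comap (E.toZero m).toLinearMap

/-- A splitting `E = K ⊕ X` respecting the sc-structure: `E_m = K_m ⊕ X_m` as a direct sum of closed
subspaces on every level. (Then `K_{m+1}` is automatically dense in `K_m`, and likewise for `X`.) -/
def IsScSplitting {E : ScBanach} (K X : Submodule ℝ (E.level 0)) : Prop :=
  ∀ m, IsClosed (levelSub K m : Set (E.level m)) ∧ IsClosed (levelSub X m : Set (E.level m)) ∧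
    IsCompl (levelSub K m) (levelSub X m)

/-- `T : E → F` restricts to a sc-isomorphism `X → Y` of sc-subspaces: on every level it induces a
bijection `X_m → Y_m` with bounded inverse. -/
def IsScIsoBetween {E F : ScBanach} (T : E.level 0 →L[ℝ] F.level 0)
    (X : Submodule ℝ (E.level 0)) (Y : Submodule ℝ (F.level 0)) : Prop :=
  ∀ m, ∃ Tm : E.level m →L[ℝ] F.level m, (∀ x, F.toZero m (Tm x) = T (E.toZero m x)) ∧
    Set.BijOn Tm (levelSub X m) (levelSub Y m) ∧
    ∃ c : ℝ, ∀ x ∈ levelSub X m, ‖x‖ ≤ c * ‖Tm x‖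

/-- Linear sc-Fredholm operators: `T : E → F` is sc-continuous and there are splittings `E = K ⊕ X`,
`F = Y ⊕ C` respecting the sc-structures with `K = ker T` and `C` finite dimensional, `Y = im T`, and
`T : X → Y` a sc-isomorphism. -/
def IsLinearScFredholm {E F : ScBanach} (T : E.level 0 →L[ℝ] F.level 0) : Prop :=
  ScContinuousOn Set.univ (fun x => T x) ∧
  ∃ (K X : Submodule ℝ (E.level 0)) (Y C : Submodule ℝ (F.level 0)),
    IsScSplitting K X ∧ IsScSplitting Y C ∧
    K = T.ker ∧ FiniteDimensional ℝ K ∧ Y = T.range ∧ FiniteDimensional ℝ C ∧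
    IsScIsoBetween T X Y

/-- The index `dim ker T - dim coker T`. -/
def fredholmIndex {A B : Type} [NormedAddCommGroup A] [NormedSpace ℝ A]
    [NormedAddCommGroup B] [NormedSpace ℝ B] (T : A →L[ℝ] B) : ℤ :=
  (Module.finrank ℝ T.ker : ℤ) - (Module.finrank ℝ (B ⧸ T.range) : ℤ)

/-! ### The nonlinear sc-Fredholm property with respect to a splitting (Wehrheim) -/

/-- `f : V ⊕ E' → F` (`V` finite dimensional) is sc-Fredholm at `0` with respect to the splitting
`V ⊕ E'`. -/
structure IsScFredholmSplit {V : Type} [NormedAddCommGroup V] [NormedSpace ℝ V]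
    [FiniteDimensional ℝ V] {E' F : ScBanach}
    (f : ((ScBanach.const V).prod E').level 0 → F.level 0) : Prop where
  /-- `f` is sc-smooth -/
  scSmooth : ScSmooth f
  /-- `f` is regularizing as a germ -/
  regularizing : ∀ m, ∃ ε > 0, ∀ e : ((ScBanach.const V).prod E').level m, ‖e‖ ≤ ε →
    F.InLevel (m + 1) (f (((ScBanach.const V).prod E').toZero m e)) →
    ∃ e' : ((ScBanach.const V).prod E').level (m + 1), ((ScBanach.const V).prod E').incl m e' = e
  /-- the conditions on the differentials in direction of `E'` -/
  linearization : ∃ (ε : ℕ → ℝ)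
      -- the induced maps `f(r, ·) : E'_m → F_m` and their differentials
      (fm : ∀ m, V → E'.level m → F.level m)
      (D : ∀ m, V → E'.level m → E'.level m →L[ℝ] F.level m),
    (∀ m, 0 < ε m) ∧
    (∀ m r e, F.toZero m (fm m r e) = f (r, E'.toZero m e)) ∧
    -- `f(r, ·)` is differentiable on the `ε_m`-ball of `E'_m`
    (∀ m r e, ‖r‖ < ε m → ‖e‖ < ε m → HasFDerivAt (fm m r) (D m r e) e) ∧
    -- the differential is continuous in `e` in operator norm, uniformly near `(0, 0)`
    (∀ m, ∀ δ > 0, ∃ η > 0, ∀ r e e', ‖r‖ < ε m → ‖e‖ < ε m → ‖e'‖ < ε m → ‖e - e'‖ < η →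
      ‖D m r e - D m r e'‖ ≤ δ) ∧
    -- the compactness condition on sequences
    (∀ m (r : ℕ → V) (e : ℕ → E'.level m), Tendsto r atTop (𝓝 0) → (∀ ν, ‖e ν‖ ≤ 1) →
      Tendsto (fun ν => ‖D m (r ν) 0 (e ν)‖) atTop (𝓝 0) →
      ∃ σ : ℕ → ℕ, StrictMono σ ∧ Tendsto (fun ν => ‖D m 0 0 (e (σ ν))‖) atTop (𝓝 0)) ∧
    -- the linearization at `(0, 0)` is a linear sc-Fredholm operator
    IsLinearScFredholm (D 0 0 0) ∧
    -- the linearizations at `(r, 0)` are Fredholm of the same index and weakly regularizing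
    (∀ r, ‖r‖ < ε 0 → (D 0 r 0).IsFredholm ∧
      fredholmIndex (D 0 r 0) = fredholmIndex (D 0 0 0) ∧
      ∀ h, D 0 r 0 h = 0 → E'.InLevel 1 h)

/-- The same property at a point `p`, obtained by translating `p` to `0`. -/
def IsScFredholmSplitAt {V : Type} [NormedAddCommGroup V] [NormedSpace ℝ V]
    [FiniteDimensional ℝ V] {E' F : ScBanach}
    (f : ((ScBanach.const V).prod E').level 0 → F.level 0)
    (p : ((ScBanach.const V).prod E').level 0) : Prop :=
  IsScFredholmSplit (V := V) (E' := E') (F := F) (fun e => f (e + p))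

/-- An sc-smooth section `S(p) = (p, s(p))` of the trivial bundle `(V ⊕ E') × F → V ⊕ E'` which is
sc-Fredholm with respect to the splitting `V ⊕ E'` at every smooth point. -/
structure IsScFredholmSectionSplit {V : Type} [NormedAddCommGroup V] [NormedSpace ℝ V]
    [FiniteDimensional ℝ V] {E' F : ScBanach}
    (S : ((ScBanach.const V).prod E').level 0 → (((ScBanach.const V).prod E').prod F).level 0) :
    Prop where
  isSection : ∀ p, (S p).1 = p
  scSmooth : ScSmooth S
  fredholm : ∀ p, ((ScBanach.const V).prod E').IsSmoothPoint p →
    IsScFredholmSplitAt (V := V) (E' := E') (F := F) (fun q => (S q).2) p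

/-! ### The sc-Fredholm property of Hofer, Wysocki and Zehnder

This is the definition for sections of a trivial bundle `E × F → E` over a scale space (no
boundary, no retractions, so that no filling is needed). -/

/-- The scale space `ℝᵃ ⊕ W`. -/
abbrev euclProd (a : ℕ) (W : ScBanach) : ScBanach :=
  (ScBanach.const (EuclideanSpace ℝ (Fin a))).prod W

/-- Basic germs `h : (ℝᵃ ⊕ W, 0) → (ℝᵇ ⊕ W, 0)`: the `W`-component is `w - B(c, w)`, where for every
level `m` and every `ε > 0` one has `‖B(c, w) - B(c, w')‖_m ≤ ε ‖w - w'‖_m` for all `(c, w)`, `(c, w')`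
sufficiently close to `0` on level `m`. -/
def IsBasicGerm {a b : ℕ} {W : ScBanach} (h : (euclProd a W).level 0 → (euclProd b W).level 0) :
    Prop :=
  h 0 = 0 ∧ ∀ m, ∀ ε > 0, ∃ δ > 0, ∀ (c : EuclideanSpace ℝ (Fin a)) (w w' : W.level m),
    ‖c‖ < δ → ‖w‖ < δ → ‖w'‖ < δ →
    ∃ z : W.level m,
      W.toZero m z = (W.toZero m w - (h (c, W.toZero m w)).2)
        - (W.toZero m w' - (h (c, W.toZero m w')).2) ∧
      ‖z‖ ≤ ε * ‖w - w'‖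

/-- `ψ : U → U'` is a sc-diffeomorphism between open sets, with inverse `χ`. -/
def IsScDiffeo {E G : ScBanach} (U : Set (E.level 0)) (U' : Set (G.level 0))
    (ψ : E.level 0 → G.level 0) (χ : G.level 0 → E.level 0) : Prop :=
  IsOpen U ∧ IsOpen U' ∧ Set.MapsTo ψ U U' ∧ Set.MapsTo χ U' U ∧ Set.InvOn χ ψ U U' ∧
    ScSmoothOn U ψ ∧ ScSmoothOn U' χ

/-- `(x, k) ↦ (ψ(x), Γ(x) k)`, with `Γ(x) : F → G` linear, is a strong bundle map on `U × F`: it is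
sc-smooth both for the filtration `U_m ⊕ F_m` and for the filtration `U_m ⊕ F_{m+1}`. -/
def IsStrongBundleMap {E F G : ScBanach} (U : Set (E.level 0))
    (Γ : E.level 0 → F.level 0 →ₗ[ℝ] G.level 0) : Prop :=
  ScSmoothOn (E := E.prod F) (F := G) {p | p.1 ∈ U} (fun p => Γ p.1 p.2) ∧
  ∃ Γ₁ : E.level 0 → F.level 1 → G.level 1,
    (∀ x ∈ U, ∀ k, G.incl 0 (Γ₁ x k) = Γ x (F.incl 0 k)) ∧
    ScSmoothOn (E := E.prod F.up) (F := G.up) {p | p.1 ∈ U} (fun p => Γ₁ p.1 p.2)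

/-- The germ at `0` of (the principal part) `f : E → F` is a sc-Fredholm germ: after subtracting a
local `sc⁺`-section `g` (a sc-smooth map into `F¹`) with `g(0) = f(0)`, it is conjugated to a basic
germ by a strong bundle isomorphism `(x, k) ↦ (ψ(x), Γ(x) k)` from a neighborhood `U` of `0` to a
neighborhood `U'` of `0 ∈ ℝᵃ ⊕ W`. -/
def IsHWZFredholmGerm {E F : ScBanach} (f : E.level 0 → F.level 0) : Prop :=
  ∃ (a b : ℕ) (W : ScBanach) (U : Set (E.level 0)) (U' : Set ((euclProd a W).level 0))
    (ψ : E.level 0 → (euclProd a W).level 0) (χ : (euclProd a W).level 0 → E.level 0)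
    (Γ : E.level 0 → F.level 0 →ₗ[ℝ] (euclProd b W).level 0)
    (Λ : (euclProd a W).level 0 → (euclProd b W).level 0 →ₗ[ℝ] F.level 0)
    (g : E.level 0 → F.level 1),
    (0 : E.level 0) ∈ U ∧ IsScDiffeo U U' ψ χ ∧ ψ 0 = 0 ∧
    IsStrongBundleMap U Γ ∧ IsStrongBundleMap U' Λ ∧
    (∀ x ∈ U, ∀ k, Λ (ψ x) (Γ x k) = k) ∧ (∀ y ∈ U', ∀ k, Γ (χ y) (Λ y k) = k) ∧
    ScSmoothOn (E := E) (F := F.up) U g ∧ F.incl 0 (g 0) = f 0 ∧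
    IsBasicGerm (fun y => Γ (χ y) (f (χ y) - F.incl 0 (g (χ y))))

/-- A sc-smooth section `S(p) = (p, s(p))` of the trivial bundle `E × F → E` is a sc-Fredholm section in
the sense of Hofer, Wysocki and Zehnder: it is regularizing, and its germ at every smooth point
(translated to `0`) is a sc-Fredholm germ. -/
structure IsHWZFredholmSection {E F : ScBanach} (S : E.level 0 → (E.prod F).level 0) : Prop where
  isSection : ∀ p, (S p).1 = p
  scSmooth : ScSmooth S
  regularizing : ∀ m (p : E.level m), F.InLevel (m + 1) (S (E.toZero m p)).2 →
    ∃ p' : E.level (m + 1), E.incl m p' = p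
  fredholm : ∀ p, E.IsSmoothPoint p → IsHWZFredholmGerm (E := E) (F := F) (fun q => (S (q + p)).2)

/-! ### Sobolev spaces on the circle -/

/-- The normalised Lebesgue measure on `S¹ = ℝ/ℤ`. -/
abbrev circleMeasure : Measure UnitAddCircle := AddCircle.haarAddCircle

/-- `L²(S¹, ℝⁿ)`. -/
abbrev L2 (n : ℕ) : Type := Lp (EuclideanSpace ℝ (Fin n)) 2 circleMeasure

/-- The derivative of a function on `S¹ = ℝ/ℤ`. -/
def circleDeriv (φ : UnitAddCircle → ℝ) (t : UnitAddCircle) : ℝ :=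
  deriv (fun s : ℝ => φ (t + (s : UnitAddCircle))) 0

/-- `y` is the weak derivative of `x`: `∫ φ' x = - ∫ φ y` for all smooth test functions `φ` on the
circle (smoothness being that of the lift to `ℝ`). -/
def IsWeakDeriv {n : ℕ} (x y : L2 n) : Prop :=
  ∀ φ : UnitAddCircle → ℝ, ContDiff ℝ ∞ (fun s : ℝ => φ (s : UnitAddCircle)) →
    ∫ t, circleDeriv φ t • x t ∂circleMeasure = - ∫ t, φ t • y t ∂circleMeasure

theorem continuous_of_lift {F : Type*} [TopologicalSpace F] {φ : UnitAddCircle → F}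
    (h : Continuous (fun s : ℝ => φ (s : UnitAddCircle))) : Continuous φ :=
  (QuotientAddGroup.isOpenQuotientMap_mk (N := AddSubgroup.zmultiples (1 : ℝ))).isQuotientMap.continuous_iff.2 h

theorem circleDeriv_coe (φ : UnitAddCircle → ℝ) (a : ℝ) :
    circleDeriv φ (a : UnitAddCircle) = deriv (fun s : ℝ => φ (s : UnitAddCircle)) a := by
  have := deriv_comp_const_add (fun s : ℝ => φ (s : UnitAddCircle)) a 0
  simpa [circleDeriv] using this

theorem continuous_circleDeriv {φ : UnitAddCircle → ℝ}
    (h : ContDiff ℝ ∞ (fun s : ℝ => φ (s : UnitAddCircle))) : Continuous (circleDeriv φ) := by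
  apply continuous_of_lift
  simp_rw [circleDeriv_coe]
  exact h.continuous_deriv (by simp)

theorem memLp_of_continuous {F : Type*} [NormedAddCommGroup F] [SecondCountableTopology F]
    {φ : UnitAddCircle → F} (h : Continuous φ) : MemLp φ 2 circleMeasure := by
  borelize F
  obtain ⟨C, hC⟩ := isCompact_univ.exists_bound_of_continuousOn h.continuousOn
  exact MemLp.of_bound h.measurable.aestronglyMeasurable C (ae_of_all _ fun t => hC t trivial)

/-- The continuous linear functional `x ↦ ∫ φ x` on `L²`. -/
def pairing {n : ℕ} {φ : UnitAddCircle → ℝ} (h : Continuous φ) :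
    L2 n →L[ℝ] EuclideanSpace ℝ (Fin n) :=
  (ContinuousLinearMap.lsmul ℝ ℝ).lpPairing circleMeasure 2 2 ((memLp_of_continuous h).toLp φ)

theorem pairing_apply {n : ℕ} {φ : UnitAddCircle → ℝ} (h : Continuous φ) (x : L2 n) :
    pairing h x = ∫ t, φ t • x t ∂circleMeasure := by
  rw [pairing, ContinuousLinearMap.lpPairing_eq_integral]
  apply integral_congr_ae
  filter_upwards [(memLp_of_continuous h).coeFn_toLp] with t ht
  simp [ht]

theorem isWeakDeriv_iff {n : ℕ} (x y : L2 n) : IsWeakDeriv x y ↔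
    ∀ (φ : UnitAddCircle → ℝ) (h : ContDiff ℝ ∞ (fun s : ℝ => φ (s : UnitAddCircle))),
      pairing (continuous_circleDeriv h) x = - pairing (continuous_of_lift h.continuous) y := by
  simp only [IsWeakDeriv, pairing_apply]

theorem IsWeakDeriv.zero {n : ℕ} : IsWeakDeriv (0 : L2 n) 0 := by
  rw [isWeakDeriv_iff]; intros; simp

theorem IsWeakDeriv.add {n : ℕ} {x y x' y' : L2 n} (h : IsWeakDeriv x y)
    (h' : IsWeakDeriv x' y') : IsWeakDeriv (x + x') (y + y') := by
  rw [isWeakDeriv_iff] at *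
  intro φ hφ
  rw [map_add, map_add, h φ hφ, h' φ hφ]; abel

theorem IsWeakDeriv.smul {n : ℕ} {x y : L2 n} (h : IsWeakDeriv x y) (c : ℝ) :
    IsWeakDeriv (c • x) (c • y) := by
  rw [isWeakDeriv_iff] at *
  intro φ hφ
  rw [map_smul, map_smul, h φ hφ, smul_neg]

theorem IsWeakDeriv.sum {n : ℕ} {ι : Type*} (s : Finset ι) {x y : ι → L2 n}
    (h : ∀ i ∈ s, IsWeakDeriv (x i) (y i)) : IsWeakDeriv (∑ i ∈ s, x i) (∑ i ∈ s, y i) := by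
  classical
  induction s using Finset.induction_on with
  | empty => simpa using IsWeakDeriv.zero
  | insert a s ha ih =>
    rw [Finset.sum_insert ha, Finset.sum_insert ha]
    exact (h a (by simp)).add (ih fun i hi => h i (by simp [hi]))

theorem isClosed_isWeakDeriv {n : ℕ} : IsClosed {p : L2 n × L2 n | IsWeakDeriv p.1 p.2} := by
  simp only [isWeakDeriv_iff, Set.ofPred_forall]
  refine isClosed_iInter fun φ => isClosed_iInter fun h => isClosed_eq ?_ ?_ <;> fun_prop

/-- The `i`-th component of an `ℝⁿ`-valued function, as a complex function. -/
def comp {n : ℕ} (i : Fin n) : L2 n →L[ℝ] Lp ℂ 2 circleMeasure :=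
  (Complex.ofRealCLM ∘L EuclideanSpace.proj (𝕜 := ℝ) i).compLpL 2 circleMeasure

/-- The function `Re z · eᵢ`. -/
def recomb {n : ℕ} (i : Fin n) : Lp ℂ 2 circleMeasure →L[ℝ] L2 n :=
  (Complex.reCLM.smulRight (EuclideanSpace.single i (1 : ℝ))).compLpL 2 circleMeasure

theorem comp_ae {n : ℕ} (i : Fin n) (x : L2 n) :
    comp i x =ᵐ[circleMeasure] fun t => ((x t i : ℝ) : ℂ) := by
  filter_upwards [ContinuousLinearMap.coeFn_compLpL (p := 2) (μ := circleMeasure)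
    (Complex.ofRealCLM ∘L EuclideanSpace.proj (𝕜 := ℝ) i) x] with t ht
  rw [comp, ht]; simp

theorem recomb_ae {n : ℕ} (i : Fin n) (z : Lp ℂ 2 circleMeasure) :
    recomb i z =ᵐ[circleMeasure] fun t => (z t).re • EuclideanSpace.single i (1 : ℝ) := by
  filter_upwards [ContinuousLinearMap.coeFn_compLpL (p := 2) (μ := circleMeasure)
    (Complex.reCLM.smulRight (EuclideanSpace.single i (1 : ℝ))) z] with t ht
  rw [recomb, ht]; simp

theorem sum_recomb_comp {n : ℕ} (x : L2 n) : ∑ i, recomb i (comp i x) = x := by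
  apply Lp.ext
  have h1 : ∀ᵐ t ∂circleMeasure, ∀ i, recomb i (comp i x) t =
      (comp i x t).re • EuclideanSpace.single i (1 : ℝ) :=
    ae_all_iff.2 fun i => recomb_ae i _
  have h2 : ∀ᵐ t ∂circleMeasure, ∀ i, comp i x t = ((x t i : ℝ) : ℂ) :=
    ae_all_iff.2 fun i => comp_ae i _
  filter_upwards [h1, h2, Lp.coeFn_finsetSum (μ := circleMeasure) Finset.univ
    (fun i => recomb i (comp i x))] with t h1 h2 h3
  rw [h3]
  ext j
  simp [h1, h2, Finset.sum_apply, Pi.single_apply]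

/-- The `k`-th Fourier mode. -/
abbrev mode (k : ℤ) : Lp ℂ 2 circleMeasure := fourierLp 2 k

/-- The `k`-th Fourier coefficient. -/
abbrev coef (k : ℤ) (z : Lp ℂ 2 circleMeasure) : ℂ := fourierBasis.repr z k

theorem coef_eq (k : ℤ) (z : Lp ℂ 2 circleMeasure) : coef k z =
    ∫ t, fourier (-k) t * z t ∂circleMeasure := by
  rw [coef, fourierBasis_repr, fourierCoeff]; rfl

theorem hasDerivAt_fourier_re_im (k : ℤ) (c : ℂ) (a : ℝ) :
    HasDerivAt (fun s : ℝ => (c * fourier k (s : UnitAddCircle)).re)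
      (c * (2 * Real.pi * Complex.I * k * fourier k (a : UnitAddCircle))).re a := by
  have h := (hasDerivAt_fourier 1 k a).const_mul c
  have h2 := (Complex.reCLM.hasFDerivAt (x := c * fourier k (a : UnitAddCircle))).comp_hasDerivAt a h
  simpa [Function.comp_def] using h2

theorem contDiff_fourier (k : ℤ) (c : ℂ) :
    ContDiff ℝ ∞ (fun s : ℝ => (c * fourier k (s : UnitAddCircle)).re) := by
  simp only [fourier_coe_apply]
  have : ContDiff ℝ ∞ (fun s : ℝ => c * Complex.exp (2 * Real.pi * Complex.I * k * s / (1 : ℝ))) := by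
    have h0 : ContDiff ℝ ∞ (fun s : ℝ => (s : ℂ)) := Complex.ofRealCLM.contDiff
    exact contDiff_const.mul ((((contDiff_const.mul h0).div_const _)).cexp)
  exact Complex.reCLM.contDiff.comp this


theorem circleDeriv_fourier (k : ℤ) (c : ℂ) (t : UnitAddCircle) :
    circleDeriv (fun t => (c * fourier k t).re) t
      = ((c * (2 * Real.pi * Complex.I * k)) * fourier k t).re := by
  induction t using QuotientAddGroup.induction_on with
  | H a =>
    have := (hasDerivAt_fourier_re_im k c a).deriv
    refine (circleDeriv_coe _ a).trans (this.trans ?_)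
    congr 1
    simp only [mul_assoc]

theorem integrable_comp {n : ℕ} (i : Fin n) (x : L2 n) (k : ℤ) :
    Integrable (fun t => fourier k t * comp i x t) circleMeasure := by
  have h : Integrable (comp i x : UnitAddCircle → ℂ) circleMeasure :=
    (Lp.memLp (comp i x)).integrable (by norm_num)
  exact h.fourier_smul k

theorem test_fourier {n : ℕ} (i : Fin n) (x : L2 n) (k : ℤ) (c : ℂ) :
    (∫ t, (c * fourier (-k) t).re • x t ∂circleMeasure) i = (c * coef k (comp i x)).re := by
  have hc : Continuous (fun t : UnitAddCircle => (c * fourier (-k) t).re) := by fun_prop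
  have hI : Integrable (fun t => (c * fourier (-k) t).re • x t) circleMeasure := by
    obtain ⟨C, hC⟩ := isCompact_univ.exists_bound_of_continuousOn hc.continuousOn
    have hx : Integrable (x : UnitAddCircle → EuclideanSpace ℝ (Fin n)) circleMeasure :=
      (Lp.memLp x).integrable (by norm_num)
    exact Integrable.bdd_smul (𝕜 := ℝ) (φ := fun t => (c * fourier (-k) t).re) hx C
      hc.aestronglyMeasurable (ae_of_all _ fun t => hC t trivial)
  have h1 := (EuclideanSpace.proj (𝕜 := ℝ) i).integral_comp_comm hI
  have h2 := Complex.reCLM.integral_comp_comm ((integrable_comp i x (-k)).const_mul c)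
  rw [coef_eq, ← integral_const_mul]
  refine Eq.trans h1.symm (Eq.trans ?_ h2)
  apply integral_congr_ae
  filter_upwards [comp_ae i x] with t ht
  simp only [ht, ← mul_assoc]
  simp

/-- Testing a weak derivative against a Fourier mode. -/
theorem IsWeakDeriv.coef {n : ℕ} {x y : L2 n} (h : IsWeakDeriv x y) (i : Fin n) (k : ℤ) :
    coef k (comp i y) = 2 * Real.pi * Complex.I * k * coef k (comp i x) := by
  have key : ∀ c : ℂ, (c * DelayScale.coef k (comp i y)).re =
      (c * (2 * Real.pi * Complex.I * k * DelayScale.coef k (comp i x))).re := by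
    intro c
    have h1 := congrArg (fun v => v i) (h (fun t => (c * fourier (-k) t).re) (contDiff_fourier (-k) c))
    simp only [circleDeriv_fourier, PiLp.neg_apply, test_fourier] at h1
    have h2 : c * (2 * Real.pi * Complex.I * k * DelayScale.coef k (comp i x)) =
      -(c * (2 * Real.pi * Complex.I * ((-k : ℤ) : ℂ)) * DelayScale.coef k (comp i x)) := by
      push_cast; ring
    rw [h2, Complex.neg_re, h1, neg_neg]
  apply Complex.ext
  · simpa using key 1
  · have := key (-Complex.I)
    simpa using this

theorem integral_circleDeriv {φ : UnitAddCircle → ℝ}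
    (h : ContDiff ℝ ∞ (fun s : ℝ => φ (s : UnitAddCircle))) :
    ∫ t, circleDeriv φ t ∂circleMeasure = 0 := by
  rw [AddCircle.integral_haarAddCircle, ← AddCircle.intervalIntegral_preimage 1 0]
  simp only [circleDeriv_coe]
  rw [intervalIntegral.integral_deriv_eq_sub]
  · have : ((0 + 1 : ℝ) : UnitAddCircle) = ((0 : ℝ) : UnitAddCircle) := by
      rw [zero_add]; simp
    rw [this, sub_self, smul_zero]
  · intro x _; exact h.differentiable (by simp) x
  · exact (h.continuous_deriv (by simp)).intervalIntegrable _ _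

theorem isWeakDeriv_mode {n : ℕ} (i : Fin n) (k : ℤ) (c : ℂ) :
    IsWeakDeriv (recomb i (c • mode k))
      (recomb i ((c * (2 * Real.pi * Complex.I * k)) • mode k)) := by
  have hm : ∀ c : ℂ, recomb i (c • mode k) =ᵐ[circleMeasure]
      fun t => (c * fourier k t).re • EuclideanSpace.single i (1 : ℝ) := by
    intro c
    filter_upwards [recomb_ae i (c • mode k), Lp.coeFn_smul c (mode k),
      coeFn_fourierLp (T := 1) 2 k] with t h1 h2 h3
    rw [h1, h2, Pi.smul_apply, h3, smul_eq_mul]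
  intro φ hφ
  have hφc := continuous_of_lift hφ.continuous
  have hφ' := continuous_circleDeriv hφ
  have e : ∀ (c : ℂ) (ψ : UnitAddCircle → ℝ),
      ∫ t, ψ t • recomb i (c • mode k) t ∂circleMeasure =
      (∫ t, ψ t * (c * fourier k t).re ∂circleMeasure) • EuclideanSpace.single i (1 : ℝ) := by
    intro c ψ
    rw [← integral_smul_const]
    apply integral_congr_ae
    filter_upwards [hm c] with t ht
    rw [ht, smul_smul]
  rw [e, e, ← neg_smul]
  congr 1
  have h0 := integral_circleDeriv (φ := fun t => φ t * (c * fourier k t).re)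
    (hφ.mul (contDiff_fourier k c))
  have h1 : ∀ t, circleDeriv (fun t => φ t * (c * fourier k t).re) t =
      circleDeriv φ t * (c * fourier k t).re
        + φ t * ((c * (2 * Real.pi * Complex.I * k)) * fourier k t).re := by
    intro t
    rw [← circleDeriv_fourier]
    induction t using QuotientAddGroup.induction_on with
    | H a =>
      have ha : DifferentiableAt ℝ (fun s : ℝ => φ (s : UnitAddCircle)) a :=
        hφ.differentiable (by simp) a
      have hb : DifferentiableAt ℝ (fun s : ℝ => (c * fourier k (s : UnitAddCircle)).re) a :=
        (contDiff_fourier k c).differentiable (by simp) a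
      have := deriv_mul ha hb
      rw [← circleDeriv_coe φ, ← circleDeriv_coe (fun t => (c * fourier k t).re)] at this
      refine (circleDeriv_coe _ a).trans this
  simp only [h1] at h0
  rw [integral_add] at h0
  · linarith
  · apply Continuous.integrable_of_hasCompactSupport
    · fun_prop
    · exact HasCompactSupport.of_compactSpace _
  · apply Continuous.integrable_of_hasCompactSupport
    · fun_prop
    · exact HasCompactSupport.of_compactSpace _

/-- Fourier truncation. -/
def trunc (N : ℕ) : Lp ℂ 2 circleMeasure →L[ℝ] Lp ℂ 2 circleMeasure :=
  ∑ k ∈ Finset.Icc (-N : ℤ) N,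
    ((innerSL ℂ (mode k)).smulRight (mode k)).restrictScalars ℝ

theorem trunc_apply (N : ℕ) (z : Lp ℂ 2 circleMeasure) :
    trunc N z = ∑ k ∈ Finset.Icc (-N : ℤ) N, coef k z • mode k := by
  simp [trunc, coef, HilbertBasis.repr_apply_apply, coe_fourierBasis]

theorem coef_trunc (N : ℕ) (z : Lp ℂ 2 circleMeasure) (k : ℤ) :
    coef k (trunc N z) = if k ∈ Finset.Icc (-N : ℤ) N then coef k z else 0 := by
  rw [trunc_apply]
  have ho := orthonormal_iff_ite.1 (orthonormal_fourier (T := 1))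
  simp only [coef, HilbertBasis.repr_apply_apply, coe_fourierBasis, inner_sum, inner_smul_right,
    mode, ho]
  simp

theorem norm_sq_eq (z : Lp ℂ 2 circleMeasure) : HasSum (fun k => ‖coef k z‖ ^ 2) (‖z‖ ^ 2) := by
  have := hasSum_sq_fourierCoeff (T := 1) z
  simp only [← fourierBasis_repr] at this
  convert this using 1
  rw [← tsum_sq_fourierCoeff]
  simp only [← fourierBasis_repr]
  have h := lp.norm_rpow_eq_tsum (p := 2) (by norm_num) (fourierBasis.repr z)
  simpa using h

theorem norm_sub_trunc_le {z w : Lp ℂ 2 circleMeasure}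
    (h : ∀ k, coef k w = 2 * Real.pi * Complex.I * k * coef k z) (N : ℕ) :
    ‖z - trunc N z‖ ≤ (1 / (N + 1 : ℝ)) * ‖w‖ := by
  have h1 := norm_sq_eq (z - trunc N z)
  have h2 := (norm_sq_eq w).mul_left ((1 / (N + 1 : ℝ)) ^ 2)
  simp only [← mul_pow] at h2
  refine le_of_pow_le_pow_left₀ two_ne_zero (by positivity) (hasSum_le ?_ h1 h2)
  intro k
  have hk : coef k (z - trunc N z) = coef k z - coef k (trunc N z) := by
    simp [coef]
  rw [hk, coef_trunc]
  split_ifs with hkN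
  · simp; positivity
  · rw [sub_zero]
    have hN : (N + 1 : ℝ) ≤ |(k : ℝ)| := by
      have : (N + 1 : ℤ) ≤ |k| := by
        rw [Finset.mem_Icc, not_and_or] at hkN
        rcases hkN with h | h
        · rw [not_le] at h; have := neg_le_abs k; omega
        · rw [not_le] at h; have := le_abs_self k; omega
      exact_mod_cast this
    have hpi : (1 : ℝ) ≤ 2 * Real.pi := by linarith [Real.pi_gt_three]
    have hw : ‖coef k w‖ = 2 * Real.pi * |(k : ℝ)| * ‖coef k z‖ := by
      rw [h k]; simp [abs_of_pos Real.pi_pos]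
    have hw2 : (N + 1 : ℝ) * ‖coef k z‖ ≤ ‖coef k w‖ := by
      rw [hw]
      gcongr
      nlinarith [abs_nonneg (k : ℝ)]
    gcongr
    rw [one_div, inv_mul_eq_div, le_div_iff₀ (by positivity)]
    linarith

theorem tendsto_trunc (z : Lp ℂ 2 circleMeasure) :
    Tendsto (fun N : ℕ => trunc N z) atTop (𝓝 z) := by
  have h : HasSum (fun k => coef k z • mode k) z := by
    simpa [coef, mode, fourierBasis_repr] using hasSum_fourier_series_L2 z
  have hN : Tendsto (fun N : ℕ => Finset.Icc (-N : ℤ) N) atTop atTop := by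
    refine tendsto_atTop_finset_of_monotone ?_ ?_
    · intro a b hab
      apply Finset.Icc_subset_Icc <;> omega
    · intro k
      refine ⟨k.natAbs, ?_⟩
      rw [Finset.mem_Icc]; omega
  simpa only [trunc_apply, Function.comp_def] using h.comp hN

theorem isCompact_trunc (N : ℕ) : IsCompactOperator (trunc N) := by
  have : trunc N ∈ compactOperator (RingHom.id ℝ) (Lp ℂ 2 circleMeasure) (Lp ℂ 2 circleMeasure) := by
    refine Submodule.sum_mem _ fun k _ => ?_
    change IsCompactOperator _
    have h1 : IsCompactOperator (id : ℂ → ℂ) := isCompactOperator_id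
    exact (h1.clm_comp ((ContinuousLinearMap.toSpanSingleton ℂ (mode k)).restrictScalars ℝ)).comp_clm
      ((innerSL ℂ (mode k)).restrictScalars ℝ)
  exact this

/-- Fourier truncation of vector valued functions. -/
def vtrunc (n N : ℕ) : L2 n →L[ℝ] L2 n := ∑ i, recomb i ∘L trunc N ∘L comp i

theorem vtrunc_apply {n : ℕ} (N : ℕ) (x : L2 n) :
    vtrunc n N x = ∑ i, recomb i (trunc N (comp i x)) := by
  simp [vtrunc]

theorem isCompact_vtrunc (n N : ℕ) : IsCompactOperator (vtrunc n N) := by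
  have : vtrunc n N ∈ compactOperator (RingHom.id ℝ) (L2 n) (L2 n) := by
    refine Submodule.sum_mem _ fun i _ => ?_
    exact ((isCompact_trunc N).comp_clm (comp i)).clm_comp (recomb i)
  exact this

theorem tendsto_vtrunc {n : ℕ} (x : L2 n) :
    Tendsto (fun N : ℕ => vtrunc n N x) atTop (𝓝 x) := by
  have : Tendsto (fun N : ℕ => ∑ i, recomb i (trunc N (comp i x))) atTop
      (𝓝 (∑ i, recomb i (comp i x))) :=
    tendsto_finsetSum _ fun i _ => ((recomb i).continuous.tendsto _).comp (tendsto_trunc _)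
  simpa only [sum_recomb_comp, ← vtrunc_apply] using this

theorem exists_norm_sub_vtrunc_le (n : ℕ) : ∃ C : ℝ, ∀ (x y : L2 n), IsWeakDeriv x y → ∀ N : ℕ,
    ‖x - vtrunc n N x‖ ≤ C / (N + 1 : ℝ) * ‖y‖ := by
  refine ⟨∑ i : Fin n, ‖(recomb i : Lp ℂ 2 circleMeasure →L[ℝ] L2 n)‖ *
    ‖(comp i : L2 n →L[ℝ] Lp ℂ 2 circleMeasure)‖, fun x y h N => ?_⟩
  have e : x - vtrunc n N x = ∑ i, recomb i (comp i x - trunc N (comp i x)) := by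
    simp only [map_sub, Finset.sum_sub_distrib, sum_recomb_comp, vtrunc_apply]
  rw [e, Finset.sum_div, Finset.sum_mul]
  refine norm_sum_le_of_le _ fun i _ => ?_
  calc _ ≤ ‖(recomb i : Lp ℂ 2 circleMeasure →L[ℝ] L2 n)‖ * ‖comp i x - trunc N (comp i x)‖ :=
        (recomb i).le_opNorm _
    _ ≤ ‖(recomb i : Lp ℂ 2 circleMeasure →L[ℝ] L2 n)‖ * ((1 / (N + 1 : ℝ)) *
        (‖(comp i : L2 n →L[ℝ] Lp ℂ 2 circleMeasure)‖ * ‖y‖)) := by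
        gcongr
        refine (norm_sub_trunc_le (fun k => h.coef i k) N).trans ?_
        gcongr
        exact (comp i).le_opNorm _
    _ = _ := by ring

theorem exists_isWeakDeriv_vtrunc {n : ℕ} (N : ℕ) (x : L2 n) :
    ∃ y, IsWeakDeriv (vtrunc n N x) y := by
  simp only [vtrunc_apply, trunc_apply, map_sum]
  exact ⟨_, IsWeakDeriv.sum _ fun i _ => IsWeakDeriv.sum _ fun k _ => isWeakDeriv_mode i k _⟩

theorem IsWeakDeriv.vtrunc {n : ℕ} {x y : L2 n} (h : IsWeakDeriv x y) (N : ℕ) :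
    IsWeakDeriv (vtrunc n N x) (vtrunc n N y) := by
  simp only [vtrunc_apply, trunc_apply, map_sum]
  refine IsWeakDeriv.sum _ fun i _ => IsWeakDeriv.sum _ fun k _ => ?_
  rw [h.coef, mul_comm]
  exact isWeakDeriv_mode i k _

/-- Weak derivatives are unique. -/
theorem IsWeakDeriv.unique {n : ℕ} {x y y' : L2 n} (h : IsWeakDeriv x y) (h' : IsWeakDeriv x y') :
    y = y' := by
  rw [← sum_recomb_comp y, ← sum_recomb_comp y']
  refine Finset.sum_congr rfl fun i _ => congrArg _ ?_
  apply fourierBasis.repr.injective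
  ext k
  exact (h.coef i k).trans (h'.coef i k).symm

/-- A function with a weak derivative in `L²` has a continuous representative. -/
theorem IsWeakDeriv.exists_continuous {n : ℕ} {x y : L2 n} (h : IsWeakDeriv x y) :
    ∃ g : UnitAddCircle → EuclideanSpace ℝ (Fin n), Continuous g ∧ x =ᵐ[circleMeasure] g := by
  have key : ∀ i, ∃ f : C(UnitAddCircle, ℂ), comp i x = ContinuousMap.toLp 2 circleMeasure ℂ f := by
    intro i
    have hs : Summable fun k : ℤ => DelayScale.coef k (comp i x) • (fourier k : C(UnitAddCircle, ℂ)) := by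
      have h1 := (norm_sq_eq (comp i y)).summable
      have h2 : Summable (fun k : ℤ => 1 / (k : ℝ) ^ 2) := Real.summable_one_div_int_pow.2 (by norm_num)
      refine Summable.of_norm_bounded_eventually (h1.add h2) ?_
      rw [Filter.eventually_cofinite]
      refine (Set.finite_singleton (0 : ℤ)).subset fun k hk => ?_
      by_contra hk0
      apply hk
      have hk0' : (0 : ℝ) < |(k : ℝ)| := by
        have : k ≠ 0 := hk0
        positivity
      rw [norm_smul, fourier_norm, mul_one]
      have hw : ‖DelayScale.coef k (comp i y)‖
          = 2 * Real.pi * |(k : ℝ)| * ‖DelayScale.coef k (comp i x)‖ := by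
        rw [h.coef]; simp [abs_of_pos Real.pi_pos]
      have hpi := Real.pi_gt_three
      have hz := norm_nonneg (DelayScale.coef k (comp i x))
      rw [hw, ← sq_abs (k : ℝ)]
      set a := |(k : ℝ)|
      set z := ‖DelayScale.coef k (comp i x)‖
      have h3 : (a * z) ^ 2 ≤ (2 * Real.pi * a * z) ^ 2 := by
        apply pow_le_pow_left₀ (by positivity)
        nlinarith [mul_nonneg hk0'.le hz]
      have h4 : z = (a * z) * (1 / a) := by field_simp
      have h5 : 1 / a ^ 2 = (1 / a) ^ 2 := by ring
      rw [h5]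
      nlinarith [sq_nonneg (a * z - 1 / a), sq_nonneg (a * z), sq_nonneg (1 / a)]
    refine ⟨∑' k : ℤ, DelayScale.coef k (comp i x) • (fourier k : C(UnitAddCircle, ℂ)), ?_⟩
    have h1 := hs.hasSum.mapL (ContinuousMap.toLp 2 circleMeasure ℂ)
    have h2 : HasSum (fun k => DelayScale.coef k (comp i x) • mode k) (comp i x) := by
      simpa [DelayScale.coef, mode, fourierBasis_repr] using hasSum_fourier_series_L2 (comp i x)
    refine h2.unique ?_
    simpa [fourierLp] using h1
  choose f hf using key
  refine ⟨fun t => WithLp.toLp 2 fun i => (f i t).re, by fun_prop, ?_⟩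
  have h1 : ∀ᵐ t ∂circleMeasure, ∀ i, comp i x t = ((x t i : ℝ) : ℂ) :=
    ae_all_iff.2 fun i => comp_ae i _
  have h2 : ∀ᵐ t ∂circleMeasure, ∀ i, comp i x t = f i t :=
    ae_all_iff.2 fun i => by
      rw [hf i]; exact ContinuousMap.coeFn_toLp (𝕜 := ℂ) circleMeasure (f i)
  filter_upwards [h1, h2] with t h1 h2
  ext i
  simp [← h2, h1]


/-- The Sobolev space `W^{m,2}(S¹, ℝⁿ)` with its Hilbert norm `(∑_{j ≤ m} ‖∂ʲx‖²)^{1/2}`. An element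
`x ∈ L²` with weak derivatives `∂x, …, ∂ᵐx ∈ L²` is represented by the tuple
`(x, ∂x, …, ∂ᵐx)`, which it determines. -/
def sobolev (n m : ℕ) : Submodule ℝ (PiLp 2 (fun _ : Fin (m + 1) => L2 n)) where
  carrier := {x | ∀ j : Fin m, IsWeakDeriv (x j.castSucc) (x j.succ)}
  zero_mem' := fun _ => IsWeakDeriv.zero
  add_mem' := fun hx hy j => (hx j).add (hy j)
  smul_mem' := fun c _ hx j => (hx j).smul c

theorem isClosed_sobolev (n m : ℕ) :
    IsClosed (sobolev n m : Set (PiLp 2 (fun _ : Fin (m + 1) => L2 n))) := by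
  have : (sobolev n m : Set (PiLp 2 (fun _ : Fin (m + 1) => L2 n))) =
      ⋂ j : Fin m, (fun x : PiLp 2 (fun _ : Fin (m + 1) => L2 n) => (x j.castSucc, x j.succ)) ⁻¹'
        {p : L2 n × L2 n | IsWeakDeriv p.1 p.2} := by
    ext x; simp only [Set.mem_iInter]; rfl
  rw [this]
  exact isClosed_iInter fun j => isClosed_isWeakDeriv.preimage
    ((PiLp.continuous_apply 2 (fun _ : Fin (m + 1) => L2 n) _).prodMk
      (PiLp.continuous_apply 2 (fun _ : Fin (m + 1) => L2 n) _))

instance (n m : ℕ) : CompleteSpace (sobolev n m) :=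
  (isClosed_sobolev n m).completeSpace_coe

/-- Forgetting the top derivative, as a map of tuples. -/
def dropLast (n m : ℕ) :
    PiLp 2 (fun _ : Fin (m + 2) => L2 n) →L[ℝ] PiLp 2 (fun _ : Fin (m + 1) => L2 n) :=
  (PiLp.continuousLinearEquiv 2 ℝ (fun _ : Fin (m + 1) => L2 n)).symm.toContinuousLinearMap ∘L
    ContinuousLinearMap.pi fun j : Fin (m + 1) =>
      PiLp.proj 2 (fun _ : Fin (m + 2) => L2 n) j.castSucc

@[simp] theorem dropLast_apply (n m : ℕ) (x : PiLp 2 (fun _ : Fin (m + 2) => L2 n))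
    (j : Fin (m + 1)) : dropLast n m x j = x j.castSucc := rfl

/-- The inclusion `W^{m+1,2} ⊆ W^{m,2}`. -/
def sobolevIncl (n m : ℕ) : sobolev n (m + 1) →L[ℝ] sobolev n m :=
  (dropLast n m ∘L (sobolev n (m + 1)).subtypeL).codRestrict (sobolev n m)
    fun x j => x.2 j.castSucc

/-- The weak derivative `∂ : W^{m+1,2} → W^{m,2}`. -/
def sobolevDeriv (n m : ℕ) : sobolev n (m + 1) →L[ℝ] sobolev n m :=
  (((PiLp.continuousLinearEquiv 2 ℝ (fun _ : Fin (m + 1) => L2 n)).symm.toContinuousLinearMap ∘L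
    ContinuousLinearMap.pi fun j : Fin (m + 1) =>
      PiLp.proj 2 (fun _ : Fin (m + 2) => L2 n) j.succ) ∘L
    (sobolev n (m + 1)).subtypeL).codRestrict (sobolev n m) fun x j => x.2 j.succ

theorem sobolevIncl_apply (n m : ℕ) (x : sobolev n (m + 1)) (j : Fin (m + 1)) :
    (sobolevIncl n m x).1 j = x.1 j.castSucc := rfl

theorem sobolevIncl_injective (n m : ℕ) : Function.Injective (sobolevIncl n m) := by
  intro x y h
  have h' : ∀ j : Fin (m + 1), x.1 j.castSucc = y.1 j.castSucc := fun j => by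
    rw [← sobolevIncl_apply, h, sobolevIncl_apply]
  apply Subtype.ext
  ext1 j
  induction j using Fin.lastCases with
  | cast j => exact h' j
  | last =>
    have hx : IsWeakDeriv (x.1 (Fin.last m).castSucc) (x.1 (Fin.last (m + 1))) := x.2 (Fin.last m)
    have hy : IsWeakDeriv (y.1 (Fin.last m).castSucc) (y.1 (Fin.last (m + 1))) := y.2 (Fin.last m)
    rw [h'] at hx
    exact hx.unique hy

/-- Fourier truncation of tuples. -/
def ptrunc (n m N : ℕ) :
    PiLp 2 (fun _ : Fin (m + 1) => L2 n) →L[ℝ] PiLp 2 (fun _ : Fin (m + 1) => L2 n) :=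
  (PiLp.continuousLinearEquiv 2 ℝ (fun _ : Fin (m + 1) => L2 n)).symm.toContinuousLinearMap ∘L
    ContinuousLinearMap.pi fun j : Fin (m + 1) =>
      vtrunc n N ∘L PiLp.proj 2 (fun _ : Fin (m + 1) => L2 n) j

@[simp] theorem ptrunc_apply (n m N : ℕ) (x : PiLp 2 (fun _ : Fin (m + 1) => L2 n))
    (j : Fin (m + 1)) : ptrunc n m N x j = vtrunc n N (x j) := rfl

theorem isCompact_ptrunc (n m N : ℕ) : IsCompactOperator (ptrunc n m N) := by
  have h : IsCompactOperator (ContinuousLinearMap.pi fun j : Fin (m + 1) =>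
      vtrunc n N ∘L PiLp.proj 2 (𝕜 := ℝ) (fun _ : Fin (m + 1) => L2 n) j) := by
    have e : (ContinuousLinearMap.pi fun j : Fin (m + 1) =>
        vtrunc n N ∘L PiLp.proj 2 (𝕜 := ℝ) (fun _ : Fin (m + 1) => L2 n) j) =
        ∑ j, ContinuousLinearMap.single ℝ (fun _ : Fin (m + 1) => L2 n) j ∘L
          vtrunc n N ∘L PiLp.proj 2 (𝕜 := ℝ) (fun _ : Fin (m + 1) => L2 n) j := by
      ext1 x
      funext j
      simp [Finset.sum_apply, Pi.single_apply]
    rw [e]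
    change _ ∈ compactOperator (RingHom.id ℝ) (PiLp 2 (fun _ : Fin (m + 1) => L2 n))
      (Fin (m + 1) → L2 n)
    refine Submodule.sum_mem _ fun j _ => ?_
    exact ((isCompact_vtrunc n N).comp_clm
      (PiLp.proj 2 (𝕜 := ℝ) (fun _ : Fin (m + 1) => L2 n) j)).clm_comp
      (ContinuousLinearMap.single ℝ (fun _ : Fin (m + 1) => L2 n) j)
  exact h.clm_comp
    (PiLp.continuousLinearEquiv 2 ℝ (fun _ : Fin (m + 1) => L2 n)).symm.toContinuousLinearMap

theorem isCompact_sobolevIncl (n m : ℕ) : IsCompactOperator (sobolevIncl n m) := by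
  set T : sobolev n (m + 1) →L[ℝ] PiLp 2 (fun _ : Fin (m + 1) => L2 n) :=
    dropLast n m ∘L (sobolev n (m + 1)).subtypeL with hT
  suffices h : IsCompactOperator T from
    h.codRestrict (V := sobolev n m) (fun x j => x.2 j.castSucc) (isClosed_sobolev n m)
  obtain ⟨C, hC⟩ := exists_norm_sub_vtrunc_le n
  have hC0 : 0 ≤ |C| := abs_nonneg C
  have hlim : Tendsto (fun N : ℕ => ptrunc n m N ∘L T) atTop (𝓝 T) := by
    refine (tendsto_iff_norm_sub_tendsto_zero
      (E := sobolev n (m + 1) →L[ℝ] PiLp 2 (fun _ : Fin (m + 1) => L2 n))).2 ?_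
    have hb : ∀ N : ℕ, ‖ptrunc n m N ∘L T - T‖ ≤ ((m + 1 : ℕ) : ℝ) * |C| * (1 / ((N : ℝ) + 1)) := by
      intro N
      refine ContinuousLinearMap.opNorm_le_bound _ (by positivity) fun x => ?_
      have hx : ∀ j, ‖(ptrunc n m N (T x) - T x) j‖ ≤ |C| * (1 / ((N : ℝ) + 1)) * ‖x‖ := by
        intro j
        have h1 := hC _ _ (x.2 j) N
        have h2 : ‖x.1 j.succ‖ ≤ ‖x‖ := PiLp.norm_apply_le x.1 j.succ
        rw [PiLp.sub_apply, norm_sub_rev, ptrunc_apply]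
        refine h1.trans ?_
        have h3 : C / ((N : ℝ) + 1) ≤ |C| * (1 / ((N : ℝ) + 1)) := by
          rw [mul_one_div]; gcongr; exact le_abs_self C
        gcongr
      rw [_root_.sub_apply, ContinuousLinearMap.comp_apply]
      have hs : ‖ptrunc n m N (T x) - T x‖ ≤ ∑ j, ‖(ptrunc n m N (T x) - T x) j‖ := by
        rw [PiLp.norm_eq_of_L2]
        refine Real.sqrt_le_iff.2 ⟨by positivity, ?_⟩
        exact Finset.sum_sq_le_sq_sum_of_nonneg fun i _ => norm_nonneg _
      refine hs.trans ((Finset.sum_le_sum fun j _ => hx j).trans (le_of_eq ?_))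
      simp; ring
    have h0 : Tendsto (fun N : ℕ => ((m + 1 : ℕ) : ℝ) * |C| * (1 / ((N : ℝ) + 1))) atTop (𝓝 0) := by
      simpa using (tendsto_one_div_add_atTop_nhds_zero_nat (𝕜 := ℝ)).const_mul
        (((m + 1 : ℕ) : ℝ) * |C|)
    exact squeeze_zero (fun _ => by positivity) hb h0
  exact isCompactOperator_of_tendsto hlim
    (Eventually.of_forall fun N => (isCompact_ptrunc n m N).comp_clm T)

theorem denseRange_sobolevIncl (n m : ℕ) : DenseRange (sobolevIncl n m) := by
  intro x
  have hmem : ∀ N : ℕ, ptrunc n m N x.1 ∈ sobolev n m := fun N j => (x.2 j).vtrunc N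
  have hlim : Tendsto (fun N : ℕ => (⟨ptrunc n m N x.1, hmem N⟩ : sobolev n m)) atTop (𝓝 x) := by
    rw [tendsto_subtype_rng]
    have h : Tendsto (fun N : ℕ => fun j => vtrunc n N (x.1 j)) atTop (𝓝 fun j => x.1 j) :=
      tendsto_pi_nhds.2 fun j => tendsto_vtrunc _
    exact ((PiLp.continuous_toLp 2 (fun _ : Fin (m + 1) => L2 n)).tendsto _).comp h
  refine mem_closure_of_tendsto hlim (Eventually.of_forall fun N => ?_)
  obtain ⟨y, hy⟩ := exists_isWeakDeriv_vtrunc N (x.1 (Fin.last m))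
  refine ⟨⟨WithLp.toLp 2 (Fin.snoc (α := fun _ => L2 n) (fun j => vtrunc n N (x.1 j)) y), ?_⟩, ?_⟩
  · intro j
    induction j using Fin.lastCases with
    | cast j =>
      have := (x.2 j).vtrunc N
      simpa [← Fin.castSucc_succ] using this
    | last => simpa using hy
  · apply Subtype.ext
    ext1 j
    simp [sobolevIncl_apply]

/-- The sc-Hilbert space `H = (W^{m,2}(S¹, ℝⁿ))_m`. -/
def sobolevScale (n : ℕ) : ScBanach where
  level m := sobolev n m
  incl m := sobolevIncl n m
  incl_injective := sobolevIncl_injective n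
  incl_compact := isCompact_sobolevIncl n
  incl_dense := denseRange_sobolevIncl n

/-! ### The delay equation -/

/-- A smooth time-dependent vector field `X : S¹ × ℝⁿ → ℝⁿ`. -/
structure TimeVectorField (n : ℕ) where
  toFun : UnitAddCircle → EuclideanSpace ℝ (Fin n) → EuclideanSpace ℝ (Fin n)
  smooth : ContDiff ℝ ∞
    (fun p : ℝ × EuclideanSpace ℝ (Fin n) => toFun (p.1 : UnitAddCircle) p.2)

theorem TimeVectorField.continuous {n : ℕ} (X : TimeVectorField n) :
    Continuous (fun p : UnitAddCircle × EuclideanSpace ℝ (Fin n) => X.toFun p.1 p.2) := by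
  have hq := (QuotientAddGroup.isOpenQuotientMap_mk
    (N := AddSubgroup.zmultiples (1 : ℝ))).prodMap
      (IsOpenQuotientMap.id (X := EuclideanSpace ℝ (Fin n)))
  exact hq.isQuotientMap.continuous_iff.2 X.smooth.continuous

/-- For `x ∈ W^{1,2}` the function `t ↦ X_t(x(t - τ))` is in `L²`, because `x` is bounded. -/
theorem memLp_delay {n : ℕ} (X : TimeVectorField n) (τ : ℝ) (x : sobolev n 1) :
    MemLp (fun t => X.toFun t (x.1 0 (t - (τ : UnitAddCircle)))) 2 circleMeasure := by
  obtain ⟨g, hg, hx⟩ := IsWeakDeriv.exists_continuous (x.2 0)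
  have hc : Continuous (fun t => X.toFun t (g (t - (τ : UnitAddCircle)))) :=
    X.continuous.comp (continuous_id.prodMk (hg.comp (continuous_id.sub continuous_const)))
  refine (memLp_of_continuous hc).ae_eq ?_
  have hs := (measurePreserving_sub_right circleMeasure (τ : UnitAddCircle)).quasiMeasurePreserving
  filter_upwards [hs.ae_eq_comp hx] with t ht
  simp only [Function.comp_apply] at ht
  exact congrArg (X.toFun t) ht.symm

/-- `X(x(· - τ))`, that is `t ↦ X_t(x(t - τ))`, as an element of `L²`. -/
def delayTerm {n : ℕ} (X : TimeVectorField n) (τ : ℝ) (x : sobolev n 1) : L2 n :=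
  (memLp_delay X τ x).toLp _

/-- `L²` as the bottom level of the Sobolev scale. -/
def ofL2 {n : ℕ} (y : L2 n) : sobolev n 0 := ⟨WithLp.toLp 2 fun _ => y, fun j => j.elim0⟩

/-- The sc-Hilbert space `ℝ × H¹`, with levels `ℝ × W^{m+1,2}(S¹, ℝⁿ)`. -/
abbrev delayBase (n : ℕ) : ScBanach := (ScBanach.const ℝ).prod (sobolevScale n).up

/-- The map `s(τ, x) = ∂ₜx - X(x(· - τ))` from `ℝ × W^{1,2}` to `L²`. -/
def delayMap {n : ℕ} (X : TimeVectorField n) (p : ℝ × sobolev n 1) : sobolev n 0 :=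
  sobolevDeriv n 0 p.2 - ofL2 (delayTerm X p.1 p.2)

/-- The section `S(τ, x) = (τ, x, ∂ₜx - X(x(· - τ)))` of the trivial bundle
`ℝ × H¹ × H → ℝ × H¹`. -/
def delaySection {n : ℕ} (X : TimeVectorField n) (p : (delayBase n).level 0) :
    ((delayBase n).prod (sobolevScale n)).level 0 :=
  (p, delayMap X p)

end DelayScale

end

noncomputable section

namespace DelayScale

/-! ### Linear sc-operators -/

/-! The only difficulty is the dependence on the delay: differentiating `x(· - τ)` in `τ` produces
`-∂x(· - τ)`, which costs one derivative, so the delay term need not be classically differentiable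
on a fixed Sobolev level. The sc-calculus permits exactly this loss.

For sc-smoothness the delay term is put into a class closed under taking tangents: the operators
`delayS`, `(c, y) ↦ Y_t(c, y(t - ℓ(c)))`, with `Y` any smooth family over the circle, `c` in a
finite dimensional space `V` and `ℓ` a linear form. The differential at `(c, y)` in direction `(c',
h)` is `DY_t(c, y)(c', h - ℓ(c') ∂y)`, evaluated at `t - ℓ(c)`. This is again such an operator, with
parameter `(c, c')` and function `(y, h, ∂y)`. Hence continuity on all levels (`exists_delayS`) and
one differentiation (`hasDerivAt_delayS_path`) give all orders by induction (`scContDiffOn_delayS`),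
and no general chain rule for sc-maps is needed. Continuity on a level is an induction of the same
kind, since the `t`-derivative is an operator of the class applied to `(y, ∂y)`; at the bottom it
rests on the strong continuity of translations in `L²`. Derivatives of paths are computed pointwise
in `t`. They give an sc-differential because the inclusion of levels is compact, which turns joint
continuity of `(x, h) ↦ df(x) h` into the required uniformity (`isLittleO_of_hasDerivAt_path`).

For the Fredholm property with respect to the splitting the delay is frozen, and then no derivative
is lost: `s(τ, ·)` is classically differentiable with differential `∂ - Ψ_τ ∘ incl`, where `Ψ_τ` is
bounded on the target level and strongly continuous in `τ`. Compactness of the inclusion upgrades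
strong continuity to uniformity on bounded sets, which is behind conditions (a) and (b). On `L²` one
writes `∂ - Ψ ∘ incl = (∂ + 1) - (1 + Ψ) ∘ incl`; here `∂ + 1` is an isomorphism by Fourier series
and the second term is a norm limit of finite rank operators, so the index is zero
(`isFredholm_deriv_sub`). Regularity is read off from `∂x = s(τ, x) + X(x(· - τ))`, and a Fredholm
operator that is regularizing on all levels is sc-Fredholm (`isLinearScFredholm_of_regularizing`).

For the Hofer-Wysocki-Zehnder property, the delay term maps `ℝ × H²` sc-smoothly into `H² = (H¹)¹`,
so it can be absorbed into an `sc⁺`-section. That section can be chosen so that the linear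
isomorphism `∂ + 1` is all that remains; used as a chart, this isomorphism makes the germ the
projection `(c, w) ↦ w`, which is basic with `B = 0`. -/

theorem ScBanach.toZero_injective (E : ScBanach) : ∀ m, Function.Injective (E.toZero m)
  | 0 => Function.injective_id
  | m + 1 => (E.toZero_injective m).comp (E.incl_injective m)

theorem ScBanach.toZero_prod (E F : ScBanach) :
    ∀ m (x : E.level m) (y : F.level m), (E.prod F).toZero m (x, y) = (E.toZero m x, F.toZero m y)
  | 0, _, _ => rfl
  | m + 1, x, y => ScBanach.toZero_prod E F m (E.incl m x) (F.incl m y)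

theorem ScBanach.toZero_const (V : Type) [NormedAddCommGroup V] [NormedSpace ℝ V]
    [FiniteDimensional ℝ V] : ∀ m (x : V), (ScBanach.const V).toZero m x = x
  | 0, _ => rfl
  | m + 1, x => ScBanach.toZero_const V m x

/-- A linear sc-operator: a compatible family of bounded operators between the levels. -/
structure ScLin (E F : ScBanach) where
  map : ∀ m, E.level m →L[ℝ] F.level m
  comm : ∀ m x, F.incl m (map (m + 1) x) = map m (E.incl m x)

theorem ScLin.toZero_map {E F : ScBanach} (L : ScLin E F) :
    ∀ m (x : E.level m), F.toZero m (L.map m x) = L.map 0 (E.toZero m x)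
  | 0, _ => rfl
  | m + 1, x => by
    change F.toZero m (F.incl m (L.map (m + 1) x)) = L.map 0 (E.toZero m (E.incl m x))
    rw [L.comm, L.toZero_map m]

namespace ScLin

variable {E F G : ScBanach}

def id (E : ScBanach) : ScLin E E := ⟨fun _ => ContinuousLinearMap.id ℝ _, fun _ _ => rfl⟩

def comp (L : ScLin F G) (M : ScLin E F) : ScLin E G :=
  ⟨fun m => (L.map m).comp (M.map m), fun m x => by
    change G.incl m (L.map (m + 1) (M.map (m + 1) x)) = L.map m (M.map m (E.incl m x))
    rw [L.comm, M.comm]⟩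

def fst (E F : ScBanach) : ScLin (E.prod F) E :=
  ⟨fun m => ContinuousLinearMap.fst ℝ (E.level m) (F.level m), fun _ _ => rfl⟩

def snd (E F : ScBanach) : ScLin (E.prod F) F :=
  ⟨fun m => ContinuousLinearMap.snd ℝ (E.level m) (F.level m), fun _ _ => rfl⟩

def pair (L : ScLin E F) (M : ScLin E G) : ScLin E (F.prod G) :=
  ⟨fun m => (L.map m).prod (M.map m), fun m x => Prod.ext (L.comm m x) (M.comm m x)⟩

def add (L M : ScLin E F) : ScLin E F :=
  ⟨fun m => L.map m + M.map m, fun m x => by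
    change F.incl m (L.map (m + 1) x + M.map (m + 1) x) = L.map m (E.incl m x) + M.map m (E.incl m x)
    rw [map_add, L.comm, M.comm]⟩

def neg (L : ScLin E F) : ScLin E F :=
  ⟨fun m => -L.map m, fun m x => by
    change F.incl m (-(L.map (m + 1) x)) = -(L.map m (E.incl m x))
    rw [map_neg, L.comm]⟩

def zero (E F : ScBanach) : ScLin E F := ⟨fun _ => 0, fun m _ => map_zero (F.incl m)⟩

def up (L : ScLin E F) : ScLin E.up F.up := ⟨fun m => L.map (m + 1), fun m x => L.comm (m + 1) x⟩

def incl (E : ScBanach) : ScLin E.up E := ⟨E.incl, fun _ _ => rfl⟩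

def const {V W : Type} [NormedAddCommGroup V] [NormedSpace ℝ V] [FiniteDimensional ℝ V]
    [NormedAddCommGroup W] [NormedSpace ℝ W] [FiniteDimensional ℝ W] (L : V →L[ℝ] W) :
    ScLin (ScBanach.const V) (ScBanach.const W) := ⟨fun _ => L, fun _ _ => rfl⟩

def prodMap {E' F' : ScBanach} (L : ScLin E F) (M : ScLin E' F') :
    ScLin (E.prod E') (F.prod F') := (L.comp (fst E E')).pair (M.comp (snd E E'))

/-- The inverse of a levelwise bijective linear sc-operator. -/
def inverse (L : ScLin E F) (h : ∀ m, Function.Bijective (L.map m)) : ScLin F E where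
  map m := ((ContinuousLinearEquiv.ofBijective (L.map m) (LinearMap.ker_eq_bot.2 (h m).1)
    (LinearMap.range_eq_top.2 (h m).2)).symm : F.level m →L[ℝ] E.level m)
  comm m x := by
    apply (h m).1
    obtain ⟨y, rfl⟩ := (h (m + 1)).2 x
    rw [L.comm m y]
    have e1 := (ContinuousLinearEquiv.ofBijective (L.map (m + 1)) (LinearMap.ker_eq_bot.2 (h (m + 1)).1)
      (LinearMap.range_eq_top.2 (h (m + 1)).2)).symm_apply_apply y
    have e2 := (ContinuousLinearEquiv.ofBijective (L.map m) (LinearMap.ker_eq_bot.2 (h m).1)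
      (LinearMap.range_eq_top.2 (h m).2)).symm_apply_apply (E.incl m y)
    exact congrArg (L.map m) ((congrArg (E.incl m) e1).trans e2.symm)

theorem inverse_map (L : ScLin E F) (h : ∀ m, Function.Bijective (L.map m)) (m : ℕ)
    (x : E.level m) : (L.inverse h).map m (L.map m x) = x :=
  (ContinuousLinearEquiv.ofBijective (L.map m) (LinearMap.ker_eq_bot.2 (h m).1)
    (LinearMap.range_eq_top.2 (h m).2)).symm_apply_apply x

theorem map_inverse (L : ScLin E F) (h : ∀ m, Function.Bijective (L.map m)) (m : ℕ)
    (y : F.level m) : L.map m ((L.inverse h).map m y) = y :=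
  (ContinuousLinearEquiv.ofBijective (L.map m) (LinearMap.ker_eq_bot.2 (h m).1)
    (LinearMap.range_eq_top.2 (h m).2)).apply_symm_apply y

end ScLin

/-- A smooth point of a scale space, as a compatible sequence of points on the levels. -/
structure ScPoint (E : ScBanach) where
  pt : ∀ m, E.level m
  comm : ∀ m, E.incl m (pt (m + 1)) = pt m

theorem ScPoint.toZero_pt {E : ScBanach} (p : ScPoint E) : ∀ m, E.toZero m (p.pt m) = p.pt 0
  | 0 => rfl
  | m + 1 => by
    change E.toZero m (E.incl m (p.pt (m + 1))) = _
    rw [p.comm, p.toZero_pt m]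

theorem ScBanach.IsSmoothPoint.exists_scPoint {E : ScBanach} {x : E.level 0}
    (h : E.IsSmoothPoint x) : ∃ p : ScPoint E, p.pt 0 = x := by
  choose y hy using h
  exact ⟨⟨y, fun m => E.toZero_injective m ((hy (m + 1)).trans (hy m).symm)⟩, hy 0⟩

def ScPoint.zero (E : ScBanach) : ScPoint E := ⟨fun _ => 0, fun m => map_zero (E.incl m)⟩

def ScPoint.up {E : ScBanach} (p : ScPoint E) : ScPoint E.up :=
  ⟨fun m => p.pt (m + 1), fun m => p.comm (m + 1)⟩

def ScPoint.prod {E F : ScBanach} (p : ScPoint E) (q : ScPoint F) : ScPoint (E.prod F) :=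
  ⟨fun m => (p.pt m, q.pt m), fun m => Prod.ext (p.comm m) (q.comm m)⟩

def ScLin.mapPoint {E F : ScBanach} (L : ScLin E F) (p : ScPoint E) : ScPoint F :=
  ⟨fun m => L.map m (p.pt m), fun m => by rw [L.comm, p.comm]⟩

/-! ### Closure properties of sc-smooth maps -/

section

variable {E F G : ScBanach}

/-- The tangent domain of `Set.univ` is `Set.univ` by definition, so inductions on the order of
smoothness for globally defined maps never meet other domains. -/
theorem scContDiffOn_succ {k : ℕ} {f : E.level 0 → F.level 0} :
    ScContDiffOn (k + 1) Set.univ f ↔ ScContDiffOn k Set.univ f ∧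
      ∃ Tf : (E.up.prod E).level 0 → (F.up.prod F).level 0,
        IsTangentMapOn Set.univ f Tf ∧ ScContDiffOn k Set.univ Tf := Iff.rfl

theorem scContDiffOn_zero {f : E.level 0 → F.level 0} :
    ScContDiffOn 0 Set.univ f ↔ ∀ m, ∃ g : E.level m → F.level m,
      (∀ x, F.toZero m (g x) = f (E.toZero m x)) ∧ Continuous g := by
  change (∀ m, _) ↔ _
  simp only [Set.mem_univ, forall_const, Set.preimage_univ, continuousOn_univ]

/-- Composition with a linear sc-operator from the left. -/
theorem ScContDiffOn.scLin_comp {k : ℕ} : ∀ {E F G : ScBanach} (L : ScLin F G)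
    {f : E.level 0 → F.level 0}, ScContDiffOn k Set.univ f →
      ScContDiffOn (F := G) k Set.univ (fun x => L.map 0 (f x)) := by
  induction k with
  | zero =>
    intro E F G L f hf
    rw [scContDiffOn_zero] at hf ⊢
    intro m
    obtain ⟨g, hg, hc⟩ := hf m
    exact ⟨fun x => L.map m (g x), fun x => by rw [L.toZero_map, hg], (L.map m).continuous.comp hc⟩
  | succ k ih =>
    intro E F G L f hf
    rw [scContDiffOn_succ] at hf ⊢
    obtain ⟨h0, Tf, ⟨df, hdf⟩, hT⟩ := hf
    -- The tangent map is `(L¹ ⊕ L) ∘ Tf`, again a linear sc-operator after an `sc^k` map.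
    refine ⟨ih L h0, _, ⟨fun x => (L.map 0).comp (df x), fun x hx => ⟨?_, fun h => ⟨?_, ?_⟩⟩⟩,
      ih (L.up.prodMap L) hT⟩
    · refine ((L.map 0).isBigO_comp _ _).trans_isLittleO (hdf x hx).1 |>.congr_left fun h => ?_
      simp only [map_sub, ContinuousLinearMap.comp_apply]
    · exact (L.comm 0 _).trans (congrArg (L.map 0) ((hdf x hx).2 h).1)
    · exact congrArg (L.map 0) ((hdf x hx).2 h).2

/-- Composition with an affine sc-operator from the right. -/
theorem ScContDiffOn.comp_affine {k : ℕ} : ∀ {E F G : ScBanach} (L : ScLin E F) (c : ScPoint F)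
    {f : F.level 0 → G.level 0}, ScContDiffOn k Set.univ f →
      ScContDiffOn (E := E) k Set.univ (fun x => f (L.map 0 x + c.pt 0)) := by
  induction k with
  | zero =>
    intro E F G L c f hf
    rw [scContDiffOn_zero] at hf ⊢
    intro m
    obtain ⟨g, hg, hc⟩ := hf m
    refine ⟨fun x => g (L.map m x + c.pt m), fun x => ?_,
      hc.comp ((L.map m).continuous.add continuous_const)⟩
    rw [hg, map_add, L.toZero_map, c.toZero_pt]
  | succ k ih =>
    intro E F G L c f hf
    rw [scContDiffOn_succ] at hf ⊢
    obtain ⟨h0, Tf, ⟨df, hdf⟩, hT⟩ := hf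
    have key : ∀ x : E.level 1, F.incl 0 (L.map 1 x + c.pt 1) = L.map 0 (E.incl 0 x) + c.pt 0 := by
      intro x
      rw [map_add, L.comm, c.comm]
    -- The tangent map is `Tf` after `(x, h) ↦ (L x + c, L h)`, again affine, with translation part
    -- `(c, 0)`. The point `c` has to lie on all levels for the shifted translation to make sense.
    refine ⟨ih L c h0, _, ⟨fun x => (df (L.map 1 x + c.pt 1)).comp (L.map 0),
      fun x _ => ⟨?_, fun h => ⟨?_, ?_⟩⟩⟩, ih (L.up.prodMap L) (c.up.prod (ScPoint.zero F)) hT⟩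
    · have h1 := (hdf (L.map 1 x + c.pt 1) trivial).1
      have h2 : Tendsto (L.map 1) (𝓝 0) (𝓝 0) := by
        simpa using (L.map 1).continuous.tendsto 0
      refine ((h1.comp_tendsto h2).trans_isBigO ((L.map 1).isBigO_id _)).congr_left fun h => ?_
      simp only [Function.comp_apply, ContinuousLinearMap.comp_apply, L.comm]
      rw [← key, ← key, map_add (L.map 1), add_right_comm]
    · exact ((hdf (L.map 1 x + c.pt 1) trivial).2 (L.map 0 h + 0)).1.trans (congrArg f (key x))
    · refine ((hdf (L.map 1 x + c.pt 1) trivial).2 (L.map 0 h + 0)).2.trans ?_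
      rw [add_zero]; rfl

theorem ScContDiffOn.comp_scLin {k : ℕ} (L : ScLin E F)
    {f : F.level 0 → G.level 0} (hf : ScContDiffOn k Set.univ f) :
      ScContDiffOn (E := E) k Set.univ (fun x => f (L.map 0 x)) := by
  have := hf.comp_affine L (ScPoint.zero F)
  simpa [ScPoint.zero] using this

theorem ScContDiffOn.prodMk {k : ℕ} : ∀ {E F G : ScBanach} {f : E.level 0 → F.level 0}
    {g : E.level 0 → G.level 0}, ScContDiffOn k Set.univ f → ScContDiffOn k Set.univ g →
      ScContDiffOn (F := F.prod G) k Set.univ (fun x => (f x, g x)) := by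
  induction k with
  | zero =>
    intro E F G f g hf hg
    rw [scContDiffOn_zero] at hf hg
    refine scContDiffOn_zero.2 fun m => ?_
    obtain ⟨f', hf', hfc⟩ := hf m
    obtain ⟨g', hg', hgc⟩ := hg m
    exact ⟨fun x => (f' x, g' x), fun x => by rw [ScBanach.toZero_prod, hf', hg'], hfc.prodMk hgc⟩
  | succ k ih =>
    intro E F G f g hf hg
    rw [scContDiffOn_succ] at hf hg
    obtain ⟨hf0, Tf, ⟨df, hdf⟩, hTf⟩ := hf
    obtain ⟨hg0, Tg, ⟨dg, hdg⟩, hTg⟩ := hg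
    -- The pair of tangent maps has values `((f, df), (g, dg))`, while the tangent map of the pair
    -- has values `((f, g), (df, dg))`; `σ` is the exchange of the middle factors.
    let σ : ScLin ((F.up.prod F).prod (G.up.prod G)) ((F.prod G).up.prod (F.prod G)) :=
      (((ScLin.fst F.up F).comp (ScLin.fst _ _)).pair ((ScLin.fst G.up G).comp (ScLin.snd _ _))).pair
      (((ScLin.snd F.up F).comp (ScLin.fst _ _)).pair ((ScLin.snd G.up G).comp (ScLin.snd _ _)))
    refine scContDiffOn_succ.2 ⟨ih hf0 hg0, _, ⟨fun x => (df x).prod (dg x), fun x _ => ⟨?_, fun h => ⟨?_, ?_⟩⟩⟩,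
      (ih hTf hTg).scLin_comp σ⟩
    · exact (hdf x trivial).1.prod_left (hdg x trivial).1
    · exact Prod.ext ((hdf x trivial).2 h).1 ((hdg x trivial).2 h).1
    · exact Prod.ext ((hdf x trivial).2 h).2 ((hdg x trivial).2 h).2

theorem ScContDiffOn.add {k : ℕ} {f g : E.level 0 → F.level 0} (hf : ScContDiffOn k Set.univ f)
    (hg : ScContDiffOn k Set.univ g) : ScContDiffOn k Set.univ (fun x => f x + g x) :=
  (hf.prodMk hg).scLin_comp ((ScLin.fst F F).add (ScLin.snd F F))

theorem ScContDiffOn.neg {k : ℕ} {f : E.level 0 → F.level 0} (hf : ScContDiffOn k Set.univ f) :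
    ScContDiffOn k Set.univ (fun x => -f x) :=
  hf.scLin_comp (ScLin.id F).neg

theorem ScContDiffOn.sub {k : ℕ} {f g : E.level 0 → F.level 0} (hf : ScContDiffOn k Set.univ f)
    (hg : ScContDiffOn k Set.univ g) : ScContDiffOn k Set.univ (fun x => f x - g x) := by
  simpa only [sub_eq_add_neg] using hf.add hg.neg

theorem scContDiffOn_id (k : ℕ) : ∀ E : ScBanach, ScContDiffOn k Set.univ (fun x : E.level 0 => x) := by
  induction k with
  | zero =>
    intro E
    rw [scContDiffOn_zero]
    exact fun m => ⟨fun x => x, fun x => rfl, continuous_id⟩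
  | succ k ih =>
    intro E
    rw [scContDiffOn_succ]
    refine ⟨ih E, _, ⟨fun x => ContinuousLinearMap.id ℝ _, fun x _ => ⟨?_, fun h => ⟨rfl, rfl⟩⟩⟩, ih _⟩
    simp

theorem ScLin.scContDiffOn (L : ScLin E F) (k : ℕ) : ScContDiffOn k Set.univ (fun x => L.map 0 x) :=
  (scContDiffOn_id k F).comp_scLin L

theorem scContDiffOn_const (c : ScPoint F) (k : ℕ) :
    ScContDiffOn (E := E) k Set.univ (fun _ => c.pt 0) := by
  have := (scContDiffOn_id k F).comp_affine (ScLin.zero E F) c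
  simpa [ScLin.zero] using this

end

/-! ### A criterion for sc-differentiability -/

/-- Mean value inequality for `P θ - θ • v`. With `P θ = f (x + θ h)` it bounds the first order
Taylor remainder by the oscillation of the derivative along the segment. -/
theorem hasDerivAt_remainder_le {F : Type*} [NormedAddCommGroup F] [NormedSpace ℝ F]
    {P G : ℝ → F} {v : F} {C : ℝ} (hP : ∀ θ ∈ Set.Icc (0 : ℝ) 1, HasDerivAt P (G θ) θ)
    (hG : ∀ θ ∈ Set.Icc (0 : ℝ) 1, ‖G θ - v‖ ≤ C) : ‖P 1 - P 0 - v‖ ≤ C := by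
  have h1 : ∀ θ ∈ Set.Icc (0 : ℝ) 1,
      HasDerivWithinAt (fun θ => P θ - θ • v) (G θ - v) (Set.Icc 0 1) θ := fun θ hθ => by
    have := ((hP θ hθ).sub ((hasDerivAt_id' θ).smul_const v)).hasDerivWithinAt (s := Set.Icc 0 1)
    rwa [one_smul] at this
  have h2 := (convex_Icc (0 : ℝ) 1).norm_image_sub_le_of_norm_hasDerivWithin_le h1 hG
    (Set.left_mem_Icc.2 zero_le_one) (Set.right_mem_Icc.2 zero_le_one)
  have e : P 1 - (1 : ℝ) • v - (P 0 - (0 : ℝ) • v) = P 1 - P 0 - v := by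
    rw [one_smul, zero_smul]; abel
  rw [e] at h2
  simpa using h2

/-- A continuous path whose images under a separating continuous linear map are differentiable, with
the expected derivative, is differentiable. -/
theorem hasDerivAt_of_separating {B C ι : Type*} [NormedAddCommGroup B] [NormedSpace ℝ B]
    [CompleteSpace B] [NormedAddCommGroup C] [NormedSpace ℝ C] [CompleteSpace C]
    (ev : ι → B →L[ℝ] C) (hev : ∀ x y, (∀ i, ev i x = ev i y) → x = y) {P G : ℝ → B}
    (hG : Continuous G) (h : ∀ i θ, HasDerivAt (fun θ => ev i (P θ)) (ev i (G θ)) θ) (θ : ℝ) :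
    HasDerivAt P (G θ) θ := by
  -- Both sides have the same image under every `ev i` by the fundamental theorem of calculus. The
  -- derivative of the right-hand side exists in `B` itself because `G` is continuous there.
  have e : P = fun θ => P 0 + ∫ s in (0 : ℝ)..θ, G s := by
    funext θ
    refine hev _ _ fun i => ?_
    rw [map_add, ← ContinuousLinearMap.intervalIntegral_comp_comm _ (hG.intervalIntegrable _ _),
      intervalIntegral.integral_eq_sub_of_hasDerivAt (fun s _ => h i s)
        (((ev i).continuous.comp hG).intervalIntegrable _ _)]
    abel
  rw [e]
  exact (intervalIntegral.integral_hasDerivAt_right (hG.intervalIntegrable _ _)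
    hG.aestronglyMeasurable.stronglyMeasurableAtFilter hG.continuousAt).const_add _

/-- Directional derivatives which are jointly continuous on `E₁ ⊕ E₀` make up a sc-differential. -/
theorem isLittleO_of_hasDerivAt_path {E F : ScBanach} {f : E.level 0 → F.level 0}
    (df : E.level 1 → E.level 0 →L[ℝ] F.level 0)
    (hc : Continuous fun p : E.level 1 × E.level 0 => df p.1 p.2)
    (hd : ∀ (x h : E.level 1) (θ : ℝ), HasDerivAt (fun θ : ℝ => f (E.incl 0 (x + θ • h)))
      (df (x + θ • h) (E.incl 0 h)) θ) (x : E.level 1) :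
    (fun h : E.level 1 => f (E.incl 0 (x + h)) - f (E.incl 0 x) - df x (E.incl 0 h))
        =o[𝓝 0] (fun h : E.level 1 => h) := by
  -- `df` need not be continuous in operator norm. Instead, a ball of radius `ρ` in `E₁` lands in
  -- the compact set `K' ⊆ E₀`, and on compact sets joint continuity gives uniformity in the
  -- direction.
  obtain ⟨K, hK, K', hK1, hK2⟩ := (isCompactOperator_iff_exists_mem_nhds_image_subset_compact _).1
    (E.incl_compact 0)
  obtain ⟨ρ, hρ, hball⟩ := Metric.mem_nhds_iff.1 hK
  rw [Asymptotics.isLittleO_iff]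
  intro c hcpos
  have hu := hK1.mem_uniformity_of_prod (f := fun (x : E.level 1) (h : E.level 0) => df x h)
    (s := Set.univ) (q := x) hc.continuousOn (Set.mem_univ _)
    (Metric.dist_mem_uniformity (show 0 < c * (ρ / 2) by positivity))
  obtain ⟨v, hv, hv'⟩ := hu
  rw [nhdsWithin_univ] at hv
  obtain ⟨δ, hδ, hδ'⟩ := Metric.mem_nhds_iff.1 hv
  filter_upwards [Metric.ball_mem_nhds (0 : E.level 1) hδ] with h hh
  rw [mem_ball_zero_iff] at hh
  have h1 : ∀ θ ∈ Set.Icc (0 : ℝ) 1,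
      ‖df (x + θ • h) (E.incl 0 h) - df x (E.incl 0 h)‖ ≤ c * ‖h‖ := by
    intro θ hθ
    rcases eq_or_ne h 0 with rfl | hne
    · simp
    have hn : 0 < ‖h‖ := norm_pos_iff.2 hne
    -- Rescaling `h` to length `ρ / 2 < ρ` places its image in `K'`. By linearity the estimate for
    -- `u` becomes one for `h` with a factor `‖h‖ / (ρ / 2)`, which explains the threshold `c * (ρ /
    -- 2)` above.
    set u : E.level 1 := ((ρ / 2) / ‖h‖) • h with hu
    have hun : ‖u‖ < ρ := by
      rw [hu, norm_smul, Real.norm_of_nonneg (by positivity), div_mul_cancel₀ _ hn.ne']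
      linarith
    have huK : E.incl 0 u ∈ K' := hK2 ⟨u, hball (by simpa using hun), rfl⟩
    have hx : x + θ • h ∈ v := by
      apply hδ'
      rw [Metric.mem_ball, dist_eq_norm, add_sub_cancel_left, norm_smul, Real.norm_of_nonneg hθ.1]
      exact (mul_le_of_le_one_left hn.le hθ.2).trans_lt hh
    have h2 := hv' _ hx _ huK
    simp only [Set.mem_ofPred_eq, dist_eq_norm] at h2
    rw [hu, map_smul, map_smul, map_smul, ← smul_sub, norm_smul,
      Real.norm_of_nonneg (by positivity)] at h2
    rw [div_mul_eq_mul_div, div_lt_iff₀ hn] at h2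
    have : (ρ / 2) * ‖df (x + θ • h) (E.incl 0 h) - df x (E.incl 0 h)‖ ≤ (ρ / 2) * (c * ‖h‖) := by
      linarith
    exact le_of_mul_le_mul_left this (by positivity)
  have := hasDerivAt_remainder_le (v := df x (E.incl 0 h)) (fun θ _ => hd x h θ) h1
  simpa using this

/-- Directional derivatives which are continuous in operator norm make up a Fréchet derivative. -/
theorem hasFDerivAt_of_hasDerivAt_path {E F : Type*} [NormedAddCommGroup E] [NormedSpace ℝ E]
    [NormedAddCommGroup F] [NormedSpace ℝ F] {f : E → F} {df : E → E →L[ℝ] F} {x : E}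
    (hc : ContinuousAt df x) (hd : ∀ (h : E) (θ : ℝ),
      HasDerivAt (fun θ : ℝ => f (x + θ • h)) (df (x + θ • h) h) θ) : HasFDerivAt f (df x) x := by
  rw [hasFDerivAt_iff_isLittleO_nhds_zero, Asymptotics.isLittleO_iff]
  intro c hcpos
  obtain ⟨δ, hδ, hδ'⟩ := Metric.continuousAt_iff.1 hc c hcpos
  filter_upwards [Metric.ball_mem_nhds (0 : E) hδ] with h hh
  rw [mem_ball_zero_iff] at hh
  have h1 : ∀ θ ∈ Set.Icc (0 : ℝ) 1, ‖df (x + θ • h) h - df x h‖ ≤ c * ‖h‖ := by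
    intro θ hθ
    have : dist (x + θ • h) x < δ := by
      rw [dist_eq_norm, add_sub_cancel_left, norm_smul, Real.norm_of_nonneg hθ.1]
      exact (mul_le_of_le_one_left (norm_nonneg _) hθ.2).trans_lt hh
    have h2 := hδ' this
    rw [dist_eq_norm] at h2
    rw [← sub_apply]
    exact (df (x + θ • h) - df x).le_of_opNorm_le h2.le h
  have := hasDerivAt_remainder_le (v := df x h) (fun θ _ => hd h θ) h1
  simpa using this

/-! ### Fredholm operators -/

/-- `1 - R` preserves the finite dimensional space `im R` and is the identity modulo it. So its
kernel and cokernel are those of the restriction to `im R`, where rank-nullity applies. -/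
theorem finrank_ker_id_sub_eq {V : Type*} [AddCommGroup V] [Module ℝ V] (R : V →ₗ[ℝ] V)
    [FiniteDimensional ℝ R.range] :
    Module.finrank ℝ (LinearMap.id - R : V →ₗ[ℝ] V).ker =
      Module.finrank ℝ (V ⧸ (LinearMap.id - R : V →ₗ[ℝ] V).range) := by
  set S : V →ₗ[ℝ] V := LinearMap.id - R with hS
  have hSx : ∀ x, S x = x - R x := fun x => rfl
  have hm : ∀ x ∈ R.range, S x ∈ R.range := fun x hx =>
    Submodule.sub_mem _ hx (LinearMap.mem_range_self R x)
  set g : R.range →ₗ[ℝ] R.range := S.restrict hm with hg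
  have h1 := g.finrank_range_add_finrank_ker
  have h2 := g.range.finrank_quotient_add_finrank
  have hk : ∀ x ∈ S.ker, x ∈ R.range := fun x hx =>
    ⟨x, (sub_eq_zero.1 (LinearMap.mem_ker.1 hx)).symm⟩
  let e1 : S.ker ≃ₗ[ℝ] g.ker :=
    { toFun := fun x => ⟨⟨x, hk x x.2⟩, LinearMap.mem_ker.2 (Subtype.ext (LinearMap.mem_ker.1 x.2))⟩
      invFun := fun x => ⟨x.1, congrArg Subtype.val (LinearMap.mem_ker.1 x.2)⟩
      map_add' := fun _ _ => rfl
      map_smul' := fun _ _ => rfl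
      left_inv := fun _ => rfl
      right_inv := fun _ => rfl }
  let φ : R.range →ₗ[ℝ] V ⧸ S.range := S.range.mkQ ∘ₗ R.range.subtype
  have hφ : Function.Surjective φ := by
    intro q
    obtain ⟨v, rfl⟩ := S.range.mkQ_surjective q
    refine ⟨⟨R v, LinearMap.mem_range_self R v⟩, ?_⟩
    rw [← sub_eq_zero]
    change S.range.mkQ (R v) - S.range.mkQ v = 0
    rw [← map_sub, Submodule.mkQ_apply, Submodule.Quotient.mk_eq_zero]
    refine ⟨-v, ?_⟩
    rw [map_neg, hSx]; simp
  have hφk : φ.ker = g.range := by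
    ext w
    change S.range.mkQ w.1 = 0 ↔ _
    rw [Submodule.mkQ_apply, Submodule.Quotient.mk_eq_zero]
    constructor
    · rintro ⟨v, hv⟩
      have hvR : v ∈ R.range := by
        have : v = w.1 + R v := by rw [← hv, hSx]; abel
        rw [this]
        exact Submodule.add_mem _ w.2 (LinearMap.mem_range_self R v)
      exact ⟨⟨v, hvR⟩, Subtype.ext hv⟩
    · rintro ⟨v, rfl⟩
      exact ⟨v.1, rfl⟩
  have h3 := (φ.quotKerEquivOfSurjective hφ).finrank_eq
  rw [hφk] at h3
  have h4 := e1.finrank_eq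
  omega

/-- A norm limit `K` of finite rank operators perturbs an isomorphism `A` to a Fredholm operator of
index zero. -/
theorem isFredholm_sub_of_tendsto {E F : Type} [NormedAddCommGroup E] [NormedSpace ℝ E]
    [CompleteSpace E] [NormedAddCommGroup F] [NormedSpace ℝ F] [CompleteSpace F]
    (A : E ≃L[ℝ] F) {K : E →L[ℝ] F} {R : ℕ → E →L[ℝ] F}
    (hR : ∀ N, FiniteDimensional ℝ (R N).range) (hlim : Tendsto R atTop (𝓝 K)) :
    ((A : E →L[ℝ] F) - K).IsFredholm ∧ fredholmIndex ((A : E →L[ℝ] F) - K) = 0 := by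
  -- Isomorphisms form an open set, so `B = A - K + R N` is one for some `N`. Then `A - K = B (1 -
  -- B⁻¹ R N)` is an isomorphism after a finite rank perturbation of the identity.
  have h1 : Tendsto (fun N => (A : E →L[ℝ] F) - K + R N) atTop (𝓝 (A : E →L[ℝ] F)) := by
    have := (tendsto_const_nhds (x := (A : E →L[ℝ] F) - K)).add hlim
    rwa [sub_add_cancel] at this
  obtain ⟨N, B, hB⟩ := (h1.eventually (ContinuousLinearEquiv.nhds A)).exists
  replace hB : (B : E →L[ℝ] F) = A - K + R N := hB
  set T := (A : E →L[ℝ] F) - K with hTdef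
  have hT : ∀ x, T x = B x - R N x := by
    intro x
    have := DFunLike.congr_fun hB x
    rw [_root_.add_apply] at this
    exact eq_sub_of_add_eq this.symm
  set R' : E →ₗ[ℝ] E := (B.symm : F →L[ℝ] E).toLinearMap ∘ₗ (R N).toLinearMap with hR'
  have hR'x : ∀ x, R' x = B.symm (R N x) := fun x => rfl
  have hfin : FiniteDimensional ℝ R'.range := by
    have := hR N
    rw [hR', LinearMap.range_comp]
    infer_instance
  have hfac : ∀ x, T x = B ((LinearMap.id - R' : E →ₗ[ℝ] E) x) := by
    intro x
    change _ = B (x - B.symm (R N x))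
    rw [hT, map_sub, B.apply_symm_apply]
  have hker : T.ker = (LinearMap.id - R' : E →ₗ[ℝ] E).ker := by
    ext x
    rw [LinearMap.mem_ker, LinearMap.mem_ker]
    change T x = 0 ↔ _
    rw [hfac]
    exact B.map_eq_zero_iff
  have hrange : T.range = (LinearMap.id - R' : E →ₗ[ℝ] E).range.map (B.toLinearEquiv : E →ₗ[ℝ] F) := by
    ext y
    constructor
    · rintro ⟨x, rfl⟩
      exact ⟨_, ⟨x, rfl⟩, (hfac x).symm⟩
    · rintro ⟨_, ⟨x, rfl⟩, rfl⟩
      exact ⟨x, hfac x⟩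
  refine ⟨?_, ?_⟩
  · refine ContinuousLinearMap.IsFredholm.of_isQuasiInverse (v := (B.symm : F →L[ℝ] E)) ⟨?_, ?_⟩
    · refine LinearMap.FiniteRangeSetoid.equiv_iff_hasFiniteRange.2 ?_
      have e : ((B.symm : F →L[ℝ] E).toLinearMap ∘ₗ T.toLinearMap - LinearMap.id) = -R' := by
        ext x
        change B.symm (T x) - x = -R' x
        rw [hfac, B.symm_apply_apply]
        change x - R' x - x = -R' x
        abel
      rw [e]
      exact LinearMap.HasFiniteRange.neg ((Submodule.fg_iff_finiteDimensional _).2 hfin)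
    · refine LinearMap.FiniteRangeSetoid.equiv_iff_hasFiniteRange.2 ?_
      have e : (T.toLinearMap ∘ₗ (B.symm : F →L[ℝ] E).toLinearMap - LinearMap.id) =
          -((R N).toLinearMap ∘ₗ (B.symm : F →L[ℝ] E).toLinearMap) := by
        ext x
        change T (B.symm x) - x = -(R N (B.symm x))
        rw [hT, B.apply_symm_apply]
        abel
      rw [e]
      exact LinearMap.HasFiniteRange.neg (LinearMap.HasFiniteRange.comp_right
        ((Submodule.fg_iff_finiteDimensional _).2 (hR N)) _)
  · have e2 := (Submodule.Quotient.equiv (LinearMap.id - R' : E →ₗ[ℝ] E).range T.range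
      B.toLinearEquiv hrange.symm).finrank_eq
    rw [fredholmIndex, ← e2, ← finrank_ker_id_sub_eq R', hker, sub_self]

/-! ### A criterion for linear sc-Fredholm operators -/

/-- The submodule `E_∞` of smooth points. -/
def smoothPoints (E : ScBanach) : Submodule ℝ (E.level 0) := ⨅ m, (E.toZero m).range

theorem mem_smoothPoints {E : ScBanach} {x : E.level 0} :
    x ∈ smoothPoints E ↔ E.IsSmoothPoint x := by
  simp only [smoothPoints, Submodule.mem_iInf]; rfl

/-- The image of `S` in the finite dimensional quotient `F ⧸ R` is dense and closed, hence
everything, so representatives of a basis of the quotient can be taken in `S`. This is used to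
choose a cokernel complement consisting of smooth points. -/
theorem exists_isCompl_le_of_dense {F : Type*} [NormedAddCommGroup F] [NormedSpace ℝ F]
    {R S : Submodule ℝ F} (hR : IsClosed (R : Set F)) [FiniteDimensional ℝ (F ⧸ R)]
    (hS : Dense (S : Set F)) : ∃ C ≤ S, IsCompl R C ∧ FiniteDimensional ℝ C := by
  have hsup : R ⊔ S = ⊤ := by
    have : IsClosed (R : Set F) := hR
    have h1 : S.map R.mkQ = ⊤ := by
      have hc : IsClosed (S.map R.mkQ : Set (F ⧸ R)) := Submodule.closed_of_finiteDimensional _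
      have hd : Dense (S.map R.mkQ : Set (F ⧸ R)) := by
        rw [Submodule.map_coe]
        exact R.mkQ_surjective.denseRange.dense_image R.mkQL.continuous hS
      exact SetLike.coe_injective (by rw [← hc.closure_eq, hd.closure_eq]; rfl)
    rw [← Submodule.comap_map_mkQ, h1, Submodule.comap_top]
  -- By the modular law, `Q ⊓ S` is a complement of `R ⊓ S` inside `S`; because `R ⊔ S = ⊤`, it is
  -- then a complement of `R` in `F`.
  obtain ⟨Q, hQ⟩ := exists_isCompl (R ⊓ S)
  have hC : IsCompl R (Q ⊓ S) := by
    refine ⟨?_, ?_⟩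
    · rw [disjoint_iff, inf_comm Q, ← inf_assoc]
      exact hQ.inf_eq_bot
    · rw [codisjoint_iff, eq_top_iff, ← hsup]
      refine sup_le le_sup_left ?_
      have : (R ⊓ S) ⊔ (Q ⊓ S) = S := by
        rw [← sup_inf_assoc_of_le Q (inf_le_right : R ⊓ S ≤ S), hQ.sup_eq_top, top_inf_eq]
      calc S = (R ⊓ S) ⊔ (Q ⊓ S) := this.symm
        _ ≤ _ := sup_le_sup_right inf_le_left _
  exact ⟨Q ⊓ S, inf_le_right, hC, (Submodule.quotientEquivOfIsCompl R _ hC).finiteDimensional⟩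

/-- The `K`-component of a point of `E_m` is smooth, hence lies in `E_m`, and so does the
difference, which is the `X`-component. Thus the splitting of `E₀` restricts to all levels. -/
theorem isScSplitting_of_smooth {E : ScBanach} {K X : Submodule ℝ (E.level 0)}
    (hK : IsClosed (K : Set (E.level 0))) (hX : IsClosed (X : Set (E.level 0))) (h : IsCompl K X)
    (hs : K ≤ smoothPoints E) : IsScSplitting K X := by
  refine fun m => ⟨hK.preimage (E.toZero m).continuous, hX.preimage (E.toZero m).continuous,
    ⟨?_, ?_⟩⟩
  · rw [Submodule.disjoint_def]
    intro x hx hx'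
    apply E.toZero_injective m
    rw [map_zero]
    exact Submodule.disjoint_def.1 h.disjoint _ hx hx'
  · rw [codisjoint_iff, Submodule.eq_top_iff']
    intro x
    have : E.toZero m x ∈ K ⊔ X := by rw [h.sup_eq_top]; trivial
    obtain ⟨k, hk, z, hz, hkz⟩ := Submodule.mem_sup.1 this
    obtain ⟨k', hk'⟩ := mem_smoothPoints.1 (hs hk) m
    refine Submodule.mem_sup.2 ⟨k', ?_, x - k', ?_, add_sub_cancel _ _⟩
    · change E.toZero m k' ∈ K
      rwa [hk']
    · change E.toZero m (x - k') ∈ X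
      rwa [map_sub, hk', ← hkz, add_sub_cancel_left]

theorem IsScSplitting.symm {E : ScBanach} {K X : Submodule ℝ (E.level 0)}
    (h : IsScSplitting K X) : IsScSplitting X K :=
  fun m => ⟨(h m).2.1, (h m).1, (h m).2.2.symm⟩

/-- Open mapping theorem for the restriction `X → Y`, whose source and target are complete because
they are closed. -/
theorem exists_le_mul_norm_of_bijOn {A B : Type*} [NormedAddCommGroup A] [NormedSpace ℝ A]
    [CompleteSpace A] [NormedAddCommGroup B] [NormedSpace ℝ B] [CompleteSpace B]
    {X : Submodule ℝ A} {Y : Submodule ℝ B} (hX : IsClosed (X : Set A)) (hY : IsClosed (Y : Set B))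
    (T : A →L[ℝ] B) (h : Set.BijOn T X Y) : ∃ c : ℝ, ∀ x ∈ X, ‖x‖ ≤ c * ‖T x‖ := by
  have := hX.completeSpace_coe
  have := hY.completeSpace_coe
  set g : X →L[ℝ] Y := (T.comp X.subtypeL).codRestrict Y fun x => h.1 x.2 with hg
  have hgx : ∀ x, (g x : B) = T x := fun x => rfl
  have hb : Function.Bijective g := by
    refine ⟨fun x y hxy => Subtype.ext (h.2.1 x.2 y.2 (congrArg Subtype.val hxy)), fun y => ?_⟩
    obtain ⟨x, hx, hxy⟩ := h.2.2 y.2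
    exact ⟨⟨x, hx⟩, Subtype.ext hxy⟩
  let e := ContinuousLinearEquiv.ofBijective g (LinearMap.ker_eq_bot.2 hb.1)
    (LinearMap.range_eq_top.2 hb.2)
  refine ⟨‖(e.symm : Y →L[ℝ] X)‖, fun x hx => ?_⟩
  have h1 := (e.symm : Y →L[ℝ] X).le_opNorm (g ⟨x, hx⟩)
  have h2 : (e.symm : Y →L[ℝ] X) (g ⟨x, hx⟩) = ⟨x, hx⟩ := e.symm_apply_apply _
  rw [h2] at h1
  exact h1

/-- A Fredholm operator which is regularizing on all levels is sc-Fredholm. -/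
theorem isLinearScFredholm_of_regularizing {E F : ScBanach} (T : ScLin E F)
    (hT : (T.map 0).IsFredholm) (hreg : ∀ m x, F.InLevel m (T.map 0 x) → E.InLevel m x)
    (hdense : Dense (smoothPoints F : Set (F.level 0))) : IsLinearScFredholm (T.map 0) := by
  refine ⟨T.scContDiffOn 0, ?_⟩
  have hkf := hT.finite_ker
  obtain ⟨X, hXc, hKX⟩ := hT.closedComplemented_ker.exists_isClosed_isCompl
  -- The value `0` lies on every level, so regularity makes every kernel element smooth.
  have hKs : (T.map 0).ker ≤ smoothPoints E := by
    intro x hx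
    refine mem_smoothPoints.2 fun m => hreg m x ?_
    rw [show T.map 0 x = 0 from hx]
    exact ⟨0, map_zero _⟩
  have hKc : IsClosed ((T.map 0).ker : Set (E.level 0)) := (T.map 0).isClosed_ker
  have : FiniteDimensional ℝ (F.level 0 ⧸ (T.map 0).range) := hT.finite_coker
  obtain ⟨C, hCs, hRC, hCf⟩ := exists_isCompl_le_of_dense hT.isClosed_range hdense
  have hEsp := isScSplitting_of_smooth hKc hXc hKX hKs
  have hFsp := (isScSplitting_of_smooth (Submodule.closed_of_finiteDimensional C) hT.isClosed_range
    hRC.symm hCs).symm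
  refine ⟨_, X, _, C, hEsp, hFsp, rfl, hkf, rfl, hCf, fun m => ⟨T.map m, T.toZero_map m, ?_⟩⟩
  have hb : Set.BijOn (T.map m) (levelSub X m) (levelSub (T.map 0).range m) := by
    refine ⟨fun x _ => ?_, fun x hx y hy hxy => ?_, fun y hy => ?_⟩
    · change F.toZero m (T.map m x) ∈ (T.map 0).range
      rw [T.toZero_map]
      exact ⟨_, rfl⟩
    · apply E.toZero_injective m
      have h1 : E.toZero m x - E.toZero m y ∈ (T.map 0).ker := by
        rw [LinearMap.mem_ker]
        change T.map 0 (E.toZero m x - E.toZero m y) = 0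
        rw [map_sub, ← T.toZero_map, ← T.toZero_map, hxy, sub_self]
      exact sub_eq_zero.1 (Submodule.disjoint_def.1 hKX.disjoint _ h1 (X.sub_mem hx hy))
    -- A preimage of `y` on level `0` lies on level `m` by regularity; discarding its kernel
    -- component moves it into `X_m` without changing the value.
    · obtain ⟨x, hx⟩ : F.toZero m y ∈ (T.map 0).range := hy
      replace hx : T.map 0 x = F.toZero m y := hx
      obtain ⟨x', rfl⟩ := hreg m x ⟨y, hx.symm⟩
      have : x' ∈ levelSub (T.map 0).ker m ⊔ levelSub X m := by
        rw [(hEsp m).2.2.sup_eq_top]; trivial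
      obtain ⟨k, hk, z, hz, rfl⟩ := Submodule.mem_sup.1 this
      refine ⟨z, hz, F.toZero_injective m ?_⟩
      have hk' : T.map 0 (E.toZero m k) = 0 := hk
      rw [← hx, T.toZero_map, map_add, map_add, hk', zero_add]
  exact ⟨hb, exists_le_mul_norm_of_bijOn (hEsp m).2.1 (hFsp m).1 (T.map m) hb⟩

/-! ### Sobolev functions as elements of `L²` -/

abbrev Vec (n : ℕ) : Type := EuclideanSpace ℝ (Fin n)

/-- The Sobolev function as an element of `L²`. -/
def sobolevBase (n m : ℕ) : sobolev n m →L[ℝ] L2 n :=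
  (PiLp.proj 2 (fun _ : Fin (m + 1) => L2 n) 0).comp (sobolev n m).subtypeL

@[simp] theorem sobolevBase_apply {n m : ℕ} (x : sobolev n m) : sobolevBase n m x = x.1 0 := rfl

/-- Weak derivatives are unique, so the entry of order zero determines the tuple. This reduces
identities between Sobolev functions, also across levels, to identities in `L²`. -/
theorem sobolev_ext {n : ℕ} : ∀ {m : ℕ} {x y : sobolev n m}, x.1 0 = y.1 0 → x = y
  | 0, x, y, h => by
    apply Subtype.ext
    ext1 j
    rw [show j = 0 from Fin.fin_one_eq_zero j, h]
  | m + 1, x, y, h => sobolevIncl_injective n m (sobolev_ext h)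

theorem sobolevIncl_base {n m : ℕ} (x : sobolev n (m + 1)) :
    (sobolevIncl n m x).1 0 = x.1 0 := rfl

theorem sobolev_isWeakDeriv {n m : ℕ} (x : sobolev n (m + 1)) :
    IsWeakDeriv (x.1 0) ((sobolevDeriv n m x).1 0) := x.2 0

theorem continuous_sobolev_iff {n m : ℕ} {T : Type*} [TopologicalSpace T] {f : T → sobolev n m} :
    Continuous f ↔ ∀ j, Continuous fun t => (f t).1 j := by
  refine ⟨fun h j => (PiLp.continuous_apply 2 (fun _ : Fin (m + 1) => L2 n) j).comp
    (continuous_subtype_val.comp h), fun h => Continuous.subtype_mk ?_ _⟩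
  exact (PiLp.continuous_toLp 2 (fun _ : Fin (m + 1) => L2 n)).comp (continuous_pi h)

theorem continuous_sobolev_zero_iff {n : ℕ} {T : Type*} [TopologicalSpace T] {f : T → sobolev n 0} :
    Continuous f ↔ Continuous fun t => (f t).1 0 :=
  continuous_sobolev_iff.trans ⟨fun h => h 0, fun h j => by rwa [show j = 0 from Fin.fin_one_eq_zero j]⟩

theorem continuous_sobolev_succ_iff {n m : ℕ} {T : Type*} [TopologicalSpace T]
    {f : T → sobolev n (m + 1)} : Continuous f ↔
      (Continuous fun t => (f t).1 0) ∧ Continuous fun t => sobolevDeriv n m (f t) := by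
  rw [continuous_sobolev_iff, Fin.forall_fin_succ, continuous_sobolev_iff]
  rfl

/-- The element of `W^{m+1,2}` with given weak derivative in `W^{m,2}`. -/
def sobolevCons {n m : ℕ} (x : L2 n) (z : sobolev n m) (h : IsWeakDeriv x (z.1 0)) :
    sobolev n (m + 1) :=
  ⟨WithLp.toLp 2 (Fin.cons (α := fun _ => L2 n) x z.1), fun j => by
    induction j using Fin.cases with
    | zero => exact h
    | succ j => exact z.2 j⟩

/-- The inclusion `W^{b,2} ⊆ W^{a,2}` for `a ≤ b`. -/
def sobolevRes (n : ℕ) {a b : ℕ} (h : a ≤ b) : sobolev n b →L[ℝ] sobolev n a :=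
  (((PiLp.continuousLinearEquiv 2 ℝ (fun _ : Fin (a + 1) => L2 n)).symm.toContinuousLinearMap ∘L
    ContinuousLinearMap.pi fun j : Fin (a + 1) =>
      PiLp.proj 2 (fun _ : Fin (b + 1) => L2 n) (Fin.castLE (Nat.succ_le_succ h) j)) ∘L
    (sobolev n b).subtypeL).codRestrict (sobolev n a) fun x j => x.2 (Fin.castLE h j)

@[simp] theorem sobolevRes_base {n a b : ℕ} (h : a ≤ b) (x : sobolev n b) :
    (sobolevRes n h x).1 0 = x.1 0 := rfl

theorem IsWeakDeriv.compLpL {n k : ℕ} {x y : L2 n} (h : IsWeakDeriv x y) (L : Vec n →L[ℝ] Vec k) :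
    IsWeakDeriv (L.compLpL 2 circleMeasure x) (L.compLpL 2 circleMeasure y) := by
  have key : ∀ (φ : UnitAddCircle → ℝ), Continuous φ → ∀ z : L2 n,
      ∫ t, φ t • (L.compLpL 2 circleMeasure z) t ∂circleMeasure =
        L (∫ t, φ t • z t ∂circleMeasure) := by
    intro φ hφ z
    have hI : Integrable (fun t => φ t • z t) circleMeasure := by
      obtain ⟨C, hC⟩ := isCompact_univ.exists_bound_of_continuousOn hφ.continuousOn
      exact Integrable.bdd_smul (𝕜 := ℝ) (φ := φ) ((Lp.memLp z).integrable (by norm_num)) C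
        hφ.aestronglyMeasurable (ae_of_all _ fun t => hC t trivial)
    rw [← L.integral_comp_comm hI]
    apply integral_congr_ae
    filter_upwards [ContinuousLinearMap.coeFn_compLpL (p := 2) (μ := circleMeasure) L z] with t ht
    rw [ht, map_smul]
  intro φ hφ
  rw [key _ (continuous_circleDeriv hφ), key _ (continuous_of_lift hφ.continuous), h φ hφ, map_neg]

/-- Composition with a linear map between the values. -/
def sobolevPost {n k : ℕ} (L : Vec n →L[ℝ] Vec k) (m : ℕ) : sobolev n m →L[ℝ] sobolev k m :=
  (((PiLp.continuousLinearEquiv 2 ℝ (fun _ : Fin (m + 1) => L2 k)).symm.toContinuousLinearMap ∘L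
    ContinuousLinearMap.pi fun j : Fin (m + 1) =>
      L.compLpL 2 circleMeasure ∘L PiLp.proj 2 (fun _ : Fin (m + 1) => L2 n) j) ∘L
    (sobolev n m).subtypeL).codRestrict (sobolev k m) fun x j => (x.2 j).compLpL L

theorem sobolevPost_apply {n k m : ℕ} (L : Vec n →L[ℝ] Vec k) (x : sobolev n m) (j : Fin (m + 1)) :
    (sobolevPost L m x).1 j = L.compLpL 2 circleMeasure (x.1 j) := rfl

/-! ### Continuous representatives -/

/-- The class in `L²` of a continuous function. -/
def toL2 (n : ℕ) : C(UnitAddCircle, Vec n) →L[ℝ] L2 n := ContinuousMap.toLp 2 circleMeasure ℝ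

theorem toL2_injective (n : ℕ) : Function.Injective (toL2 n) :=
  ContinuousMap.toLp_injective circleMeasure

theorem coeFn_toL2 {n : ℕ} (f : C(UnitAddCircle, Vec n)) : toL2 n f =ᵐ[circleMeasure] f :=
  ContinuousMap.coeFn_toLp circleMeasure f

theorem norm_toL2_le {n : ℕ} (f : C(UnitAddCircle, Vec n)) : ‖toL2 n f‖ ≤ ‖f‖ := by
  have h := Lp.norm_le_of_ae_bound (p := 2) (μ := circleMeasure) (f := toL2 n f) (norm_nonneg f) (by
    filter_upwards [coeFn_toL2 f] with t ht
    rw [ht]; exact f.norm_coe_le_norm t)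
  simpa [measureUnivNNReal] using h

theorem exists_toL2_eq {n : ℕ} (x : sobolev n 1) : ∃ g, toL2 n g = x.1 0 := by
  obtain ⟨g, hg, hx⟩ := IsWeakDeriv.exists_continuous (x.2 0)
  exact ⟨⟨g, hg⟩, Lp.ext ((coeFn_toL2 _).trans hx.symm)⟩

/-- The embedding `W^{1,2} ⊆ C⁰`, as a linear map. -/
def sobolevRepₗ (n : ℕ) : sobolev n 1 →ₗ[ℝ] C(UnitAddCircle, Vec n) where
  toFun x := (exists_toL2_eq x).choose
  map_add' x y := toL2_injective n (by
    rw [map_add, (exists_toL2_eq _).choose_spec, (exists_toL2_eq _).choose_spec,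
      (exists_toL2_eq _).choose_spec]; rfl)
  map_smul' c x := toL2_injective n (by
    rw [map_smul, (exists_toL2_eq _).choose_spec, (exists_toL2_eq _).choose_spec]; rfl)

theorem toL2_sobolevRepₗ {n : ℕ} (x : sobolev n 1) : toL2 n (sobolevRepₗ n x) = x.1 0 :=
  (exists_toL2_eq x).choose_spec

/-- The embedding `W^{m+1,2} ⊆ C⁰`. -/
def sobolevRep (n m : ℕ) : sobolev n (m + 1) →L[ℝ] C(UnitAddCircle, Vec n) :=
  ContinuousLinearMap.comp ⟨sobolevRepₗ n, by
    -- Closed graph theorem: a limit in `C⁰` and a limit in `W^{1,2}` have the same class in `L²`,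
    -- which determines the continuous function.
    refine (sobolevRepₗ n).continuous_of_seq_closed_graph fun u x y hu hy => ?_
    apply toL2_injective
    rw [toL2_sobolevRepₗ]
    refine tendsto_nhds_unique (((toL2 n).continuous.tendsto _).comp hy) ?_
    simp only [Function.comp_def, toL2_sobolevRepₗ]
    exact ((sobolevBase n 1).continuous.tendsto x).comp hu⟩
    (sobolevRes n (Nat.le_add_left 1 m))

theorem toL2_sobolevRep {n m : ℕ} (x : sobolev n (m + 1)) : toL2 n (sobolevRep n m x) = x.1 0 :=
  toL2_sobolevRepₗ (sobolevRes n (Nat.le_add_left 1 m) x)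

theorem sobolevRep_eq_iff {n m : ℕ} {x : sobolev n (m + 1)} {g : C(UnitAddCircle, Vec n)} :
    sobolevRep n m x = g ↔ x.1 0 = toL2 n g := by
  rw [← toL2_sobolevRep, (toL2_injective n).eq_iff]

theorem sobolevRep_injective (n m : ℕ) : Function.Injective (sobolevRep n m) := by
  intro x y h
  apply sobolev_ext
  rw [← toL2_sobolevRep, h, toL2_sobolevRep]

theorem sobolevRep_res {n a b : ℕ} (h : a + 1 ≤ b + 1) (x : sobolev n (b + 1)) :
    sobolevRep n a (sobolevRes n h x) = sobolevRep n b x := by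
  rw [sobolevRep_eq_iff, toL2_sobolevRep, sobolevRes_base]

theorem sobolevRep_incl {n m : ℕ} (x : sobolev n (m + 2)) :
    sobolevRep n m (sobolevIncl n (m + 1) x) = sobolevRep n (m + 1) x := by
  rw [sobolevRep_eq_iff, toL2_sobolevRep, sobolevIncl_base]

theorem sobolevRep_post {n k m : ℕ} (L : Vec n →L[ℝ] Vec k) (x : sobolev n (m + 1))
    (t : UnitAddCircle) : sobolevRep k m (sobolevPost L (m + 1) x) t = L (sobolevRep n m x t) := by
  have : sobolevRep k m (sobolevPost L (m + 1) x) = (L : C(Vec n, Vec k)).comp (sobolevRep n m x) := by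
    rw [sobolevRep_eq_iff, sobolevPost_apply, ← toL2_sobolevRep]
    apply Lp.ext
    filter_upwards [ContinuousLinearMap.coeFn_compLpL (p := 2) (μ := circleMeasure) L
      (toL2 n (sobolevRep n m x)), coeFn_toL2 (sobolevRep n m x),
      coeFn_toL2 ((L : C(Vec n, Vec k)).comp (sobolevRep n m x))] with t h1 h2 h3
    rw [h1, h2, h3]; rfl
  rw [this]; rfl

/-! ### Classical derivatives -/

/-- Integration by parts: `φ f` is periodic, so the integral of its derivative over one period
vanishes. -/
theorem isWeakDeriv_toL2 {n : ℕ} {f f' : C(UnitAddCircle, Vec n)}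
    (h : ∀ a : ℝ, HasDerivAt (fun s : ℝ => f (s : UnitAddCircle)) (f' (a : UnitAddCircle)) a) :
    IsWeakDeriv (toL2 n f) (toL2 n f') := by
  intro φ hφ
  have hφc := continuous_of_lift hφ.continuous
  have hφ' := continuous_circleDeriv hφ
  have e : ∀ (ψ : UnitAddCircle → ℝ) (g : C(UnitAddCircle, Vec n)),
      ∫ t, ψ t • toL2 n g t ∂circleMeasure = ∫ t, ψ t • g t ∂circleMeasure := fun ψ g =>
    integral_congr_ae (by filter_upwards [coeFn_toL2 g] with t ht; rw [ht])
  rw [e, e, eq_neg_iff_add_eq_zero, ← integral_add]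
  · rw [AddCircle.integral_haarAddCircle, ← AddCircle.intervalIntegral_preimage 1 0]
    have hd : ∀ a : ℝ, HasDerivAt (fun s : ℝ => φ (s : UnitAddCircle) • f (s : UnitAddCircle))
        (circleDeriv φ (a : UnitAddCircle) • f (a : UnitAddCircle) +
          φ (a : UnitAddCircle) • f' (a : UnitAddCircle)) a := by
      intro a
      have h1 := ((hφ.differentiable (by simp) a).hasDerivAt).smul (h a)
      rw [← circleDeriv_coe] at h1
      rw [add_comm]
      exact h1
    rw [intervalIntegral.integral_eq_sub_of_hasDerivAt (fun a _ => hd a)]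
    · have : ((0 + 1 : ℝ) : UnitAddCircle) = ((0 : ℝ) : UnitAddCircle) := by
        rw [zero_add]; simp
      rw [this, sub_self, smul_zero]
    · apply Continuous.intervalIntegrable
      exact ((hφ'.smul f.continuous).add (hφc.smul f'.continuous)).comp (AddCircle.continuous_mk' 1)
  · exact (hφ'.smul f.continuous).integrable_of_hasCompactSupport (HasCompactSupport.of_compactSpace _)
  · exact (hφc.smul f'.continuous).integrable_of_hasCompactSupport (HasCompactSupport.of_compactSpace _)

/-- Elements of `L²` with a continuously differentiable representative. -/
def HasC1Rep {n : ℕ} (x : L2 n) : Prop := ∃ f f' : C(UnitAddCircle, Vec n), toL2 n f = x ∧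
  ∀ a : ℝ, HasDerivAt (fun s : ℝ => f (s : UnitAddCircle)) (f' (a : UnitAddCircle)) a

theorem HasC1Rep.sum {n : ℕ} {ι : Type*} (s : Finset ι) {x : ι → L2 n}
    (h : ∀ i ∈ s, HasC1Rep (x i)) : HasC1Rep (∑ i ∈ s, x i) := by
  classical
  induction s using Finset.induction_on with
  | empty => exact ⟨0, 0, by simp, fun a => hasDerivAt_const a 0⟩
  | insert a s ha ih =>
    rw [Finset.sum_insert ha]
    obtain ⟨f, f', hf, hd⟩ := h a (by simp)
    obtain ⟨g, g', hg, hd'⟩ := ih fun i hi => h i (by simp [hi])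
    exact ⟨f + g, f' + g', by rw [map_add, hf, hg], fun a => (hd a).add (hd' a)⟩

theorem recomb_mode_ae {n : ℕ} (i : Fin n) (k : ℤ) (c : ℂ) :
    recomb i (c • mode k) =ᵐ[circleMeasure]
      fun t => (c * fourier k t).re • EuclideanSpace.single i (1 : ℝ) := by
  filter_upwards [recomb_ae i (c • mode k), Lp.coeFn_smul c (mode k),
    coeFn_fourierLp (T := 1) 2 k] with t h1 h2 h3
  rw [h1, h2, Pi.smul_apply, h3, smul_eq_mul]

theorem hasC1Rep_mode {n : ℕ} (i : Fin n) (k : ℤ) (c : ℂ) :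
    HasC1Rep (recomb (n := n) i (c • mode k)) := by
  let f : ℂ → C(UnitAddCircle, Vec n) := fun c =>
    ⟨fun t => (c * fourier k t).re • EuclideanSpace.single i (1 : ℝ), by fun_prop⟩
  refine ⟨f c, f (c * (2 * Real.pi * Complex.I * k)), ?_, fun a => ?_⟩
  · apply Lp.ext
    filter_upwards [coeFn_toL2 (f c), recomb_mode_ae i k c] with t h1 h2
    rw [h1, h2]; rfl
  · refine ((hasDerivAt_fourier_re_im k c a).smul_const
      (EuclideanSpace.single i (1 : ℝ))).congr_deriv ?_
    change _ = (c * (2 * Real.pi * Complex.I * k) * fourier k (a : UnitAddCircle)).re •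
      EuclideanSpace.single i (1 : ℝ)
    rw [mul_assoc c]

theorem hasC1Rep_vtrunc {n : ℕ} (N : ℕ) (x : L2 n) : HasC1Rep (vtrunc n N x) := by
  simp only [vtrunc_apply, trunc_apply, map_sum]
  exact HasC1Rep.sum _ fun i _ => HasC1Rep.sum _ fun k _ => hasC1Rep_mode i k _

/-- Fourier truncation of Sobolev functions. -/
def sobolevTrunc (n m N : ℕ) (x : sobolev n m) : sobolev n m :=
  ⟨ptrunc n m N x.1, fun j => (x.2 j).vtrunc N⟩

theorem tendsto_sobolevTrunc {n m : ℕ} (x : sobolev n m) :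
    Tendsto (fun N => sobolevTrunc n m N x) atTop (𝓝 x) := by
  rw [tendsto_subtype_rng]
  have h : Tendsto (fun N : ℕ => fun j => vtrunc n N (x.1 j)) atTop (𝓝 fun j => x.1 j) :=
    tendsto_pi_nhds.2 fun j => tendsto_vtrunc _
  exact ((PiLp.continuous_toLp 2 (fun _ : Fin (m + 1) => L2 n)).tendsto _).comp h

/-- Functions in `W^{m+2,2}` are continuously differentiable. -/
theorem hasDerivAt_sobolevRep {n m : ℕ} (x : sobolev n (m + 2)) (a : ℝ) :
    HasDerivAt (fun s : ℝ => sobolevRep n (m + 1) x (s : UnitAddCircle))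
      (sobolevRep n m (sobolevDeriv n (m + 1) x) (a : UnitAddCircle)) a := by
  have hlim := tendsto_sobolevTrunc x
  have h0 := ((sobolevRep n (m + 1)).continuous.tendsto x).comp hlim
  have h1 := (((sobolevRep n m).comp (sobolevDeriv n (m + 1))).continuous.tendsto x).comp hlim
  rw [ContinuousMap.tendsto_iff_tendstoUniformly] at h0 h1
  -- The Fourier truncations are continuously differentiable. They converge to `x` in `W^{m+2,2}`,
  -- so their representatives and those of their derivatives converge uniformly, and the limit may
  -- be differentiated termwise.
  refine hasDerivAt_of_tendstoUniformly (l := atTop)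
    (f := fun N (s : ℝ) => sobolevRep n (m + 1) (sobolevTrunc n (m + 2) N x) (s : UnitAddCircle))
    (g' := fun s : ℝ => sobolevRep n m (sobolevDeriv n (m + 1) x) (s : UnitAddCircle))
    (h1.comp fun s : ℝ => (s : UnitAddCircle)) (Eventually.of_forall fun N a => ?_)
    (fun a => h0.tendsto_at _) a
  obtain ⟨f, f', hf, hd⟩ := hasC1Rep_vtrunc N (x.1 0)
  have e0 : sobolevRep n (m + 1) (sobolevTrunc n (m + 2) N x) = f := by
    rw [sobolevRep_eq_iff, hf]; rfl
  have e1 : sobolevRep n m (sobolevDeriv n (m + 1) (sobolevTrunc n (m + 2) N x)) = f' := by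
    rw [sobolevRep_eq_iff]
    have h2 := isWeakDeriv_toL2 hd
    rw [hf] at h2
    exact ((x.2 0).vtrunc N).unique h2
  simp only [Function.comp_apply]
  rw [e0]
  refine (hd a).congr_deriv ?_
  rw [← e1]; rfl

/-! ### Smooth points of the Sobolev scale -/

theorem sobolevScale_toZero {n : ℕ} : ∀ (m : ℕ) (x : sobolev n m),
    ((sobolevScale n).toZero m x : sobolev n 0).1 0 = x.1 0
  | 0, _ => rfl
  | m + 1, x => sobolevScale_toZero m (sobolevIncl n m x)

theorem sobolevScale_inLevel_iff {n m : ℕ} {x : sobolev n 0} :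
    (sobolevScale n).InLevel m x ↔ x.1 0 ∈ (sobolevBase n m).range := by
  constructor
  · rintro ⟨y, rfl⟩
    exact ⟨y, (sobolevScale_toZero m y).symm⟩
  · rintro ⟨y, hy⟩
    exact ⟨y, sobolev_ext ((sobolevScale_toZero m y).trans hy)⟩

theorem recomb_mode_mem_range {n : ℕ} (i : Fin n) (k : ℤ) (c : ℂ) (m : ℕ) :
    recomb i (c • mode k) ∈ (sobolevBase n m).range :=
  ⟨⟨WithLp.toLp 2 fun j : Fin (m + 1) =>
    recomb i ((c * (2 * Real.pi * Complex.I * k) ^ (j : ℕ)) • mode k), fun j => by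
      have := isWeakDeriv_mode (n := n) i k (c * (2 * Real.pi * Complex.I * k) ^ (j : ℕ))
      rw [mul_assoc c, ← pow_succ] at this
      exact this⟩, by simp⟩

theorem vtrunc_mem_range {n : ℕ} (N : ℕ) (x : L2 n) (m : ℕ) :
    vtrunc n N x ∈ (sobolevBase n m).range := by
  simp only [vtrunc_apply, trunc_apply, map_sum]
  exact Submodule.sum_mem _ fun i _ => Submodule.sum_mem _ fun k _ => recomb_mode_mem_range i k _ m

theorem dense_smoothPoints_sobolevScale (n : ℕ) :
    Dense (smoothPoints (sobolevScale n) : Set ((sobolevScale n).level 0)) := by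
  intro x
  refine mem_closure_of_tendsto (tendsto_sobolevTrunc (n := n) (m := 0) x)
    (Eventually.of_forall fun N => ?_)
  exact mem_smoothPoints.2 fun m => sobolevScale_inLevel_iff.2 (vtrunc_mem_range N _ m)

/-! ### The isomorphism `∂ + 1` -/

/-- On the `k`-th Fourier mode `∂ + 1` is multiplication by `1 + 2πik`, whose modulus is at least
its real part `1`; Parseval's identity sums this up. -/
theorem norm_comp_le_of_isWeakDeriv {n : ℕ} {x y : L2 n} (h : IsWeakDeriv x y) (i : Fin n) :
    ‖comp i x‖ ≤ ‖comp i (y + x)‖ := by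
  refine le_of_pow_le_pow_left₀ two_ne_zero (norm_nonneg _)
    (hasSum_le (fun k => ?_) (norm_sq_eq (comp i x)) (norm_sq_eq (comp i (y + x))))
  have e : coef k (comp i (y + x)) = (1 + (2 * Real.pi * k : ℝ) * Complex.I) * coef k (comp i x) := by
    have : coef k (comp i (y + x)) = coef k (comp i y) + coef k (comp i x) := by simp [coef]
    rw [this, h.coef]
    push_cast
    ring
  have h1 : 1 ≤ ‖(1 + (2 * Real.pi * k : ℝ) * Complex.I : ℂ)‖ := by
    refine le_trans ?_ (Complex.abs_re_le_norm _)
    simp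
  rw [e, norm_mul]
  gcongr
  exact le_mul_of_one_le_left (norm_nonneg _) h1

theorem exists_norm_le_deriv_add (n : ℕ) : ∃ C : ℝ, 0 ≤ C ∧ ∀ x y : L2 n, IsWeakDeriv x y →
    ‖x‖ ≤ C * ‖y + x‖ := by
  refine ⟨∑ i : Fin n, ‖(recomb i : Lp ℂ 2 circleMeasure →L[ℝ] L2 n)‖ *
    ‖(comp i : L2 n →L[ℝ] Lp ℂ 2 circleMeasure)‖, by positivity, fun x y h => ?_⟩
  conv_lhs => rw [← sum_recomb_comp x]
  rw [Finset.sum_mul]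
  refine norm_sum_le_of_le _ fun i _ => ?_
  refine ((recomb i).le_opNorm _).trans ?_
  rw [mul_assoc]
  gcongr
  exact (norm_comp_le_of_isWeakDeriv h i).trans ((comp i).le_opNorm _)

/-- The operator `∂ + 1 : H¹ → H`. -/
def derivAddOne (n : ℕ) : ScLin (sobolevScale n).up (sobolevScale n) where
  map m := sobolevDeriv n m + sobolevIncl n m
  comm _ _ := sobolev_ext rfl

/-- `∂ + 1` is bounded below, so its range is closed. The range contains all Fourier modes, and
trigonometric polynomials are dense. -/
theorem surjective_derivAddOne_zero (n : ℕ) : Function.Surjective ((derivAddOne n).map 0) := by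
  let T : sobolev n 1 →L[ℝ] sobolev n 0 := sobolevDeriv n 0 + sobolevIncl n 0
  obtain ⟨C, hC, hC'⟩ := exists_norm_le_deriv_add n
  have hn : ∀ x : sobolev n 0, ‖x‖ = ‖x.1 0‖ := by
    intro x
    rw [Submodule.coe_norm, PiLp.norm_eq_of_L2]
    simp
  have hb : ∀ x : sobolev n 1, ‖x‖ ≤ (2 * C + 1) * ‖T x‖ := by
    intro x
    have h0 := hC' (x.1 0) (x.1 1) (x.2 0)
    have hT : ‖T x‖ = ‖x.1 1 + x.1 0‖ := hn (T x)
    have h1 : ‖x.1 1‖ ≤ ‖T x‖ + ‖x.1 0‖ := by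
      rw [hT]
      calc ‖x.1 1‖ = ‖x.1 1 + x.1 0 - x.1 0‖ := by rw [add_sub_cancel_right]
        _ ≤ _ := norm_sub_le _ _
    have h2 : ‖x‖ ≤ ‖x.1 0‖ + ‖x.1 1‖ := by
      rw [Submodule.coe_norm, PiLp.norm_eq_of_L2]
      refine Real.sqrt_le_iff.2 ⟨by positivity, ?_⟩
      rw [Fin.sum_univ_two]
      nlinarith [norm_nonneg (x.1 0), norm_nonneg (x.1 1)]
    rw [← hT] at h0
    linarith
  have hcl : IsClosed (T.range : Set (sobolev n 0)) := by
    have : AntilipschitzWith (Real.toNNReal (2 * C + 1)) T :=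
      AddMonoidHomClass.antilipschitz_of_bound T fun x => by
        rw [Real.coe_toNNReal _ (by positivity)]; exact hb x
    exact this.isClosed_range T.uniformContinuous
  have hA : ∀ (i : Fin n) (k : ℤ) (c : ℂ), ofL2 (recomb i (c • mode k)) ∈ T.range := by
    intro i k c
    have hne : (1 + 2 * Real.pi * Complex.I * k : ℂ) ≠ 0 := by
      intro h
      have := congrArg Complex.re h
      simp at this
    -- The mode with amplitude `d` solves the equation, because `(1 + 2πik) d = c`.
    set d := c * (1 + 2 * Real.pi * Complex.I * k)⁻¹
    refine ⟨sobolevCons _ (ofL2 _) (isWeakDeriv_mode i k d), sobolev_ext ?_⟩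
    change recomb i ((d * (2 * Real.pi * Complex.I * k)) • mode k) + recomb i (d • mode k) =
      recomb i (c • mode k)
    rw [← map_add, ← add_smul]
    congr 2
    simp only [d]
    field_simp
    ring
  let J : L2 n →ₗ[ℝ] sobolev n 0 :=
    { toFun := ofL2, map_add' := fun _ _ => rfl, map_smul' := fun _ _ => rfl }
  intro y
  change y ∈ (T.range : Set (sobolev n 0))
  rw [← hcl.closure_eq]
  refine mem_closure_of_tendsto (tendsto_sobolevTrunc (n := n) (m := 0) y)
    (Eventually.of_forall fun N => ?_)
  have e : sobolevTrunc n 0 N y = J (vtrunc n N (y.1 0)) := sobolev_ext rfl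
  rw [e]
  simp only [vtrunc_apply, trunc_apply, map_sum]
  exact Submodule.sum_mem _ fun i _ => Submodule.sum_mem _ fun k _ => hA i k _

theorem bijective_derivAddOne (n : ℕ) : ∀ m, Function.Bijective ((derivAddOne n).map m) := by
  obtain ⟨C, hC, hC'⟩ := exists_norm_le_deriv_add n
  have hinj : ∀ m, Function.Injective ((derivAddOne n).map m) := by
    intro m
    refine (injective_iff_map_eq_zero _).2 fun x hx => ?_
    have h1 : (sobolevDeriv n m x).1 0 + x.1 0 = 0 := congrArg (fun z : sobolev n m => z.1 0) hx
    have h2 := hC' _ _ (sobolev_isWeakDeriv (m := m) x)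
    rw [h1, norm_zero, mul_zero] at h2
    exact sobolev_ext (norm_le_zero_iff.1 h2)
  refine fun m => ⟨hinj m, ?_⟩
  induction m with
  | zero => exact surjective_derivAddOne_zero n
  | succ m ih =>
    -- Bootstrapping: the solution `x` found one level lower has `∂x = y - x`, which lies in
    -- `W^{m+1,2}`, so `x` lies in `W^{m+2,2}`.
    intro (y : sobolev n (m + 1))
    obtain ⟨x, hx⟩ := ih (sobolevIncl n m y)
    change sobolev n (m + 1) at x
    have hx' : (sobolevDeriv n m x).1 0 + x.1 0 = y.1 0 :=
      congrArg (fun z : sobolev n m => z.1 0) hx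
    refine ⟨sobolevCons (m := m + 1) (x.1 0) (y - x) ?_, sobolev_ext ?_⟩
    · have : (y - x).1 0 = (sobolevDeriv n m x).1 0 := by
        change y.1 0 - x.1 0 = _
        rw [← hx']; abel
      rw [this]
      exact sobolev_isWeakDeriv x
    · change (y.1 0 - x.1 0) + x.1 0 = y.1 0
      abel

/-! ### Smooth families of maps parametrized by the circle -/

section Family

variable {Q G : Type*} [NormedAddCommGroup Q] [NormedSpace ℝ Q] [NormedAddCommGroup G]
  [NormedSpace ℝ G]

/-- Families `Y_t : Q → G`, `t ∈ S¹`, which are jointly smooth. -/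
def SmoothFamily (Y : UnitAddCircle → Q → G) : Prop :=
  ContDiff ℝ ∞ (fun p : ℝ × Q => Y (p.1 : UnitAddCircle) p.2)

/-- The derivative `∂ₜY`. -/
def tderiv (Y : UnitAddCircle → Q → G) (t : UnitAddCircle) (q : Q) : G :=
  deriv (fun s : ℝ => Y (t + (s : UnitAddCircle)) q) 0

variable {Y : UnitAddCircle → Q → G}

theorem SmoothFamily.continuous (hY : SmoothFamily Y) :
    Continuous (fun p : UnitAddCircle × Q => Y p.1 p.2) := by
  have hq := (QuotientAddGroup.isOpenQuotientMap_mk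
    (N := AddSubgroup.zmultiples (1 : ℝ))).prodMap (IsOpenQuotientMap.id (X := Q))
  exact hq.isQuotientMap.continuous_iff.2 (ContDiff.continuous hY)

theorem SmoothFamily.contDiff (hY : SmoothFamily Y) (t : UnitAddCircle) : ContDiff ℝ ∞ (Y t) := by
  induction t using QuotientAddGroup.induction_on with
  | H a =>
    have h : ContDiff ℝ ∞ (fun p : ℝ × Q => Y (p.1 : UnitAddCircle) p.2) := hY
    exact h.comp (contDiff_prodMk_right a)

theorem SmoothFamily.hasFDerivAt (hY : SmoothFamily Y) (t : UnitAddCircle) (q : Q) :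
    HasFDerivAt (Y t) (fderiv ℝ (Y t) q) q :=
  ((hY.contDiff t).differentiable (by simp) q).hasFDerivAt

theorem SmoothFamily.fderiv (hY : SmoothFamily Y) : SmoothFamily fun t q => fderiv ℝ (Y t) q := by
  refine ContDiff.fderiv (m := ∞) (f := fun (p : ℝ × Q) (q : Q) => Y (p.1 : UnitAddCircle) q)
    (g := fun p => p.2) ?_ contDiff_snd (by simp)
  exact ContDiff.comp hY (g := fun p : ℝ × Q => Y (p.1 : UnitAddCircle) p.2)
    (f := fun z : (ℝ × Q) × Q => (z.1.1, z.2)) (by fun_prop)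

theorem SmoothFamily.tderiv_coe (hY : SmoothFamily Y) (a : ℝ) (q : Q) :
    tderiv Y (a : UnitAddCircle) q =
      _root_.fderiv ℝ (fun p : ℝ × Q => Y (p.1 : UnitAddCircle) p.2) (a, q) (1, 0) := by
  have h1 := (ContDiff.differentiable hY (by simp) (a, q)).hasFDerivAt
  have h2 : HasDerivAt (fun s : ℝ => ((a + s, q) : ℝ × Q)) (1, 0) 0 :=
    ((hasDerivAt_id (0 : ℝ)).const_add a).prodMk (hasDerivAt_const _ q)
  have e : ((a + 0, q) : ℝ × Q) = (a, q) := by rw [add_zero]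
  rw [← e] at h1
  have h3 := HasFDerivAt.comp_hasDerivAt (0 : ℝ) h1 h2
  rw [e] at h3
  exact h3.deriv

theorem SmoothFamily.fderiv_coe (hY : SmoothFamily Y) (a : ℝ) (q v : Q) :
    _root_.fderiv ℝ (Y (a : UnitAddCircle)) q v =
      _root_.fderiv ℝ (fun p : ℝ × Q => Y (p.1 : UnitAddCircle) p.2) (a, q) (0, v) := by
  have h1 := (ContDiff.differentiable hY (by simp) (a, q)).hasFDerivAt
  have h3 := (HasFDerivAt.comp q h1 (hasFDerivAt_prodMk_right a q)).fderiv
  exact DFunLike.congr_fun h3 v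

theorem SmoothFamily.tderiv (hY : SmoothFamily Y) : SmoothFamily (tderiv Y) := by
  have : ContDiff ℝ ∞ (fun p : ℝ × Q =>
      _root_.fderiv ℝ (fun p : ℝ × Q => Y (p.1 : UnitAddCircle) p.2) p (1, 0)) :=
    (ContDiff.fderiv_right (m := ∞) hY (by simp)).clm_apply contDiff_const
  have e : (fun p : ℝ × Q => DelayScale.tderiv Y (p.1 : UnitAddCircle) p.2) = _ :=
    funext fun p => hY.tderiv_coe p.1 p.2
  rw [SmoothFamily, e]
  exact this

/-- The chain rule with the `t`- and `q`-parts kept apart, since both parts are again smooth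
families over the circle. -/
theorem SmoothFamily.hasDerivAt (hY : SmoothFamily Y) {q : ℝ → Q} {q' : Q} {a : ℝ}
    (hq : HasDerivAt q q' a) : HasDerivAt (fun s : ℝ => Y (s : UnitAddCircle) (q s))
      (DelayScale.tderiv Y a (q a) + _root_.fderiv ℝ (Y (a : UnitAddCircle)) (q a) q') a := by
  have h1 := (ContDiff.differentiable hY (by simp) (a, q a)).hasFDerivAt
  have h3 := HasFDerivAt.comp_hasDerivAt a h1 ((hasDerivAt_id a).prodMk hq)
  rw [hY.tderiv_coe, hY.fderiv_coe, ← map_add, Prod.mk_add_mk, add_zero, zero_add]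
  exact h3

theorem SmoothFamily.clm_comp {G' : Type*} [NormedAddCommGroup G'] [NormedSpace ℝ G']
    (hY : SmoothFamily Y) (L : G →L[ℝ] G') : SmoothFamily fun t q => L (Y t q) :=
  L.contDiff.comp hY

theorem SmoothFamily.comp_clm {Q' : Type*} [NormedAddCommGroup Q'] [NormedSpace ℝ Q']
    (hY : SmoothFamily Y) (L : Q' →L[ℝ] Q) : SmoothFamily fun t q => Y t (L q) :=
  ContDiff.comp hY (g := fun p : ℝ × Q => Y (p.1 : UnitAddCircle) p.2)
    (f := fun z : ℝ × Q' => (z.1, L z.2)) (by fun_prop)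

theorem SmoothFamily.clm_apply {H : Type*} [NormedAddCommGroup H] [NormedSpace ℝ H]
    {A : UnitAddCircle → Q → G →L[ℝ] H} (hA : SmoothFamily A) (L : Q →L[ℝ] G) :
    SmoothFamily fun t q => A t q (L q) :=
  ContDiff.clm_apply hA (L.contDiff.comp contDiff_snd)

theorem SmoothFamily.add {Z : UnitAddCircle → Q → G} (hY : SmoothFamily Y) (hZ : SmoothFamily Z) :
    SmoothFamily fun t q => Y t q + Z t q := ContDiff.add hY hZ

end Family

/-! ### Superposition operators with delay on continuous functions -/

section Delay

variable {V : Type*} [NormedAddCommGroup V] [NormedSpace ℝ V]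
  {E G : Type*} [NormedAddCommGroup E] [NormedSpace ℝ E] [NormedAddCommGroup G] [NormedSpace ℝ G]

theorem continuous_coe_circle : Continuous (fun s : ℝ => (s : UnitAddCircle)) :=
  AddCircle.continuous_mk' 1

/-- The function `t ↦ Y_t(c, g(t - ℓ(c)))`. -/
def delayC (ℓ : V →L[ℝ] ℝ) {Y : UnitAddCircle → V × E → G} (hY : SmoothFamily Y)
    (p : V × C(UnitAddCircle, E)) : C(UnitAddCircle, G) :=
  ⟨fun t => Y t (p.1, p.2 (t - (ℓ p.1 : ℝ))), hY.continuous.comp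
    (continuous_id.prodMk (continuous_const.prodMk
      (p.2.continuous.comp (continuous_id.sub continuous_const))))⟩

theorem delayC_apply (ℓ : V →L[ℝ] ℝ) {Y : UnitAddCircle → V × E → G} (hY : SmoothFamily Y)
    (p : V × C(UnitAddCircle, E)) (t : UnitAddCircle) :
    delayC ℓ hY p t = Y t (p.1, p.2 (t - (ℓ p.1 : ℝ))) := rfl

/-- In the compact-open topology, joint continuity in the parameter, the function and `t` suffices.
Continuity in the delay therefore costs no regularity. -/
theorem continuous_delayC (ℓ : V →L[ℝ] ℝ) {Y : UnitAddCircle → V × E → G} (hY : SmoothFamily Y) :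
    Continuous (delayC ℓ hY) := by
  refine ContinuousMap.continuous_of_continuous_uncurry _ ?_
  have h1 : Continuous fun z : (V × C(UnitAddCircle, E)) × UnitAddCircle =>
      z.2 - ((ℓ z.1.1 : ℝ) : UnitAddCircle) :=
    continuous_snd.sub (continuous_coe_circle.comp (ℓ.continuous.comp continuous_fst.fst))
  have h2 : Continuous fun z : (V × C(UnitAddCircle, E)) × UnitAddCircle =>
      (z.2, (z.1.1, z.1.2 (z.2 - ((ℓ z.1.1 : ℝ) : UnitAddCircle)))) :=
    continuous_snd.prodMk (continuous_fst.fst.prodMk (continuous_fst.snd.eval h1))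
  exact hY.continuous.comp h2

/-- The derivative in direction of `E`. -/
def partialDeriv (Y : UnitAddCircle → V × E → G) (t : UnitAddCircle) (q : V × E) : E →L[ℝ] G :=
  (fderiv ℝ (Y t) q).comp (ContinuousLinearMap.inr ℝ V E)

theorem SmoothFamily.partialDeriv {Y : UnitAddCircle → V × E → G} (hY : SmoothFamily Y) :
    SmoothFamily (partialDeriv Y) :=
  hY.fderiv.clm_comp ((ContinuousLinearMap.compL ℝ E (V × E) G).flip (ContinuousLinearMap.inr ℝ V E))

end Delay

/-! ### Translations and multiplication operators on `L²` -/

theorem measurePreserving_shift (τ : UnitAddCircle) :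
    MeasurePreserving (fun t => t - τ) circleMeasure circleMeasure :=
  measurePreserving_sub_right circleMeasure τ

/-- The translation `x ↦ x(· - τ)`. -/
def shiftL2 (n : ℕ) (τ : UnitAddCircle) : L2 n →L[ℝ] L2 n :=
  (Lp.compMeasurePreservingₗᵢ ℝ _ (measurePreserving_shift τ)).toContinuousLinearMap

theorem coeFn_shiftL2 {n : ℕ} (τ : UnitAddCircle) (x : L2 n) :
    shiftL2 n τ x =ᵐ[circleMeasure] fun t => x (t - τ) :=
  Lp.coeFn_compMeasurePreserving x (measurePreserving_shift τ)

/-- Only joint, that is strong, continuity: in general translations do not depend on the delay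
continuously in operator norm. Uniformity is recovered later from compact inclusions. -/
theorem continuous_shiftL2 (n : ℕ) : Continuous fun p : UnitAddCircle × L2 n => shiftL2 n p.1 p.2 := by
  have hg : Continuous fun p : UnitAddCircle × L2 n =>
      (⟨fun t => t - p.1, by fun_prop⟩ : C(UnitAddCircle, UnitAddCircle)) := by
    refine ContinuousMap.continuous_of_continuous_uncurry _ ?_
    exact continuous_snd.sub continuous_fst.fst
  exact continuous_snd.compMeasurePreservingLp hg (fun p => measurePreserving_shift p.1) (by simp)

/-- Multiplication of `L²` functions by continuous matrix valued functions. -/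
def mulL2 (n k : ℕ) : C(UnitAddCircle, Vec n →L[ℝ] Vec k) →L[ℝ] L2 n →L[ℝ] L2 k :=
  ((ContinuousLinearMap.id ℝ (Vec n →L[ℝ] Vec k)).holderL circleMeasure ⊤ 2 2).comp
    (ContinuousMap.toLp ⊤ circleMeasure ℝ)

theorem coeFn_mulL2 {n k : ℕ} (A : C(UnitAddCircle, Vec n →L[ℝ] Vec k)) (x : L2 n) :
    mulL2 n k A x =ᵐ[circleMeasure] fun t => A t (x t) := by
  have h1 := ContinuousLinearMap.coeFn_holder (r := 2) (ContinuousLinearMap.id ℝ (Vec n →L[ℝ] Vec k))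
    (ContinuousMap.toLp ⊤ circleMeasure ℝ A) x
  filter_upwards [h1, ContinuousMap.coeFn_toLp (p := ⊤) (𝕜 := ℝ) circleMeasure A] with t h1 h2
  refine h1.trans ?_
  rw [h2]; rfl

/-- Links the `L²` operators, needed when `∂y` is merely square integrable, with the pointwise
formula that holds for continuous functions. -/
theorem mulL2_shift_toL2 {n k : ℕ} (A : C(UnitAddCircle, Vec n →L[ℝ] Vec k)) (τ : UnitAddCircle)
    (g : C(UnitAddCircle, Vec n)) (f : C(UnitAddCircle, Vec k)) (h : ∀ t, f t = A t (g (t - τ))) :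
    mulL2 n k A (shiftL2 n τ (toL2 n g)) = toL2 k f := by
  apply Lp.ext
  have hs := (measurePreserving_shift τ).quasiMeasurePreserving.ae_eq_comp (coeFn_toL2 g)
  filter_upwards [coeFn_mulL2 A (shiftL2 n τ (toL2 n g)), coeFn_shiftL2 τ (toL2 n g), hs,
    coeFn_toL2 f] with t h1 h2 h3 h4
  rw [h1, h2, h4, h]
  exact congrArg (A t) h3

/-! ### The chain rule for weak derivatives -/

section ChainRule

variable {V : Type*} [NormedAddCommGroup V] [NormedSpace ℝ V] {N M : ℕ}

/-- For `x` in the dense subspace `W^{2,2}` this is the classical chain rule. Both sides depend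
continuously on `x ∈ W^{1,2}`, and being a weak derivative is a closed condition. -/
theorem isWeakDeriv_delayC (ℓ : V →L[ℝ] ℝ) {Y : UnitAddCircle → V × Vec N → Vec M}
    (hY : SmoothFamily Y) (c : V) (x : sobolev N 1) :
    IsWeakDeriv (toL2 M (delayC ℓ hY (c, sobolevRep N 0 x)))
      (toL2 M (delayC ℓ hY.tderiv (c, sobolevRep N 0 x)) +
        mulL2 N M (delayC ℓ hY.partialDeriv (c, sobolevRep N 0 x))
          (shiftL2 N (ℓ c : ℝ) (x.1 1))) := by
  have hrep : Continuous fun x : sobolev N 1 => (c, sobolevRep N 0 x) :=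
    continuous_const.prodMk (sobolevRep N 0).continuous
  have hx1 : Continuous fun x : sobolev N 1 => x.1 1 := continuous_sobolev_iff.1 continuous_id 1
  have hcl : IsClosed {x : sobolev N 1 | IsWeakDeriv (toL2 M (delayC ℓ hY (c, sobolevRep N 0 x)))
      (toL2 M (delayC ℓ hY.tderiv (c, sobolevRep N 0 x)) +
        mulL2 N M (delayC ℓ hY.partialDeriv (c, sobolevRep N 0 x))
          (shiftL2 N (ℓ c : ℝ) (x.1 1)))} := by
    refine isClosed_isWeakDeriv.preimage (f := fun x : sobolev N 1 =>
      (toL2 M (delayC ℓ hY (c, sobolevRep N 0 x)),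
        toL2 M (delayC ℓ hY.tderiv (c, sobolevRep N 0 x)) +
        mulL2 N M (delayC ℓ hY.partialDeriv (c, sobolevRep N 0 x))
          (shiftL2 N (ℓ c : ℝ) (x.1 1)))) ?_
    refine ((toL2 M).continuous.comp ((continuous_delayC ℓ hY).comp hrep)).prodMk (.add ?_ ?_)
    · exact (toL2 M).continuous.comp ((continuous_delayC ℓ hY.tderiv).comp hrep)
    · exact ((mulL2 N M).continuous.comp ((continuous_delayC ℓ hY.partialDeriv).comp hrep)).clm_apply
        ((shiftL2 N _).continuous.comp hx1)
  refine (denseRange_sobolevIncl N 1).induction_on (p := fun x => IsWeakDeriv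
    (toL2 M (delayC ℓ hY (c, sobolevRep N 0 x))) (toL2 M (delayC ℓ hY.tderiv (c, sobolevRep N 0 x)) +
        mulL2 N M (delayC ℓ hY.partialDeriv (c, sobolevRep N 0 x))
          (shiftL2 N (ℓ c : ℝ) (x.1 1)))) x hcl fun x => ?_
  set g := sobolevRep N 0 (sobolevIncl N 1 x) with hg
  set g' := sobolevRep N 0 (sobolevDeriv N 1 x) with hg'
  have e1 : (sobolevIncl N 1 x).1 1 = toL2 N g' := (toL2_sobolevRep (sobolevDeriv N 1 x)).symm
  let f : C(UnitAddCircle, Vec M) := ⟨fun t => delayC ℓ hY.partialDeriv (c, g) t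
    (g' (t - (ℓ c : ℝ))), (ContinuousMap.continuous _).clm_apply (by fun_prop)⟩
  rw [e1, mulL2_shift_toL2 _ _ g' f fun t => rfl, ← map_add]
  refine isWeakDeriv_toL2 fun a => ?_
  have hd : HasDerivAt (fun s : ℝ => ((c, g ((s : UnitAddCircle) - (ℓ c : ℝ))) : V × Vec N))
      (0, g' ((a : UnitAddCircle) - (ℓ c : ℝ))) a := by
    refine (hasDerivAt_const a c).prodMk ?_
    have h1 := hasDerivAt_sobolevRep x (a - ℓ c)
    rw [← sobolevRep_incl] at h1
    have h2 := HasDerivAt.comp_sub_const a (ℓ c) h1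
    simpa only [AddCircle.coe_sub] using h2
  exact hY.hasDerivAt hd

end ChainRule

/-! ### Joining vector valued functions -/

/-- `(ℝᴺ)ᵏ ≅ ℝᵏᴺ`. -/
def joinEquiv (k N : ℕ) : (Fin k → Vec N) ≃L[ℝ] Vec (k * N) :=
  ContinuousLinearEquiv.ofFinrankEq (by simp [Module.finrank_pi_fintype])

/-- The `i`-th block of a vector. -/
def block {k N : ℕ} (i : Fin k) : Vec (k * N) →L[ℝ] Vec N :=
  (ContinuousLinearMap.proj i).comp (joinEquiv k N).symm.toContinuousLinearMap

/-- The functions `(y₀, …, y_{k-1})` as one vector valued function. -/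
def sobolevJoin (k N m : ℕ) : (Fin k → sobolev N m) →L[ℝ] sobolev (k * N) m :=
  ∑ i, (sobolevPost ((joinEquiv k N).toContinuousLinearMap.comp
    (ContinuousLinearMap.single ℝ (fun _ : Fin k => Vec N) i)) m).comp
      (ContinuousLinearMap.proj (φ := fun _ : Fin k => sobolev N m) i)

theorem block_sobolevJoin {k N m : ℕ} (y : Fin k → sobolev N (m + 1)) (i : Fin k)
    (t : UnitAddCircle) :
    block i (sobolevRep (k * N) m (sobolevJoin k N (m + 1) y) t) = sobolevRep N m (y i) t := by
  have h1 : sobolevRep (k * N) m (sobolevJoin k N (m + 1) y) t =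
      joinEquiv k N (fun j => sobolevRep N m (y j) t) := by
    rw [sobolevJoin, _root_.sum_apply, map_sum, ContinuousMap.sum_apply]
    simp only [ContinuousLinearMap.comp_apply, sobolevRep_post, ContinuousLinearMap.proj_apply]
    refine (map_sum (joinEquiv k N) (fun j => Pi.single j (sobolevRep N m (y j) t)) Finset.univ).symm.trans ?_
    rw [Finset.univ_sum_single]
  rw [h1, block]
  simp

theorem sobolevJoin_base {k N m : ℕ} (y : Fin k → sobolev N m) : (sobolevJoin k N m y).1 0 =
    ∑ i, ((joinEquiv k N).toContinuousLinearMap.comp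
      (ContinuousLinearMap.single ℝ (fun _ : Fin k => Vec N) i)).compLpL 2 circleMeasure ((y i).1 0) := by
  rw [← sobolevBase_apply, sobolevJoin, _root_.sum_apply, map_sum]
  rfl

/-! ### Superposition operators with delay on Sobolev functions -/

/-- Induction on `s` with `Y` and the dimensions arbitrary: the weak derivative of `Y_t(c, y(t -
ℓ(c)))` is an operator of the same type, for another family, applied to `(y, ∂y)` one level lower.
Continuity is joint in `c` and `y`, and so includes the delay. -/
theorem exists_delayS (s : ℕ) : ∀ {V : Type} [NormedAddCommGroup V] [NormedSpace ℝ V] {N M : ℕ}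
    (ℓ : V →L[ℝ] ℝ) {Y : UnitAddCircle → V × Vec N → Vec M} (hY : SmoothFamily Y),
    ∃ F : V × sobolev N (s + 1) → sobolev M (s + 1), Continuous F ∧
      ∀ p, sobolevRep M s (F p) = delayC ℓ hY (p.1, sobolevRep N s p.2) := by
  induction s with
  | zero =>
    intro V _ _ N M ℓ Y hY
    have hrep : Continuous fun p : V × sobolev N 1 => (p.1, sobolevRep N 0 p.2) :=
      continuous_fst.prodMk ((sobolevRep N 0).continuous.comp continuous_snd)
    have hx1 : Continuous fun p : V × sobolev N 1 => p.2.1 1 := continuous_sobolev_iff.1 continuous_snd 1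
    -- Here `∂y` is only in `L²`; continuity of the derivative comes from the strong continuity of
    -- translations and the uniform continuity of the coefficient.
    refine ⟨fun p => sobolevCons _ (ofL2 _) (isWeakDeriv_delayC ℓ hY p.1 p.2), ?_, fun p => ?_⟩
    · rw [continuous_sobolev_succ_iff, continuous_sobolev_zero_iff]
      refine ⟨(toL2 M).continuous.comp ((continuous_delayC ℓ hY).comp hrep), .add ?_ ?_⟩
      · exact (toL2 M).continuous.comp ((continuous_delayC ℓ hY.tderiv).comp hrep)
      · refine ((mulL2 N M).continuous.comp
          ((continuous_delayC ℓ hY.partialDeriv).comp hrep)).clm_apply ?_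
        exact (continuous_shiftL2 N).comp
          ((continuous_coe_circle.comp (ℓ.continuous.comp continuous_fst)).prodMk hx1)
    · exact sobolevRep_eq_iff.2 rfl
  | succ s ih =>
    intro V _ _ N M ℓ Y hY
    let P : Fin 2 → V × Vec (2 * N) →L[ℝ] V × Vec N := fun i =>
      (ContinuousLinearMap.id ℝ V).prodMap (block i)
    let J : sobolev N (s + 2) →L[ℝ] sobolev (2 * N) (s + 1) := (sobolevJoin 2 N (s + 1)).comp
      (ContinuousLinearMap.pi ![sobolevIncl N (s + 1), sobolevDeriv N (s + 1)])
    -- The family `(c, (y, y')) ↦ ∂ₜY(c, y) + ∂_yY(c, y) y'`, which at `y' = ∂y` gives the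
    -- derivative by the chain rule.
    have hZ : SmoothFamily fun t (q : V × Vec (2 * N)) =>
        tderiv Y t (P 0 q) + partialDeriv Y t (P 0 q) (P 1 q).2 :=
      (hY.tderiv.comp_clm (P 0)).add ((hY.partialDeriv.comp_clm (P 0)).clm_apply
        ((ContinuousLinearMap.snd ℝ V (Vec N)).comp (P 1)))
    obtain ⟨F, hFc, hF⟩ := ih ℓ hZ
    have hbase : ∀ p : V × sobolev N (s + 2), IsWeakDeriv
        (toL2 M (delayC ℓ hY (p.1, sobolevRep N (s + 1) p.2))) ((F (p.1, J p.2)).1 0) := by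
      intro p
      have h1 := isWeakDeriv_delayC ℓ hY p.1 (sobolevRes N (Nat.le_add_left 1 (s + 1)) p.2)
      rw [sobolevRep_res] at h1
      have e1 : (sobolevRes N (Nat.le_add_left 1 (s + 1)) p.2).1 1 =
          toL2 N (sobolevRep N s (sobolevDeriv N (s + 1) p.2)) := by
        rw [toL2_sobolevRep]; rfl
      rw [e1, mulL2_shift_toL2 _ _ _ (⟨fun t => delayC ℓ hY.partialDeriv (p.1, sobolevRep N (s + 1) p.2)
        t (sobolevRep N s (sobolevDeriv N (s + 1) p.2) (t - (ℓ p.1 : ℝ))),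
        (ContinuousMap.continuous _).clm_apply (by fun_prop)⟩ : C(UnitAddCircle, Vec M))
        fun t => rfl, ← map_add] at h1
      refine (?_ : (F (p.1, J p.2)).1 0 = _) ▸ h1
      rw [← toL2_sobolevRep, hF]
      refine congrArg (toL2 M) (ContinuousMap.ext fun t => ?_)
      have b0 := block_sobolevJoin (fun i => (![sobolevIncl N (s + 1), sobolevDeriv N (s + 1)] i) p.2) 0
        (t - (ℓ p.1 : ℝ))
      have b1 := block_sobolevJoin (fun i => (![sobolevIncl N (s + 1), sobolevDeriv N (s + 1)] i) p.2) 1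
        (t - (ℓ p.1 : ℝ))
      simp only [Matrix.cons_val_zero, Matrix.cons_val_one, sobolevRep_incl] at b0 b1
      change tderiv Y t (p.1, block 0 _) + partialDeriv Y t (p.1, block 0 _) (block 1 _) =
        tderiv Y t (p.1, _) + partialDeriv Y t (p.1, _) _
      exact congrArg₂ _ (congrArg (fun v => tderiv Y t (p.1, v)) b0)
        (congrArg₂ (fun v w => partialDeriv Y t (p.1, v) w) b0 b1)
    refine ⟨fun p => sobolevCons _ _ (hbase p), ?_, fun p => ?_⟩
    · rw [continuous_sobolev_succ_iff]
      refine ⟨(toL2 M).continuous.comp ((continuous_delayC ℓ hY).comp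
        (continuous_fst.prodMk ((sobolevRep N (s + 1)).continuous.comp continuous_snd))), ?_⟩
      exact hFc.comp (continuous_fst.prodMk (J.continuous.comp continuous_snd))
    · exact sobolevRep_eq_iff.2 rfl

theorem sobolevIncl_res {n a b : ℕ} (h : a + 1 ≤ b + 1) (h' : a ≤ b) (x : sobolev n (b + 1)) :
    sobolevIncl n a (sobolevRes n h x) = sobolevRes n h' (sobolevIncl n b x) := sobolev_ext rfl

section DelayS

variable {V : Type} [NormedAddCommGroup V] [NormedSpace ℝ V] {N M : ℕ}

/-- The function `t ↦ Y_t(c, y(t - ℓ(c)))` in `W^{s+1,2}`, for `y ∈ W^{s+1,2}`. -/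
def delayS (s : ℕ) (ℓ : V →L[ℝ] ℝ) {Y : UnitAddCircle → V × Vec N → Vec M} (hY : SmoothFamily Y) :
    V × sobolev N (s + 1) → sobolev M (s + 1) := (exists_delayS s ℓ hY).choose

theorem continuous_delayS (s : ℕ) (ℓ : V →L[ℝ] ℝ) {Y : UnitAddCircle → V × Vec N → Vec M}
    (hY : SmoothFamily Y) : Continuous (delayS s ℓ hY) := (exists_delayS s ℓ hY).choose_spec.1

theorem sobolevRep_delayS (s : ℕ) (ℓ : V →L[ℝ] ℝ) {Y : UnitAddCircle → V × Vec N → Vec M}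
    (hY : SmoothFamily Y) (p : V × sobolev N (s + 1)) :
    sobolevRep M s (delayS s ℓ hY p) = delayC ℓ hY (p.1, sobolevRep N s p.2) :=
  (exists_delayS s ℓ hY).choose_spec.2 p

/-- The operators on different levels are chosen separately; they agree because each is determined
by the same continuous function. -/
theorem delayS_base_eq {s s' : ℕ} (ℓ : V →L[ℝ] ℝ) {Y : UnitAddCircle → V × Vec N → Vec M}
    (hY : SmoothFamily Y) (c : V) {y : sobolev N (s + 1)} {y' : sobolev N (s' + 1)}
    (h : y.1 0 = y'.1 0) : (delayS s ℓ hY (c, y)).1 0 = (delayS s' ℓ hY (c, y')).1 0 := by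
  rw [← toL2_sobolevRep, ← toL2_sobolevRep, sobolevRep_delayS, sobolevRep_delayS]
  have : sobolevRep N s y = sobolevRep N s' y' := by rw [sobolevRep_eq_iff, toL2_sobolevRep, h]
  rw [this]

/-- Point evaluations are continuous and separate points, so a path in a Sobolev space may be
differentiated pointwise in `t` once the candidate derivative is known to be continuous. -/
theorem hasDerivAt_sobolev_of_rep {s : ℕ} {P G : ℝ → sobolev M (s + 1)} (hG : Continuous G)
    (h : ∀ (t : UnitAddCircle) θ, HasDerivAt (fun θ => sobolevRep M s (P θ) t)
      (sobolevRep M s (G θ) t) θ) (θ : ℝ) : HasDerivAt P (G θ) θ :=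
  hasDerivAt_of_separating (fun t => (ContinuousMap.evalCLM ℝ t).comp (sobolevRep M s))
    (fun _ _ hxy => sobolevRep_injective M s (ContinuousMap.ext hxy)) hG h θ

/-! ### The differential in all directions, including the delay -/

/-- The family of the differential: `((c, c'), (y, y', ∂y)) ↦ DY_t(c, y)(c', y' - ℓ(c') ∂y)`. -/
def tangentFamily (ℓ : V →L[ℝ] ℝ) (Y : UnitAddCircle → V × Vec N → Vec M) (t : UnitAddCircle)
    (q : (V × V) × Vec (3 * N)) : Vec M :=
  fderiv ℝ (Y t) (q.1.1, block 0 q.2) (q.1.2, block 1 q.2 - ℓ q.1.2 • block 2 q.2)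

theorem SmoothFamily.tangentFamily (ℓ : V →L[ℝ] ℝ) {Y : UnitAddCircle → V × Vec N → Vec M}
    (hY : SmoothFamily Y) : SmoothFamily (tangentFamily ℓ Y) := by
  have h1 := hY.fderiv.comp_clm (((ContinuousLinearMap.fst ℝ V V).comp
    (ContinuousLinearMap.fst ℝ (V × V) (Vec (3 * N)))).prod
      ((block 0).comp (ContinuousLinearMap.snd ℝ (V × V) (Vec (3 * N)))))
  exact ContDiff.clm_apply h1 (g := fun p : ℝ × ((V × V) × Vec (3 * N)) =>
    (p.2.1.2, block 1 p.2.2 - ℓ p.2.1.2 • block 2 p.2.2)) (by fun_prop)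

/-- The functions `y, h, ∂y` as one vector valued function. -/
def tangentJoin (N s : ℕ) : sobolev N (s + 1) × sobolev N s →L[ℝ] sobolev (3 * N) s :=
  (sobolevJoin 3 N s).comp (ContinuousLinearMap.pi
    ![(sobolevIncl N s).comp (ContinuousLinearMap.fst ℝ _ _), ContinuousLinearMap.snd ℝ _ _,
      (sobolevDeriv N s).comp (ContinuousLinearMap.fst ℝ _ _)])

theorem tangentJoin_base (N s : ℕ) (p : sobolev N (s + 1) × sobolev N s) :
    (tangentJoin N s p).1 0 = ∑ i, ((joinEquiv 3 N).toContinuousLinearMap.comp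
      (ContinuousLinearMap.single ℝ (fun _ : Fin 3 => Vec N) i)).compLpL 2 circleMeasure
        ((![p.1.1 0, p.2.1 0, p.1.1 1] : Fin 3 → L2 N) i) := by
  rw [tangentJoin, ContinuousLinearMap.comp_apply, sobolevJoin_base]
  refine Finset.sum_congr rfl fun i _ => congrArg _ ?_
  fin_cases i <;> rfl

theorem block_tangentJoin (N s : ℕ) (p : sobolev N (s + 2) × sobolev N (s + 1)) (t : UnitAddCircle) :
    block 0 (sobolevRep (3 * N) s (tangentJoin N (s + 1) p) t) = sobolevRep N (s + 1) p.1 t ∧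
    block 1 (sobolevRep (3 * N) s (tangentJoin N (s + 1) p) t) = sobolevRep N s p.2 t ∧
    block 2 (sobolevRep (3 * N) s (tangentJoin N (s + 1) p) t) =
      sobolevRep N s (sobolevDeriv N (s + 1) p.1) t := by
  refine ⟨?_, ?_, ?_⟩
  · refine (block_sobolevJoin _ 0 t).trans ?_
    exact congrArg (fun f : C(UnitAddCircle, Vec N) => f t) (sobolevRep_incl p.1)
  · exact block_sobolevJoin _ 1 t
  · exact block_sobolevJoin _ 2 t

/-- The summand with `ℓ h.1` comes from moving the delay and contains `∂x`. So the base point needs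
one derivative more than the direction `h`, which is the loss built into sc-differentials. -/
theorem sobolevRep_tangent (s : ℕ) (ℓ : V →L[ℝ] ℝ) {Y : UnitAddCircle → V × Vec N → Vec M}
    (hY : SmoothFamily Y) (x : V × sobolev N (s + 2)) (h : V × sobolev N (s + 1))
    (t : UnitAddCircle) :
    sobolevRep M s (delayS s (ℓ.comp (ContinuousLinearMap.fst ℝ V V)) (hY.tangentFamily ℓ)
      ((x.1, h.1), tangentJoin N (s + 1) (x.2, h.2))) t =
    fderiv ℝ (Y t) (x.1, sobolevRep N (s + 1) x.2 (t - (ℓ x.1 : ℝ)))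
      (h.1, sobolevRep N s h.2 (t - (ℓ x.1 : ℝ)) -
        ℓ h.1 • sobolevRep N s (sobolevDeriv N (s + 1) x.2) (t - (ℓ x.1 : ℝ))) := by
  rw [sobolevRep_delayS]
  obtain ⟨b0, b1, b2⟩ := block_tangentJoin N s (x.2, h.2) (t - (ℓ x.1 : ℝ))
  rw [← b0, ← b1, ← b2]
  rfl

/-- The sc-differential of `delayS`. -/
def delayDiff (s : ℕ) (ℓ : V →L[ℝ] ℝ) {Y : UnitAddCircle → V × Vec N → Vec M} (hY : SmoothFamily Y)
    (x : V × sobolev N (s + 2)) : V × sobolev N (s + 1) →L[ℝ] sobolev M (s + 1) where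
  toFun h := delayS s (ℓ.comp (ContinuousLinearMap.fst ℝ V V)) (hY.tangentFamily ℓ)
      ((x.1, h.1), tangentJoin N (s + 1) (x.2, h.2))
  map_add' h h' := by
    -- `delayS` is nonlinear in general; linearity in the direction is visible only in the pointwise
    -- formula.
    refine sobolevRep_injective M s (ContinuousMap.ext fun t =>
      (sobolevRep_tangent s ℓ hY x (h + h') t).trans ?_)
    rw [(sobolevRep M s).map_add, ContinuousMap.add_apply]
    refine Eq.trans ?_ (congrArg₂ (· + ·) (sobolevRep_tangent s ℓ hY x h t)
      (sobolevRep_tangent s ℓ hY x h' t)).symm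
    rw [← (fderiv ℝ (Y t) _).map_add, Prod.mk_add_mk]
    refine congrArg _ (Prod.ext rfl ?_)
    dsimp only
    rw [Prod.mk_add_mk, ℓ.map_add, (sobolevRep N s).map_add, add_smul,
      ContinuousMap.add_apply]
    exact add_sub_add_comm _ _ _ _
  map_smul' c h := by
    refine sobolevRep_injective M s (ContinuousMap.ext fun t =>
      (sobolevRep_tangent s ℓ hY x (c • h) t).trans ?_)
    rw [RingHom.id_apply, (sobolevRep M s).map_smul, ContinuousMap.smul_apply]
    refine Eq.trans ?_ (congrArg (c • ·) (sobolevRep_tangent s ℓ hY x h t)).symm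
    rw [← (fderiv ℝ (Y t) _).map_smul, Prod.smul_mk]
    refine congrArg _ (Prod.ext rfl ?_)
    dsimp only
    rw [Prod.smul_mk, ℓ.map_smul, (sobolevRep N s).map_smul, smul_assoc,
      ContinuousMap.smul_apply, smul_sub]
  cont := (continuous_delayS s _ _).comp ((continuous_const.prodMk continuous_fst).prodMk
    ((tangentJoin N (s + 1)).continuous.comp (continuous_const.prodMk continuous_snd)))

theorem continuous_delayDiff (s : ℕ) (ℓ : V →L[ℝ] ℝ) {Y : UnitAddCircle → V × Vec N → Vec M}
    (hY : SmoothFamily Y) : Continuous fun p : (V × sobolev N (s + 2)) × (V × sobolev N (s + 1)) =>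
      delayDiff s ℓ hY p.1 p.2 :=
  (continuous_delayS s (ℓ.comp (ContinuousLinearMap.fst ℝ V V)) (hY.tangentFamily ℓ)).comp
    ((continuous_fst.fst.prodMk continuous_snd.fst).prodMk
      ((tangentJoin N (s + 1)).continuous.comp (continuous_fst.snd.prodMk continuous_snd.snd)))

/-- Pointwise in `t` this is the chain rule. It applies because functions in `W^{s+2,2}` are
continuously differentiable and can be evaluated along the moving point `t - ℓ(c)`. -/
theorem hasDerivAt_delayS_path (s : ℕ) (ℓ : V →L[ℝ] ℝ) {Y : UnitAddCircle → V × Vec N → Vec M}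
    (hY : SmoothFamily Y) (x h : V × sobolev N (s + 2)) (θ : ℝ) :
    HasDerivAt (fun θ : ℝ => delayS s ℓ hY (x.1 + θ • h.1, sobolevIncl N (s + 1) (x.2 + θ • h.2)))
      (delayDiff s ℓ hY (x + θ • h) (h.1, sobolevIncl N (s + 1) h.2)) θ := by
  refine hasDerivAt_sobolev_of_rep (G := fun θ =>
    delayDiff s ℓ hY (x + θ • h) (h.1, sobolevIncl N (s + 1) h.2))
    ((continuous_delayDiff s ℓ hY).comp ((continuous_const.add
      (continuous_id.smul continuous_const)).prodMk continuous_const)) (fun t θ => ?_) θ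
  rw [show sobolevRep M s (delayDiff s ℓ hY (x + θ • h) (h.1, sobolevIncl N (s + 1) h.2)) t = _ from
    sobolevRep_tangent s ℓ hY (x + θ • h) (h.1, sobolevIncl N (s + 1) h.2) t]
  simp only [sobolevRep_delayS, delayC_apply, sobolevRep_incl]
  induction t using QuotientAddGroup.induction_on with
  | H a =>
    have hb : HasDerivAt (fun θ : ℝ => a - ℓ (x.1 + θ • h.1)) (-(ℓ h.1)) θ := by
      have h1 := ((hasDerivAt_id θ).mul_const (ℓ h.1)).const_sub (a - ℓ x.1)
      rw [one_mul] at h1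
      refine h1.congr_of_eventuallyEq (Eventually.of_forall fun θ => ?_)
      simp only [map_add, map_smul, smul_eq_mul, id_eq]
      ring
    have hz : ∀ z : sobolev N (s + 2), HasDerivAt
        (fun θ : ℝ => sobolevRep N (s + 1) z ((a : UnitAddCircle) - (ℓ (x.1 + θ • h.1) : ℝ)))
        (-(ℓ h.1) • sobolevRep N s (sobolevDeriv N (s + 1) z)
          ((a : UnitAddCircle) - (ℓ (x.1 + θ • h.1) : ℝ))) θ := by
      intro z
      have h1 := (hasDerivAt_sobolevRep z (a - ℓ (x.1 + θ • h.1))).scomp θ hb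
      simpa only [AddCircle.coe_sub, Function.comp_def] using h1
    have hu : HasDerivAt (fun θ : ℝ => (x.1 + θ • h.1, sobolevRep N (s + 1) (x.2 + θ • h.2)
        ((a : UnitAddCircle) - (ℓ (x.1 + θ • h.1) : ℝ))))
        (h.1, sobolevRep N (s + 1) h.2 ((a : UnitAddCircle) - (ℓ (x.1 + θ • h.1) : ℝ)) -
          ℓ h.1 • sobolevRep N s (sobolevDeriv N (s + 1) (x.2 + θ • h.2))
            ((a : UnitAddCircle) - (ℓ (x.1 + θ • h.1) : ℝ))) θ := by
      refine HasDerivAt.prodMk ?_ ?_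
      · simpa using ((hasDerivAt_id θ).smul_const h.1).const_add x.1
      -- Both summands of `x.2 + θ • h.2` are evaluated at the moving point; the product rule for `θ
      -- • h.2` yields the direction `h.2` itself together with a delay contribution.
      · have h1 := (hz x.2).add ((hasDerivAt_id θ).smul (hz h.2))
        simp only [id_eq, one_smul] at h1
        refine (h1.congr_of_eventuallyEq (Eventually.of_forall fun θ => ?_)).congr_deriv ?_
        · simp [map_add, map_smul]
        · simp only [map_add, map_smul, ContinuousMap.add_apply, ContinuousMap.smul_apply]
          module
    exact (hY.hasFDerivAt (a : UnitAddCircle) _).comp_hasDerivAt θ hu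

end DelayS

/-! ### sc-smoothness of superposition operators with delay -/

/-- The scale with levels `W^{j+m+1,2}`, `m ≥ 0`. -/
def sobScale (N j : ℕ) : ScBanach where
  level m := sobolev N (j + m + 1)
  incl m := sobolevIncl N (j + m + 1)
  incl_injective m := sobolevIncl_injective N (j + m + 1)
  incl_compact m := isCompact_sobolevIncl N (j + m + 1)
  incl_dense m := denseRange_sobolevIncl N (j + m + 1)

theorem sobScale_toZero {N j : ℕ} : ∀ (m : ℕ) (x : sobolev N (j + m + 1)),
    ((sobScale N j).toZero m x : sobolev N (j + 1)).1 0 = x.1 0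
  | 0, _ => rfl
  | m + 1, x => sobScale_toZero m (sobolevIncl N (j + m + 1) x)

/-- The two scales have the same levels, but `j + (m + 1) + 1` and `j + 1 + m + 1` are not
definitionally equal, so restriction maps serve as the identification. -/
def sobScaleUp (N j : ℕ) : ScLin (sobScale N j).up (sobScale N (j + 1)) where
  map m := sobolevRes N (show j + 1 + m + 1 ≤ j + (m + 1) + 1 by omega)
  comm m x := sobolevIncl_res (a := j + 1 + m + 1) (b := j + (m + 1) + 1) _ _ x

def sobScaleDown (N j : ℕ) : ScLin (sobScale N (j + 1)) (sobScale N j).up where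
  map m := sobolevRes N (show j + (m + 1) + 1 ≤ j + 1 + m + 1 by omega)
  comm m x := sobolevIncl_res (a := j + (m + 1) + 1) (b := j + 1 + m + 1) _ _ x

section

variable (V : Type) [NormedAddCommGroup V] [NormedSpace ℝ V] [FiniteDimensional ℝ V]

abbrev paramScale (N j : ℕ) : ScBanach := (ScBanach.const V).prod (sobScale N j)

/-- Of a tangent vector `(x, h)`, this keeps the more regular point `x`, on which the first
component of the tangent map depends. Its counterpart `tangentFiberLin` prepares the argument of the
differential. -/
def tangentBaseLin (N j : ℕ) :
    ScLin ((paramScale V N j).up.prod (paramScale V N j)) (paramScale V N (j + 1)) where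
  map m := ((ContinuousLinearMap.fst ℝ V (sobolev N (j + (m + 1) + 1))).prod
    (((sobScaleUp N j).map m).comp (ContinuousLinearMap.snd ℝ V (sobolev N (j + (m + 1) + 1))))).comp
      (ContinuousLinearMap.fst ℝ (V × sobolev N (j + (m + 1) + 1)) (V × sobolev N (j + m + 1)))
  comm m x := Prod.ext rfl ((sobScaleUp N j).comm m x.1.2)

def tangentFiberLin (N j : ℕ) :
    ScLin ((paramScale V N j).up.prod (paramScale V N j)) (paramScale (V × V) (3 * N) j) where
  map m := ((ContinuousLinearMap.fst ℝ V (sobolev N (j + m + 2))).prodMap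
      (ContinuousLinearMap.fst ℝ V (sobolev N (j + m + 1)))).prod
    ((tangentJoin N (j + m + 1)).comp ((ContinuousLinearMap.snd ℝ V (sobolev N (j + m + 2))).prodMap
      (ContinuousLinearMap.snd ℝ V (sobolev N (j + m + 1)))))
  comm m x := Prod.ext rfl (sobolev_ext (n := 3 * N) (m := j + m + 1)
    ((tangentJoin_base N (j + m + 2) (x.1.2, x.2.2)).trans (tangentJoin_base N (j + m + 1)
      (sobolevIncl N (j + m + 2) x.1.2, sobolevIncl N (j + m + 1) x.2.2)).symm))

end

/-- Up to linear sc-operators, the tangent map is a pair of operators of the same class: the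
original one on the shifted scale `j + 1`, and that of `tangentFamily` with parameters in `V × V`
and `3 * N` components. The induction on `k` therefore runs over all `V`, `N`, `Y` and `j` at once.
-/
theorem scContDiffOn_delayS (k : ℕ) : ∀ {V : Type} [NormedAddCommGroup V] [NormedSpace ℝ V]
    [FiniteDimensional ℝ V] {N M : ℕ} (ℓ : V →L[ℝ] ℝ) {Y : UnitAddCircle → V × Vec N → Vec M}
    (hY : SmoothFamily Y) (j : ℕ),
    ScContDiffOn (E := paramScale V N j) (F := sobScale M j) k Set.univ (delayS j ℓ hY) := by
  induction k with
  | zero =>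
    intro V _ _ _ N M ℓ Y hY j
    refine scContDiffOn_zero.2 fun m => ⟨delayS (j + m) ℓ hY, fun x => ?_, continuous_delayS _ _ _⟩
    refine sobolev_ext ((sobScale_toZero m _).trans ?_)
    have e : (paramScale V N j).toZero m x = (x.1, (sobScale N j).toZero m x.2) :=
      (ScBanach.toZero_prod _ _ m x.1 x.2).trans (congrArg₂ Prod.mk (ScBanach.toZero_const V m x.1) rfl)
    rw [e]
    exact delayS_base_eq ℓ hY x.1 (sobScale_toZero m x.2).symm
  | succ k ih =>
    intro V _ _ _ N M ℓ Y hY j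
    refine scContDiffOn_succ.2 ⟨ih ℓ hY j, _, ⟨fun x => delayDiff j ℓ hY x, fun x _ => ⟨?_,
      fun h => ⟨?_, rfl⟩⟩⟩,
      (((ih ℓ hY (j + 1)).comp_scLin (tangentBaseLin V N j)).scLin_comp (sobScaleDown M j)).prodMk
      ((ih (ℓ.comp (ContinuousLinearMap.fst ℝ V V)) (hY.tangentFamily ℓ) j).comp_scLin
        (tangentFiberLin V N j))⟩
    · exact isLittleO_of_hasDerivAt_path (E := paramScale V N j) (F := sobScale M j)
        (fun x => delayDiff j ℓ hY x) (continuous_delayDiff j ℓ hY)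
        (fun x h θ => hasDerivAt_delayS_path j ℓ hY x h θ) x
    · exact sobolev_ext (delayS_base_eq ℓ hY x.1 rfl)

/-! ### The differential at fixed delay -/

section FiberDiff

variable {V : Type} [NormedAddCommGroup V] [NormedSpace ℝ V] {N M : ℕ}

/-- The family `(c, (y, h)) ↦ ∂_y Y_t(c, y) h`. -/
def fiberFamily (Y : UnitAddCircle → V × Vec N → Vec M) (t : UnitAddCircle)
    (q : V × Vec (2 * N)) : Vec M :=
  partialDeriv Y t (q.1, block 0 q.2) (block 1 q.2)

theorem SmoothFamily.fiberFamily {Y : UnitAddCircle → V × Vec N → Vec M}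
    (hY : SmoothFamily Y) : SmoothFamily (fiberFamily Y) :=
  (hY.partialDeriv.comp_clm ((ContinuousLinearMap.id ℝ V).prodMap (block 0))).clm_apply
    ((block 1).comp (ContinuousLinearMap.snd ℝ V (Vec (2 * N))))

/-- The functions `y, h` as one vector valued function. -/
def pairJoin (N s : ℕ) : sobolev N s × sobolev N s →L[ℝ] sobolev (2 * N) s :=
  (sobolevJoin 2 N s).comp (ContinuousLinearMap.pi
    ![ContinuousLinearMap.fst ℝ _ _, ContinuousLinearMap.snd ℝ _ _])

theorem sobolevRep_fiber (s : ℕ) (ℓ : V →L[ℝ] ℝ) {Y : UnitAddCircle → V × Vec N → Vec M}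
    (hY : SmoothFamily Y) (c : V) (y h : sobolev N (s + 1)) (t : UnitAddCircle) :
    sobolevRep M s (delayS s ℓ hY.fiberFamily (c, pairJoin N (s + 1) (y, h))) t =
      partialDeriv Y t (c, sobolevRep N s y (t - (ℓ c : ℝ))) (sobolevRep N s h (t - (ℓ c : ℝ))) := by
  have b0 : block 0 (sobolevRep (2 * N) s (pairJoin N (s + 1) (y, h)) (t - (ℓ c : ℝ))) =
    sobolevRep N s y (t - (ℓ c : ℝ)) := block_sobolevJoin _ 0 _
  have b1 : block 1 (sobolevRep (2 * N) s (pairJoin N (s + 1) (y, h)) (t - (ℓ c : ℝ))) =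
    sobolevRep N s h (t - (ℓ c : ℝ)) := block_sobolevJoin _ 1 _
  rw [sobolevRep_delayS, ← b0, ← b1]
  rfl

/-- The differential of `y ↦ Y_t(c, y(t - ℓ(c)))`. -/
def fiberDiff (s : ℕ) (ℓ : V →L[ℝ] ℝ) {Y : UnitAddCircle → V × Vec N → Vec M} (hY : SmoothFamily Y)
    (c : V) (y : sobolev N (s + 1)) : sobolev N (s + 1) →L[ℝ] sobolev M (s + 1) where
  toFun h := delayS s ℓ hY.fiberFamily (c, pairJoin N (s + 1) (y, h))
  map_add' h h' := by
    refine sobolevRep_injective M s (ContinuousMap.ext fun t =>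
      (sobolevRep_fiber s ℓ hY c y (h + h') t).trans ?_)
    rw [(sobolevRep M s).map_add, ContinuousMap.add_apply, (sobolevRep N s).map_add]
    exact (map_add _ _ _).trans (congrArg₂ (· + ·) (sobolevRep_fiber s ℓ hY c y h t)
      (sobolevRep_fiber s ℓ hY c y h' t)).symm
  map_smul' a h := by
    refine sobolevRep_injective M s (ContinuousMap.ext fun t =>
      (sobolevRep_fiber s ℓ hY c y (a • h) t).trans ?_)
    rw [RingHom.id_apply, (sobolevRep M s).map_smul, ContinuousMap.smul_apply,
      (sobolevRep N s).map_smul]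
    exact (map_smul _ _ _).trans (congrArg (a • ·) (sobolevRep_fiber s ℓ hY c y h t)).symm
  cont := (continuous_delayS s _ _).comp (continuous_const.prodMk
    ((pairJoin N (s + 1)).continuous.comp (continuous_const.prodMk continuous_id)))

theorem sobolevRep_fiberDiff (s : ℕ) (ℓ : V →L[ℝ] ℝ) {Y : UnitAddCircle → V × Vec N → Vec M}
    (hY : SmoothFamily Y) (c : V) (y h : sobolev N (s + 1)) (t : UnitAddCircle) :
    sobolevRep M s (fiberDiff s ℓ hY c y h) t =
      partialDeriv Y t (c, sobolevRep N s y (t - (ℓ c : ℝ))) (sobolevRep N s h (t - (ℓ c : ℝ))) :=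
  sobolevRep_fiber s ℓ hY c y h t

theorem continuous_fiberDiff (s : ℕ) (ℓ : V →L[ℝ] ℝ) {Y : UnitAddCircle → V × Vec N → Vec M}
    (hY : SmoothFamily Y) : Continuous fun p : V × sobolev N (s + 1) × sobolev N (s + 1) =>
      fiberDiff s ℓ hY p.1 p.2.1 p.2.2 :=
  (continuous_delayS s ℓ hY.fiberFamily).comp (continuous_fst.prodMk
    ((pairJoin N (s + 1)).continuous.comp continuous_snd))

theorem fiberDiff_base_eq {s s' : ℕ} (ℓ : V →L[ℝ] ℝ) {Y : UnitAddCircle → V × Vec N → Vec M}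
    (hY : SmoothFamily Y) (c : V) {y h : sobolev N (s + 1)} {y' h' : sobolev N (s' + 1)}
    (hy : y.1 0 = y'.1 0) (hh : h.1 0 = h'.1 0) :
    (fiberDiff s ℓ hY c y h).1 0 = (fiberDiff s' ℓ hY c y' h').1 0 := by
  have e1 : sobolevRep N s y = sobolevRep N s' y' := by rw [sobolevRep_eq_iff, toL2_sobolevRep, hy]
  have e2 : sobolevRep N s h = sobolevRep N s' h' := by rw [sobolevRep_eq_iff, toL2_sobolevRep, hh]
  rw [← toL2_sobolevRep, ← toL2_sobolevRep]
  refine congrArg _ (ContinuousMap.ext fun t => ?_)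
  rw [sobolevRep_fiberDiff, sobolevRep_fiberDiff, e1, e2]

theorem sobolevIncl_fiberDiff (s : ℕ) (ℓ : V →L[ℝ] ℝ) {Y : UnitAddCircle → V × Vec N → Vec M}
    (hY : SmoothFamily Y) (c : V) (y h : sobolev N (s + 2)) :
    sobolevIncl M (s + 1) (fiberDiff (s + 1) ℓ hY c y h) =
      fiberDiff s ℓ hY c (sobolevIncl N (s + 1) y) (sobolevIncl N (s + 1) h) :=
  sobolev_ext (fiberDiff_base_eq ℓ hY c (sobolevIncl_base y).symm (sobolevIncl_base h).symm)

/-- With `c`, and hence the delay, fixed, the evaluation point does not move, no derivative of `y`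
enters, and paths in `W^{s+1,2}` suffice. -/
theorem hasDerivAt_fiber_path (s : ℕ) (ℓ : V →L[ℝ] ℝ) {Y : UnitAddCircle → V × Vec N → Vec M}
    (hY : SmoothFamily Y) (c : V) (y h : sobolev N (s + 1)) (θ : ℝ) :
    HasDerivAt (fun θ : ℝ => delayS s ℓ hY (c, y + θ • h)) (fiberDiff s ℓ hY c (y + θ • h) h) θ := by
  refine hasDerivAt_sobolev_of_rep (G := fun θ => fiberDiff s ℓ hY c (y + θ • h) h)
    ((continuous_fiberDiff s ℓ hY).comp (continuous_const.prodMk ((continuous_const.add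
      (continuous_id.smul continuous_const)).prodMk continuous_const))) (fun t θ => ?_) θ
  rw [sobolevRep_fiberDiff]
  simp only [sobolevRep_delayS, delayC_apply]
  have hu : HasDerivAt (fun θ : ℝ => (c, sobolevRep N s (y + θ • h) (t - (ℓ c : ℝ))))
      (0, sobolevRep N s h (t - (ℓ c : ℝ))) θ := by
    refine (hasDerivAt_const θ c).prodMk ?_
    have h1 := ((hasDerivAt_id θ).smul_const (sobolevRep N s h (t - (ℓ c : ℝ)))).const_add
      (sobolevRep N s y (t - (ℓ c : ℝ)))
    rw [one_smul] at h1
    refine h1.congr_of_eventuallyEq (Eventually.of_forall fun θ => ?_)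
    simp
  exact (hY.hasFDerivAt t _).comp_hasDerivAt θ hu

/-- On bounded sets, the differential at fixed delay is uniformly continuous in operator norm. -/
theorem exists_norm_fiberDiff_sub_le (s : ℕ) (ℓ : V →L[ℝ] ℝ)
    {Y : UnitAddCircle → V × Vec N → Vec M} (hY : SmoothFamily Y) {K : Set V} (hK : IsCompact K)
    (R : ℝ) {δ : ℝ} (hδ : 0 < δ) : ∃ η > 0, ∀ c ∈ K, ∀ y y' : sobolev N (s + 1), ‖y‖ ≤ R → ‖y'‖ ≤ R →
      ‖y - y'‖ < η → ‖(sobolevIncl M s).comp (fiberDiff s ℓ hY c y) -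
        (sobolevIncl M s).comp (fiberDiff s ℓ hY c y')‖ ≤ δ := by
  cases s with
  | zero =>
    set a := ‖sobolevRep N 0‖ with ha
    have ha0 : 0 ≤ a := by positivity
    -- With target `L²`, the sup norm of the coefficient `∂_yY` controls the operator. The Sobolev
    -- embedding, of norm `a`, confines the values of `y` to a fixed compact ball, where `∂_yY` is
    -- uniformly continuous.
    have hcomp : IsCompact ((Set.univ : Set UnitAddCircle) ×ˢ (K ×ˢ Metric.closedBall (0 : Vec N) (a * R))) :=
      isCompact_univ.prod (hK.prod (isCompact_closedBall _ _))
    have huc := hcomp.uniformContinuousOn_of_continuous hY.partialDeriv.continuous.continuousOn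
    obtain ⟨η, hη, hη'⟩ := Metric.uniformContinuousOn_iff.1 huc (δ / (a + 1)) (by positivity)
    refine ⟨η / (a + 1), by positivity, fun c hc y y' hy hy' hyy => ?_⟩
    refine ContinuousLinearMap.opNorm_le_bound _ hδ.le fun h => ?_
    have hb : ∀ z : sobolev N 1, ‖z‖ ≤ R → ∀ t, ‖sobolevRep N 0 z t‖ ≤ a * R := fun z hz t =>
      ((sobolevRep N 0 z).norm_coe_le_norm t).trans (((sobolevRep N 0).le_opNorm z).trans (by gcongr))
    have e : ((sobolevIncl M 0).comp (fiberDiff 0 ℓ hY c y) -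
        (sobolevIncl M 0).comp (fiberDiff 0 ℓ hY c y')) h =
        sobolevIncl M 0 (fiberDiff 0 ℓ hY c y h - fiberDiff 0 ℓ hY c y' h) := by
      rw [map_sub]; rfl
    have hn : ∀ x : sobolev M 0, ‖x‖ = ‖x.1 0‖ := by
      intro x
      rw [Submodule.coe_norm, PiLp.norm_eq_of_L2]
      simp
    rw [e, hn, sobolevIncl_base, ← toL2_sobolevRep]
    refine (norm_toL2_le _).trans ((ContinuousMap.norm_le _ (by positivity)).2 fun t => ?_)
    rw [map_sub, ContinuousMap.sub_apply, sobolevRep_fiberDiff, sobolevRep_fiberDiff,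
      ← _root_.sub_apply]
    have hd : dist (partialDeriv Y t (c, sobolevRep N 0 y (t - (ℓ c : ℝ))))
        (partialDeriv Y t (c, sobolevRep N 0 y' (t - (ℓ c : ℝ)))) < δ / (a + 1) := by
      refine hη' (t, (c, sobolevRep N 0 y (t - (ℓ c : ℝ))))
        ⟨trivial, hc, mem_closedBall_zero_iff.2 (hb y hy _)⟩
        (t, (c, sobolevRep N 0 y' (t - (ℓ c : ℝ))))
        ⟨trivial, hc, mem_closedBall_zero_iff.2 (hb y' hy' _)⟩ ?_
      rw [Prod.dist_eq, Prod.dist_eq, dist_self, dist_self]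
      refine max_lt hη (max_lt hη ?_)
      rw [dist_eq_norm, ← ContinuousMap.sub_apply, ← map_sub]
      refine ((sobolevRep N 0 (y - y')).norm_coe_le_norm _).trans_lt
        (((sobolevRep N 0).le_opNorm _).trans_lt ?_)
      rw [lt_div_iff₀ (by positivity)] at hyy
      nlinarith [norm_nonneg (y - y')]
    rw [dist_eq_norm] at hd
    refine (ContinuousLinearMap.le_of_opNorm_le _ hd.le _).trans ?_
    have h1 : ‖sobolevRep N 0 h (t - (ℓ c : ℝ))‖ ≤ a * ‖h‖ :=
      ((sobolevRep N 0 h).norm_coe_le_norm _).trans ((sobolevRep N 0).le_opNorm h)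
    calc δ / (a + 1) * ‖sobolevRep N 0 h (t - (ℓ c : ℝ))‖ ≤ δ / (a + 1) * ((a + 1) * ‖h‖) := by
          gcongr
          nlinarith [norm_nonneg h]
      _ = δ * ‖h‖ := by field_simp
  | succ s =>
    -- On higher levels the composite with the inclusion factors through the level below, where both
    -- the base points and the unit directions lie in compact sets. Joint continuity there becomes
    -- uniform, which bounds the operator norm.
    obtain ⟨K₁, hK₁, hK₁'⟩ := (isCompact_sobolevIncl N (s + 1)).image_subset_compact_of_bounded
      (Metric.isBounded_closedBall (x := (0 : sobolev N (s + 2))) (r := R))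
    obtain ⟨K₂, hK₂, hK₂'⟩ := (isCompact_sobolevIncl N (s + 1)).image_subset_compact_of_bounded
      (Metric.isBounded_closedBall (x := (0 : sobolev N (s + 2))) (r := 1))
    have huc := (hK.prod (hK₁.prod hK₂)).uniformContinuousOn_of_continuous
      (continuous_fiberDiff s ℓ hY).continuousOn
    obtain ⟨η, hη, hη'⟩ := Metric.uniformContinuousOn_iff.1 huc δ hδ
    set a := ‖sobolevIncl N (s + 1)‖ with ha
    have ha0 : 0 ≤ a := by positivity
    refine ⟨η / (a + 1), by positivity, fun c hc y y' hy hy' hyy => ?_⟩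
    refine ContinuousLinearMap.opNorm_le_of_unit_norm hδ.le fun h hh => ?_
    have e : ((sobolevIncl M (s + 1)).comp (fiberDiff (s + 1) ℓ hY c y) -
        (sobolevIncl M (s + 1)).comp (fiberDiff (s + 1) ℓ hY c y')) h =
        fiberDiff s ℓ hY c (sobolevIncl N (s + 1) y) (sobolevIncl N (s + 1) h) -
        fiberDiff s ℓ hY c (sobolevIncl N (s + 1) y') (sobolevIncl N (s + 1) h) := by
      rw [← sobolevIncl_fiberDiff, ← sobolevIncl_fiberDiff]; rfl
    rw [e, ← dist_eq_norm]
    have hh' := hK₂' ⟨h, mem_closedBall_zero_iff.2 hh.le, rfl⟩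
    refine (hη' (c, sobolevIncl N (s + 1) y, sobolevIncl N (s + 1) h)
      ⟨hc, hK₁' ⟨y, mem_closedBall_zero_iff.2 hy, rfl⟩, hh'⟩
      (c, sobolevIncl N (s + 1) y', sobolevIncl N (s + 1) h)
      ⟨hc, hK₁' ⟨y', mem_closedBall_zero_iff.2 hy', rfl⟩, hh'⟩ ?_).le
    rw [Prod.dist_eq, Prod.dist_eq, dist_self, dist_self]
    refine max_lt hη (max_lt ?_ hη)
    rw [dist_eq_norm, ← map_sub]
    refine ((sobolevIncl N (s + 1)).le_opNorm _).trans_lt ?_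
    rw [lt_div_iff₀ (by positivity)] at hyy
    nlinarith [norm_nonneg (y - y')]

/-- For the coarser norm of `W^{s,2}` on the target the differential is continuous in operator norm,
so the directional derivatives form a Fréchet derivative. -/
theorem hasFDerivAt_delayS (s : ℕ) (ℓ : V →L[ℝ] ℝ) {Y : UnitAddCircle → V × Vec N → Vec M}
    (hY : SmoothFamily Y) (c : V) (y : sobolev N (s + 1)) :
    HasFDerivAt (fun y => sobolevIncl M s (delayS s ℓ hY (c, y)))
      ((sobolevIncl M s).comp (fiberDiff s ℓ hY c y)) y := by
  refine hasFDerivAt_of_hasDerivAt_path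
    (df := fun y => (sobolevIncl M s).comp (fiberDiff s ℓ hY c y)) ?_ fun h θ => ?_
  · refine (Metric.continuousAt_iff (α := sobolev N (s + 1))
      (β := sobolev N (s + 1) →L[ℝ] sobolev M s)).2 fun ε hε => ?_
    obtain ⟨η, hη, hη'⟩ := exists_norm_fiberDiff_sub_le s ℓ hY (isCompact_singleton (x := c))
      (‖y‖ + 1) (half_pos hε)
    refine ⟨min η 1, by positivity, fun y' hy' => ?_⟩
    rw [dist_eq_norm] at hy'
    refine (dist_eq_norm (E := sobolev N (s + 1) →L[ℝ] sobolev M s) _ _).trans_lt ?_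
    have h1 : ‖y'‖ ≤ ‖y‖ + 1 := by
      have := norm_le_norm_add_norm_sub' y' y
      linarith [min_le_right η 1]
    exact (hη' c rfl y' y h1 (by linarith) (hy'.trans_le (min_le_left _ _))).trans_lt (by linarith)
  · exact (sobolevIncl M s).hasFDerivAt.comp_hasDerivAt θ (hasDerivAt_fiber_path s ℓ hY c y h θ)

/-- `L²` functions as elements of the bottom level. -/
def ofL2L (n : ℕ) : L2 n →L[ℝ] sobolev n 0 where
  toFun := ofL2
  map_add' _ _ := rfl
  map_smul' _ _ := rfl
  cont := continuous_sobolev_zero_iff.2 continuous_id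

/-- The differential at fixed delay extends to an operator `W^{s,2} → W^{s,2}`, continuously in the
parameter. -/
theorem exists_fiberDiff_extension (s : ℕ) (ℓ : V →L[ℝ] ℝ) {Y : UnitAddCircle → V × Vec N → Vec M}
    (hY : SmoothFamily Y) (y : sobolev N (s + 1)) : ∃ Ψ : V → sobolev N s →L[ℝ] sobolev M s,
      (Continuous fun p : V × sobolev N s => Ψ p.1 p.2) ∧
      ∀ c h, sobolevIncl M s (fiberDiff s ℓ hY c y h) = Ψ c (sobolevIncl N s h) := by
  cases s with
  | zero =>
    -- On `L²` the extension is translation followed by multiplication with the continuous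
    -- coefficient. On higher levels the differential of the level below already serves.
    refine ⟨fun c => (ofL2L M).comp ((mulL2 N M (delayC ℓ hY.partialDeriv (c, sobolevRep N 0 y))).comp
      ((shiftL2 N (ℓ c : ℝ)).comp (sobolevBase N 0))), ?_, fun c h => ?_⟩
    · refine (ofL2L M).continuous.comp (((mulL2 N M).continuous.comp
        ((continuous_delayC ℓ hY.partialDeriv).comp (continuous_fst.prodMk continuous_const))).clm_apply ?_)
      exact (continuous_shiftL2 N).comp ((continuous_coe_circle.comp
        (ℓ.continuous.comp continuous_fst)).prodMk ((sobolevBase N 0).continuous.comp continuous_snd))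
    · refine sobolev_ext ?_
      rw [sobolevIncl_base, ← toL2_sobolevRep]
      change _ = mulL2 N M _ (shiftL2 N _ (h.1 0))
      rw [← toL2_sobolevRep h]
      exact (mulL2_shift_toL2 _ _ _ _ fun t => sobolevRep_fiberDiff 0 ℓ hY c y h t).symm
  | succ s =>
    exact ⟨fun c => fiberDiff s ℓ hY c (sobolevIncl N (s + 1) y), (continuous_fiberDiff s ℓ hY).comp
      (continuous_fst.prodMk (continuous_const.prodMk continuous_snd)),
      fun c h => sobolevIncl_fiberDiff s ℓ hY c y h⟩

end FiberDiff

/-! ### Finite rank approximation of the inclusion -/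

theorem hasFiniteRange_vtrunc (n N : ℕ) : (vtrunc n N).toLinearMap.HasFiniteRange := by
  have h1 : ∀ k : ℤ, (((innerSL ℂ (mode k)).smulRight (mode k)).restrictScalars ℝ :
      Lp ℂ 2 circleMeasure →L[ℝ] Lp ℂ 2 circleMeasure).toLinearMap ∈
        LinearMap.finiteRange ℝ (Lp ℂ 2 circleMeasure) (Lp ℂ 2 circleMeasure) := by
    intro k
    refine LinearMap.mem_finiteRange_iff_hasFiniteRange.2 ?_
    have h2 : (((ContinuousLinearMap.toSpanSingleton ℂ (mode k)).restrictScalars ℝ :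
      ℂ →L[ℝ] Lp ℂ 2 circleMeasure).toLinearMap).HasFiniteRange := LinearMap.HasFiniteRange.of_finite_dom
    exact h2.comp_right ((innerSL ℂ (mode k)).restrictScalars ℝ).toLinearMap
  have h2 : (trunc N).toLinearMap ∈
      LinearMap.finiteRange ℝ (Lp ℂ 2 circleMeasure) (Lp ℂ 2 circleMeasure) := by
    rw [trunc, ContinuousLinearMap.toLinearMap_sum]
    exact Submodule.sum_mem _ fun k _ => h1 k
  refine LinearMap.mem_finiteRange_iff_hasFiniteRange.1 ?_
  rw [vtrunc, ContinuousLinearMap.toLinearMap_sum]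
  refine Submodule.sum_mem _ fun i _ => LinearMap.mem_finiteRange_iff_hasFiniteRange.2 ?_
  exact ((LinearMap.mem_finiteRange_iff_hasFiniteRange.1 h2).comp_right
    (comp i).toLinearMap).comp_left (recomb i).toLinearMap

/-- Truncating at frequency `N` costs at most a multiple of `‖∂x‖ / (N + 1)`, so the inclusion is a
norm limit of finite rank operators. -/
theorem tendsto_trunc_comp_sobolevIncl (n : ℕ) :
    Tendsto (fun N => (ofL2L n).comp ((vtrunc n N).comp ((sobolevBase n 0).comp (sobolevIncl n 0))))
      atTop (𝓝 (sobolevIncl n 0)) := by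
  obtain ⟨C, hC⟩ := exists_norm_sub_vtrunc_le n
  refine (tendsto_iff_norm_sub_tendsto_zero (E := sobolev n 1 →L[ℝ] sobolev n 0)).2 ?_
  have h0 : Tendsto (fun N : ℕ => |C| * (1 / ((N : ℝ) + 1))) atTop (𝓝 0) := by
    simpa using (tendsto_one_div_add_atTop_nhds_zero_nat (𝕜 := ℝ)).const_mul |C|
  refine squeeze_zero (fun _ => by positivity) (fun N => ?_) h0
  refine ContinuousLinearMap.opNorm_le_bound _ (by positivity) fun x => ?_
  have hn : ∀ x : sobolev n 0, ‖x‖ = ‖x.1 0‖ := by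
    intro x
    rw [Submodule.coe_norm, PiLp.norm_eq_of_L2]
    simp
  rw [hn]
  change ‖vtrunc n N (x.1 0) - x.1 0‖ ≤ _
  rw [norm_sub_rev]
  refine (hC _ _ (x.2 0) N).trans ?_
  have h2 : ‖x.1 1‖ ≤ ‖x‖ := PiLp.norm_apply_le x.1 1
  have h3 : C / ((N : ℝ) + 1) ≤ |C| * (1 / ((N : ℝ) + 1)) := by
    rw [mul_one_div]; gcongr; exact le_abs_self C
  exact mul_le_mul h3 h2 (norm_nonneg _) (by positivity)

/-- `∂ - Ψ` is a Fredholm operator of index zero for every bounded operator `Ψ` on `L²`. -/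
theorem isFredholm_deriv_sub {n : ℕ} (Ψ : sobolev n 0 →L[ℝ] sobolev n 0) :
    (sobolevDeriv n 0 - Ψ.comp (sobolevIncl n 0)).IsFredholm ∧
      fredholmIndex (sobolevDeriv n 0 - Ψ.comp (sobolevIncl n 0)) = 0 := by
  have hb := bijective_derivAddOne n 0
  let T : sobolev n 1 →L[ℝ] sobolev n 0 := sobolevDeriv n 0 + sobolevIncl n 0
  let A : sobolev n 1 ≃L[ℝ] sobolev n 0 := ContinuousLinearEquiv.ofBijective T
    (LinearMap.ker_eq_bot.2 hb.1) (LinearMap.range_eq_top.2 hb.2)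
  -- `∂ - Ψ ∘ incl = (∂ + 1) - (1 + Ψ) ∘ incl`: the added identity makes the leading term
  -- invertible.
  let Φ : sobolev n 0 →L[ℝ] sobolev n 0 := ContinuousLinearMap.id ℝ _ + Ψ
  have hlim : Tendsto (fun N => Φ.comp
      ((ofL2L n).comp ((vtrunc n N).comp ((sobolevBase n 0).comp (sobolevIncl n 0)))))
      atTop (𝓝 (Φ.comp (sobolevIncl n 0))) :=
    ((ContinuousLinearMap.compL ℝ (sobolev n 1) (sobolev n 0) (sobolev n 0) Φ).continuous.tendsto
      _).comp (tendsto_trunc_comp_sobolevIncl n)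
  have hfin : ∀ N, FiniteDimensional ℝ (Φ.comp
      ((ofL2L n).comp ((vtrunc n N).comp ((sobolevBase n 0).comp (sobolevIncl n 0))))).range := by
    intro N
    refine (Submodule.fg_iff_finiteDimensional _).1 ?_
    exact ((((hasFiniteRange_vtrunc n N).comp_right
      ((sobolevBase n 0).comp (sobolevIncl n 0)).toLinearMap).comp_left (ofL2L n).toLinearMap).comp_left
        Φ.toLinearMap)
  have h := isFredholm_sub_of_tendsto A hfin hlim
  have e : (A : sobolev n 1 →L[ℝ] sobolev n 0) - Φ.comp (sobolevIncl n 0) =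
      sobolevDeriv n 0 - Ψ.comp (sobolevIncl n 0) := by
    ext1 x
    change sobolevDeriv n 0 x + sobolevIncl n 0 x - (sobolevIncl n 0 x + Ψ (sobolevIncl n 0 x)) =
      sobolevDeriv n 0 x - Ψ (sobolevIncl n 0 x)
    abel
  rwa [e] at h

/-! ### The delay equation on the Sobolev scale -/

section DelayLevel

variable {n : ℕ} (X : TimeVectorField n)

/-- The vector field as a family depending trivially on a real parameter. -/
def TimeVectorField.family (t : UnitAddCircle) (q : ℝ × Vec n) : Vec n := X.toFun t q.2

theorem TimeVectorField.smoothFamily : SmoothFamily X.family :=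
  X.smooth.comp (contDiff_fst.prodMk (contDiff_snd.comp contDiff_snd))

/-- The map `(τ, x) ↦ X(x(· - τ))` from `ℝ × W^{s+1,2}` to `W^{s+1,2}`. -/
def delayOp (s : ℕ) (p : ℝ × sobolev n (s + 1)) : sobolev n (s + 1) :=
  delayS s (ContinuousLinearMap.id ℝ ℝ) X.smoothFamily p

theorem delayOp_base_eq {s s' : ℕ} (τ : ℝ) {x : sobolev n (s + 1)} {x' : sobolev n (s' + 1)}
    (h : x.1 0 = x'.1 0) : (delayOp X s (τ, x)).1 0 = (delayOp X s' (τ, x')).1 0 :=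
  delayS_base_eq _ X.smoothFamily τ h

theorem delayOp_base (τ : ℝ) (x : sobolev n 1) : (delayOp X 0 (τ, x)).1 0 = delayTerm X τ x := by
  rw [← toL2_sobolevRep, delayOp, sobolevRep_delayS]
  refine Lp.ext ((coeFn_toL2 _).trans (EventuallyEq.trans ?_ (memLp_delay X τ x).coeFn_toLp.symm))
  have hs := (measurePreserving_sub_right circleMeasure (τ : UnitAddCircle)).quasiMeasurePreserving
  have hx := hs.ae_eq_comp (coeFn_toL2 (sobolevRep n 0 x))
  rw [toL2_sobolevRep] at hx
  filter_upwards [hx] with t ht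
  exact congrArg (X.toFun t) ht.symm

/-- The map `s(τ, x) = ∂x - X(x(· - τ))` from `ℝ × W^{m+1,2}` to `W^{m,2}`. -/
def delayLevel (m : ℕ) (p : ℝ × sobolev n (m + 1)) : sobolev n m :=
  sobolevDeriv n m p.2 - sobolevIncl n m (delayOp X m p)

theorem delayMap_eq (p : ℝ × sobolev n 1) : delayMap X p = delayLevel X 0 p :=
  sobolev_ext (congrArg ((sobolevDeriv n 0 p.2).1 0 - ·) (delayOp_base X p.1 p.2).symm)

theorem delayLevel_base_eq {m m' : ℕ} (τ : ℝ) {x : sobolev n (m + 1)} {x' : sobolev n (m' + 1)}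
    (h : x.1 0 = x'.1 0) : (delayLevel X m (τ, x)).1 0 = (delayLevel X m' (τ, x')).1 0 := by
  have h1 := sobolev_isWeakDeriv x
  rw [h] at h1
  exact congrArg₂ (· - ·) (h1.unique (sobolev_isWeakDeriv x')) (delayOp_base_eq X τ h)

/-- A Sobolev function with more regular weak derivative is more regular. -/
theorem exists_sobolevIncl_eq {m : ℕ} (x : sobolev n (m + 1)) (z : sobolev n (m + 1))
    (h : (sobolevDeriv n m x).1 0 = z.1 0) : ∃ x', sobolevIncl n (m + 1) x' = x :=
  ⟨sobolevCons (x.1 0) z (h ▸ sobolev_isWeakDeriv x), sobolev_ext rfl⟩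

/-- Since `∂x = z + X(x(· - τ))` and the delay term is as regular as `x`, the derivative of `x` lies
in `W^{m+1,2}`. -/
theorem delayLevel_regularizing {m : ℕ} (τ : ℝ) (x z : sobolev n (m + 1))
    (h : (delayLevel X m (τ, x)).1 0 = z.1 0) : ∃ x', sobolevIncl n (m + 1) x' = x :=
  exists_sobolevIncl_eq x (z + delayOp X m (τ, x)) (eq_add_of_sub_eq h)

/-- The differential of `s(τ, ·)`. -/
def delayLin (m : ℕ) (τ : ℝ) (x : sobolev n (m + 1)) : sobolev n (m + 1) →L[ℝ] sobolev n m :=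
  sobolevDeriv n m -
    (sobolevIncl n m).comp (fiberDiff m (ContinuousLinearMap.id ℝ ℝ) X.smoothFamily τ x)

theorem hasFDerivAt_delayLevel (m : ℕ) (τ : ℝ) (x : sobolev n (m + 1)) :
    HasFDerivAt (fun x => delayLevel X m (τ, x)) (delayLin X m τ x) x :=
  (sobolevDeriv n m).hasFDerivAt.sub (hasFDerivAt_delayS m _ X.smoothFamily τ x)

theorem delayLin_regularizing {m : ℕ} (τ : ℝ) (x h z : sobolev n (m + 1))
    (e : (delayLin X m τ x h).1 0 = z.1 0) : ∃ h', sobolevIncl n (m + 1) h' = h :=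
  exists_sobolevIncl_eq h (z + fiberDiff m _ X.smoothFamily τ x h) (eq_add_of_sub_eq e)

theorem exists_norm_delayLin_sub_le (m : ℕ) {K : Set ℝ} (hK : IsCompact K) (R : ℝ) {δ : ℝ}
    (hδ : 0 < δ) : ∃ η > 0, ∀ τ ∈ K, ∀ x x' : sobolev n (m + 1), ‖x‖ ≤ R → ‖x'‖ ≤ R →
      ‖x - x'‖ < η → ‖delayLin X m τ x - delayLin X m τ x'‖ ≤ δ := by
  obtain ⟨η, hη, h⟩ := exists_norm_fiberDiff_sub_le m (ContinuousLinearMap.id ℝ ℝ) X.smoothFamily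
    hK R hδ
  refine ⟨η, hη, fun τ hτ x x' hx hx' hxx => ?_⟩
  have h1 := h τ hτ x' x hx' hx (by rwa [norm_sub_rev])
  have e : delayLin X m τ x - delayLin X m τ x' =
      (sobolevIncl n m).comp (fiberDiff m (ContinuousLinearMap.id ℝ ℝ) X.smoothFamily τ x') -
      (sobolevIncl n m).comp (fiberDiff m (ContinuousLinearMap.id ℝ ℝ) X.smoothFamily τ x) :=
    sub_sub_sub_cancel_left _ _ _
  exact (congrArg norm e).trans_le h1

/-- The two differentials differ by `Ψ (r ν) - Ψ τ` applied to the inclusions of the `e ν`. These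
stay in a compact set, on which strong continuity of `Ψ` is uniform. No passage to a subsequence is
needed. -/
theorem tendsto_norm_delayLin {m : ℕ} {τ : ℝ} (x : sobolev n (m + 1)) {r : ℕ → ℝ}
    {e : ℕ → sobolev n (m + 1)} (hr : Tendsto r atTop (𝓝 τ)) (he : ∀ ν, ‖e ν‖ ≤ 1)
    (h : Tendsto (fun ν => ‖delayLin X m (r ν) x (e ν)‖) atTop (𝓝 0)) :
    Tendsto (fun ν => ‖delayLin X m τ x (e ν)‖) atTop (𝓝 0) := by
  obtain ⟨Ψ, hΨ, hΨ'⟩ := exists_fiberDiff_extension m (ContinuousLinearMap.id ℝ ℝ) X.smoothFamily x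
  obtain ⟨K, hK, hK'⟩ := (isCompact_sobolevIncl n m).image_subset_compact_of_bounded
    (Metric.isBounded_closedBall (x := (0 : sobolev n (m + 1))) (r := 1))
  have hd : Tendsto (fun ν => ‖Ψ (r ν) (sobolevIncl n m (e ν)) - Ψ τ (sobolevIncl n m (e ν))‖)
      atTop (𝓝 0) := by
    refine Metric.tendsto_atTop.2 fun ε hε => eventually_atTop.1 ?_
    obtain ⟨v, hv, hv'⟩ := hK.mem_uniformity_of_prod (f := fun c y => Ψ c y)
      (s := Set.univ) (q := τ) hΨ.continuousOn (Set.mem_univ _) (Metric.dist_mem_uniformity hε)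
    rw [nhdsWithin_univ] at hv
    filter_upwards [hr hv] with ν hν
    have h1 := hv' _ hν _ (hK' ⟨e ν, mem_closedBall_zero_iff.2 (he ν), rfl⟩)
    simp only [Set.mem_ofPred_eq, dist_eq_norm] at h1
    rwa [dist_zero_right, norm_norm]
  have hs := h.add hd
  rw [add_zero] at hs
  refine squeeze_zero (fun _ => norm_nonneg _) (fun ν => ?_) hs
  have e : delayLin X m τ x (e ν) = delayLin X m (r ν) x (e ν) +
      (Ψ (r ν) (sobolevIncl n m (e ν)) - Ψ τ (sobolevIncl n m (e ν))) := by
    rw [← hΨ', ← hΨ']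
    change sobolevDeriv n m (e ν) - _ = sobolevDeriv n m (e ν) - sobolevIncl n m (fiberDiff m _ _ _ _ _) + _
    abel_nf
    rfl
  rw [e]
  exact norm_add_le _ _

theorem isFredholm_delayLin (τ : ℝ) (x : sobolev n 1) :
    (delayLin X 0 τ x).IsFredholm ∧ fredholmIndex (delayLin X 0 τ x) = 0 := by
  obtain ⟨Ψ, -, hΨ⟩ := exists_fiberDiff_extension 0 (ContinuousLinearMap.id ℝ ℝ) X.smoothFamily x
  have e : delayLin X 0 τ x = sobolevDeriv n 0 - (Ψ τ).comp (sobolevIncl n 0) :=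
    congrArg (sobolevDeriv n 0 - ·) (ContinuousLinearMap.ext fun h => hΨ τ h)
  rw [e]
  exact isFredholm_deriv_sub _

end DelayLevel

/-! ### Comparison of scales -/

theorem sobolevScale_up_toZero {n : ℕ} : ∀ (m : ℕ) (x : sobolev n (m + 1)),
    ((sobolevScale n).up.toZero m x : sobolev n 1).1 0 = x.1 0
  | 0, _ => rfl
  | m + 1, x => sobolevScale_up_toZero m (sobolevIncl n (m + 1) x)

/-- The inclusion `W^{m+1,2} ⊆ W^{1,2}`. -/
def sobolevToOne (n m : ℕ) : sobolev n (m + 1) →L[ℝ] sobolev n 1 := (sobolevScale n).up.toZero m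

theorem sobolevToOne_base {n m : ℕ} (x : sobolev n (m + 1)) : (sobolevToOne n m x).1 0 = x.1 0 :=
  sobolevScale_up_toZero m x

theorem delayBase_toZero {n : ℕ} (m : ℕ) (p : ℝ × sobolev n (m + 1)) :
    (delayBase n).toZero m p = (p.1, sobolevToOne n m p.2) :=
  (ScBanach.toZero_prod (ScBanach.const ℝ) (sobolevScale n).up m p.1 p.2).trans
    (congrArg₂ Prod.mk (ScBanach.toZero_const ℝ m p.1) rfl)

/-- The inclusion `W^{m+2,2} ⊆ W^{2,2}`. -/
def sobolevToTwo (n m : ℕ) : sobolev n (m + 2) →L[ℝ] sobolev n 2 := (sobolevScale n).up.up.toZero m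

theorem sobolevToTwo_base {n : ℕ} : ∀ {m : ℕ} (x : sobolev n (m + 2)),
    (sobolevToTwo n m x).1 0 = x.1 0
  | 0, _ => rfl
  | m + 1, x => sobolevToTwo_base (m := m) (sobolevIncl n (m + 2) x)

theorem delayBase_up_toZero {n : ℕ} : ∀ (m : ℕ) (p : ℝ × sobolev n (m + 2)),
    (delayBase n).up.toZero m p = (p.1, sobolevToTwo n m p.2)
  | 0, _ => rfl
  | m + 1, p => delayBase_up_toZero m (p.1, sobolevIncl n (m + 2) p.2)

/-- The weak derivative as a linear sc-operator. -/
def derivLin (n : ℕ) : ScLin (sobolevScale n).up (sobolevScale n) where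
  map m := sobolevDeriv n m
  comm _ _ := sobolev_ext rfl

def toSobScaleZero (n : ℕ) : ScLin (sobolevScale n).up (sobScale n 0) where
  map m := sobolevRes n (show 0 + m + 1 ≤ m + 1 by omega)
  comm m x := sobolevIncl_res (a := 0 + m + 1) (b := m + 1) _ _ x

def ofSobScaleZero (n : ℕ) : ScLin (sobScale n 0) (sobolevScale n).up where
  map m := sobolevRes n (show m + 1 ≤ 0 + m + 1 by omega)
  comm m x := sobolevIncl_res (a := m + 1) (b := 0 + m + 1) _ _ x

def toSobScaleOne (n : ℕ) : ScLin (sobolevScale n).up.up (sobScale n 1) where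
  map m := sobolevRes n (show 1 + m + 1 ≤ m + 2 by omega)
  comm m x := sobolevIncl_res (a := 1 + m + 1) (b := m + 2) _ _ x

def ofSobScaleOne (n : ℕ) : ScLin (sobScale n 1) (sobolevScale n).up.up where
  map m := sobolevRes n (show m + 2 ≤ 1 + m + 1 by omega)
  comm m x := sobolevIncl_res (a := m + 2) (b := 1 + m + 1) _ _ x

/-- `(ℝ ⊕ H¹)¹` and `ℝ ⊕ H²` are the same scale. -/
def delayBaseUp (n : ℕ) :
    ScLin (delayBase n).up ((ScBanach.const ℝ).prod (sobolevScale n).up.up) where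
  map m := ContinuousLinearMap.id ℝ (ℝ × sobolev n (m + 2))
  comm _ _ := rfl

/-! ### sc-smoothness of the delay equation -/

theorem scContDiffOn_delayOp_zero {n : ℕ} (X : TimeVectorField n) (k : ℕ) :
    ScContDiffOn (E := delayBase n) (F := (sobolevScale n).up) k Set.univ (delayOp X 0) := by
  have h := ((scContDiffOn_delayS k (ContinuousLinearMap.id ℝ ℝ) X.smoothFamily 0).comp_scLin
    ((ScLin.id (ScBanach.const ℝ)).prodMap (toSobScaleZero n))).scLin_comp (ofSobScaleZero n)
  refine (congrArg (ScContDiffOn (E := delayBase n) (F := (sobolevScale n).up) k Set.univ)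
    (funext fun p => ?_)).mp h
  exact sobolev_ext (n := n) (m := 1) (delayS_base_eq _ X.smoothFamily _ rfl)

theorem scContDiffOn_delayOp_one {n : ℕ} (X : TimeVectorField n) (k : ℕ) :
    ScContDiffOn (E := (delayBase n).up) (F := (sobolevScale n).up.up) k Set.univ (delayOp X 1) := by
  have h := ((scContDiffOn_delayS k (ContinuousLinearMap.id ℝ ℝ) X.smoothFamily 1).comp_scLin
    (((ScLin.id (ScBanach.const ℝ)).prodMap (toSobScaleOne n)).comp (delayBaseUp n))).scLin_comp
      (ofSobScaleOne n)
  refine (congrArg (ScContDiffOn (E := (delayBase n).up) (F := (sobolevScale n).up.up) k Set.univ)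
    (funext fun p => ?_)).mp h
  exact sobolev_ext (n := n) (m := 2) (delayS_base_eq _ X.smoothFamily _ rfl)

theorem scContDiffOn_delayMap {n : ℕ} (X : TimeVectorField n) (k : ℕ) :
    ScContDiffOn (E := delayBase n) (F := sobolevScale n) k Set.univ (delayMap X) := by
  have h := (((derivLin n).comp (ScLin.snd (ScBanach.const ℝ) (sobolevScale n).up)).scContDiffOn k).sub
    ((scContDiffOn_delayOp_zero X k).scLin_comp (ScLin.incl (sobolevScale n)))
  refine (congrArg (ScContDiffOn (E := delayBase n) (F := sobolevScale n) k Set.univ)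
    (funext fun p => ?_)).mp h
  exact (delayMap_eq X p).symm

theorem scContDiffOn_delayLevel_one {n : ℕ} (X : TimeVectorField n) (k : ℕ) :
    ScContDiffOn (E := (delayBase n).up) (F := (sobolevScale n).up) k Set.univ (delayLevel X 1) :=
  (((derivLin n).up.comp ((ScLin.snd (ScBanach.const ℝ) (sobolevScale n).up.up).comp
    (delayBaseUp n))).scContDiffOn k).sub
    ((scContDiffOn_delayOp_one X k).scLin_comp (ScLin.incl (sobolevScale n).up))

/-! ### The sc-Fredholm property with respect to the splitting -/

section Split

variable {n : ℕ} (X : TimeVectorField n)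

/-- The differential of `s(τ, ·)` at a smooth point as a linear sc-operator. -/
def delayScLin (τ : ℝ) (x : ∀ m, sobolev n (m + 1))
    (hx : ∀ m, sobolevIncl n (m + 1) (x (m + 1)) = x m) :
    ScLin (sobolevScale n).up (sobolevScale n) where
  map m := delayLin X m τ (x m)
  comm m h := by
    refine sobolev_ext (n := n) (m := m) (congrArg ((sobolevDeriv n (m + 1) h).1 0 - ·) ?_)
    refine fiberDiff_base_eq (s := m + 1) (s' := m) _ X.smoothFamily τ ?_ rfl
    exact congrArg (fun z : sobolev n (m + 1) => z.1 0) (hx m)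

theorem delayScLin_regularizing (τ : ℝ) (x : ∀ m, sobolev n (m + 1))
    (hx : ∀ m, sobolevIncl n (m + 1) (x (m + 1)) = x m) (m : ℕ) :
    ∀ h : sobolev n 1, (sobolevScale n).InLevel m ((delayScLin X τ x hx).map 0 h) →
      (sobolevScale n).up.InLevel m h := by
  induction m with
  | zero => exact fun h _ => ⟨h, rfl⟩
  | succ m ih =>
    intro h hh
    obtain ⟨z, hz⟩ := hh
    obtain ⟨y, hy⟩ := ih h ⟨(sobolevScale n).incl m z, hz⟩
    change sobolev n (m + 1) at y z
    have e : (delayLin X m τ (x m) y).1 0 = z.1 0 := by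
      have h1 := (delayScLin X τ x hx).toZero_map m y
      rw [hy, ← hz] at h1
      have h2 := congrArg (fun z : sobolev n 0 => z.1 0) h1
      exact ((sobolevScale_toZero m _).symm.trans h2).trans (sobolevScale_toZero (m + 1) z)
    obtain ⟨y', hy'⟩ := delayLin_regularizing X τ (x m) y z e
    exact ⟨y', (congrArg ((sobolevScale n).up.toZero m) hy').trans hy⟩

theorem delayMap_regularizing {m : ℕ} (τ : ℝ) (x : sobolev n (m + 1))
    (h : (sobolevScale n).InLevel (m + 1) (delayMap X (τ, sobolevToOne n m x))) :
    ∃ x', sobolevIncl n (m + 1) x' = x := by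
  obtain ⟨z, hz⟩ := sobolevScale_inLevel_iff.1 h
  refine delayLevel_regularizing X τ x z ?_
  rw [delayMap_eq] at hz
  exact (delayLevel_base_eq X τ (sobolevToOne_base x).symm).trans hz.symm

theorem isScFredholmSplitAt_delayMap (τ : ℝ) (x : ∀ m, sobolev n (m + 1))
    (hx : ∀ m, sobolevIncl n (m + 1) (x (m + 1)) = x m) :
    IsScFredholmSplitAt (V := ℝ) (E' := (sobolevScale n).up) (F := sobolevScale n)
      (delayMap X) (τ, x 0) := by
  let c : ScPoint (delayBase n) := ⟨fun m => (τ, x m), fun m => Prod.ext rfl (hx m)⟩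
  have hz : ∀ m (e : sobolev n (m + 1)), sobolevToOne n m (e + x m) = sobolevToOne n m e + x 0 := by
    intro m e
    have hx0 : ∀ m, (x m).1 0 = (x 0).1 0 := fun m => by
      induction m with
      | zero => rfl
      | succ m ih => rw [← ih, ← hx m]; rfl
    refine sobolev_ext ((sobolevToOne_base _).trans ?_)
    exact congrArg₂ (· + ·) (sobolevToOne_base e).symm (hx0 m)
  refine ⟨fun k => (scContDiffOn_delayMap X k).comp_affine (ScLin.id (delayBase n)) c, ?_, ?_⟩
  -- Regularity holds globally, so the radius `1` is arbitrary.
  · refine fun m => ⟨1, one_pos, fun (e : ℝ × sobolev n (m + 1)) _ he => ?_⟩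
    have h1 : (e.1, sobolevToOne n m e.2) + (τ, x 0) = (e.1 + τ, sobolevToOne n m (e.2 + x m)) :=
      Prod.ext rfl (hz m e.2).symm
    rw [delayBase_toZero] at he
    have h2 : (sobolevScale n).InLevel (m + 1)
      (delayMap X ((e.1, sobolevToOne n m e.2) + (τ, x 0))) := he
    rw [h1] at h2
    obtain ⟨x', hx'⟩ := delayMap_regularizing X _ _ h2
    refine ⟨(e.1, x' - x (m + 1)), Prod.ext rfl ?_⟩
    change sobolevIncl n (m + 1) (x' - x (m + 1)) = e.2
    rw [map_sub, hx', hx m]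
    exact add_sub_cancel_right _ _
  -- No smallness is needed here either: `ε m = 1` only confines the uniform continuity estimate to
  -- a bounded set.
  · refine ⟨fun _ => 1, fun m r (e : sobolev n (m + 1)) => delayLevel X m (r + τ, e + x m),
      fun m r (e : sobolev n (m + 1)) => delayLin X m (r + τ) (e + x m), fun _ => one_pos,
      fun m r e => ?_, fun m r e _ _ => ?_, fun m δ hδ => ?_, fun m r e hr he h => ?_, ?_,
      fun r _ => ⟨(isFredholm_delayLin X _ _).1, ?_, fun h hh => ?_⟩⟩
    · change sobolev n (m + 1) at e
      have e1 : delayMap X (r + τ, sobolevToOne n m e + x 0) =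
          (sobolevScale n).toZero m (delayLevel X m (r + τ, e + x m)) := by
        rw [← hz, delayMap_eq]
        refine sobolev_ext (n := n) (m := 0) (Eq.trans ?_ (sobolevScale_toZero m _).symm)
        exact delayLevel_base_eq X _ (sobolevToOne_base _)
      exact e1.symm
    · change sobolev n (m + 1) at e
      have h1 := (hasFDerivAt_delayLevel X m (r + τ) (e + x m)).comp e
        ((hasFDerivAt_id e).add_const (x m))
      exact h1
    -- The unit balls around the smooth point: `r + τ` is within `1` of `τ`, and `e + x m` has norm
    -- at most `‖x m‖ + 1`.
    · obtain ⟨η, hη, h⟩ := exists_norm_delayLin_sub_le X m (isCompact_closedBall τ 1) (‖x m‖ + 1) hδ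
      refine ⟨η, hη, fun r (e : sobolev n (m + 1)) (e' : sobolev n (m + 1)) hr he he' hee => ?_⟩
      have hb : ∀ e : sobolev n (m + 1), ‖e‖ < 1 → ‖e + x m‖ ≤ ‖x m‖ + 1 := fun e he =>
        (norm_add_le _ _).trans (by linarith)
      refine h (r + τ) ?_ (e + x m) (e' + x m) (hb e he) (hb e' he') ?_
      · rw [Metric.mem_closedBall, dist_eq_norm, add_sub_cancel_right]
        exact hr.le
      · rw [add_sub_add_right_eq_sub]
        exact hee
    · refine ⟨id, strictMono_id, ?_⟩
      have hr' : Tendsto (fun ν => r ν + τ) atTop (𝓝 (0 + τ)) := hr.add_const τ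
      exact tendsto_norm_delayLin (m := m) X (0 + x m) hr' he h
    · have e1 : delayLin X 0 (0 + τ) (0 + x 0) = delayLin X 0 τ (x 0) :=
        congrArg₂ (delayLin X 0) (zero_add τ) (zero_add (x 0))
      have h1 : IsLinearScFredholm ((delayScLin X τ x hx).map 0) :=
        isLinearScFredholm_of_regularizing _ (isFredholm_delayLin X τ (x 0)).1
          (delayScLin_regularizing X τ x hx) (dense_smoothPoints_sobolevScale n)
      exact (congrArg (IsLinearScFredholm (E := (sobolevScale n).up) (F := sobolevScale n)) e1).mpr h1
    · exact (isFredholm_delayLin X _ _).2.trans (isFredholm_delayLin X _ _).2.symm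
    · obtain ⟨h', hh'⟩ := delayLin_regularizing (m := 0) X _ _ h 0
        (congrArg (fun z : sobolev n 0 => z.1 0) hh)
      exact ⟨h', hh'⟩

theorem isScFredholmSectionSplit_delaySection :
    IsScFredholmSectionSplit (V := ℝ) (E' := (sobolevScale n).up) (F := sobolevScale n)
      (delaySection X) where
  isSection _ := rfl
  scSmooth k := (scContDiffOn_id k (delayBase n)).prodMk (scContDiffOn_delayMap X k)
  fredholm p hp := by
    obtain ⟨q, rfl⟩ := hp.exists_scPoint
    exact isScFredholmSplitAt_delayMap X (q.pt 0).1 (fun m => (q.pt m).2)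
      fun m => congrArg Prod.snd (q.comm m)

end Split

/-! ### The sc-Fredholm property of Hofer, Wysocki and Zehnder -/

section HWZ

variable {n : ℕ} (X : TimeVectorField n)

def delaySectionUp (p : (delayBase n).up.level 0) :
    ((delayBase n).up.prod (sobolevScale n).up).level 0 := (p, delayLevel X 1 p)

theorem incl_delaySectionUp (p : (delayBase n).up.level 0) :
    ((delayBase n).prod (sobolevScale n)).incl 0 (delaySectionUp X p) =
      delaySection X ((delayBase n).incl 0 p) := by
  refine Prod.ext rfl ?_
  refine Eq.trans (sobolev_ext (n := n) (m := 0) ?_)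
    (delayMap_eq X (p.1, sobolevIncl n 1 p.2)).symm
  exact delayLevel_base_eq (m := 1) (m' := 0) X p.1 rfl

/-- The chart `(r, e) ↦ (r, (∂ + 1) e)`. -/
def delayChart (n : ℕ) : ScLin (delayBase n).up (euclProd 1 (sobolevScale n).up) :=
  ((ScLin.const (ContinuousLinearEquiv.ofFinrankEq (𝕜 := ℝ) (E := ℝ) (F := EuclideanSpace ℝ (Fin 1))
    (by simp) : ℝ →L[ℝ] EuclideanSpace ℝ (Fin 1))).prodMap (derivAddOne n).up).comp (delayBaseUp n)

theorem bijective_delayChart (n m : ℕ) : Function.Bijective ((delayChart n).map m) :=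
  (ContinuousLinearEquiv.ofFinrankEq (𝕜 := ℝ) (E := ℝ) (F := EuclideanSpace ℝ (Fin 1))
    (by simp)).bijective.prodMap (bijective_derivAddOne n (m + 1))

/-- All nonlinearity sits in the delay term, which takes values in `W^{2,2}` while the fibre begins
with `W^{1,2}`, so it is an `sc⁺`-term. What remains after subtracting `g` is linear and invertible
in the Sobolev direction. -/
theorem isHWZFredholmGerm_delayLevel (q : ScPoint (delayBase n).up) :
    IsHWZFredholmGerm (E := (delayBase n).up) (F := (sobolevScale n).up)
      (fun p => delayLevel X 1 (p + q.pt 0)) := by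
  let ψ := delayChart n
  let χ := ψ.inverse (bijective_delayChart n)
  -- Since `∂ + 1` is bijective, no finite dimensional factor is needed in the fibre, whence `b =
  -- 0`; `a = 1` accounts for the delay parameter.
  let Γ : ScLin (sobolevScale n).up (euclProd 0 (sobolevScale n).up) :=
    (ScLin.zero _ _).pair (ScLin.id _)
  let Λ : ScLin (euclProd 0 (sobolevScale n).up) (sobolevScale n).up := ScLin.snd _ _
  let q₀ : ℝ × sobolev n 2 := q.pt 0
  let q₁ : ℝ × sobolev n 3 := q.pt 1
  have hq : sobolevIncl n 2 q₁.2 = q₀.2 := congrArg Prod.snd (q.comm 0)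
  -- The constant `∂x*` lies in `W^{2,2}` because the smooth point has a representative in
  -- `W^{3,2}`. The summand `-p.2` turns the remaining `∂` into `∂ + 1`.
  let g : ℝ × sobolev n 2 → sobolev n 2 := fun p =>
    sobolevDeriv n 2 q₁.2 - delayOp X 1 (p + q₀) - p.2
  have hg : ∀ p : ℝ × sobolev n 2, delayLevel X 1 (p + q₀) - sobolevIncl n 1 (g p) =
      sobolevDeriv n 1 p.2 + sobolevIncl n 1 p.2 := by
    intro p
    have h1 : sobolevIncl n 1 (sobolevDeriv n 2 q₁.2) = sobolevDeriv n 1 q₀.2 := by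
      rw [← hq]; exact sobolev_ext rfl
    simp only [g, delayLevel, map_sub, h1, Prod.snd_add, map_add]
    abel
  refine ⟨1, 0, (sobolevScale n).up, Set.univ, Set.univ, ψ.map 0, χ.map 0,
    fun _ => (Γ.map 0).toLinearMap, fun _ => (Λ.map 0).toLinearMap, g, trivial,
    ⟨isOpen_univ, isOpen_univ, Set.mapsTo_univ _ _, Set.mapsTo_univ _ _,
      ⟨fun x _ => ψ.inverse_map _ 0 x, fun y _ => ψ.map_inverse _ 0 y⟩,
      ψ.scContDiffOn, χ.scContDiffOn⟩, map_zero (ψ.map 0),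
    ⟨fun k => ScLin.scContDiffOn (Γ.comp (ScLin.snd (delayBase n).up (sobolevScale n).up)) k,
      fun _ => Γ.map 1, fun _ _ k => Γ.comm 0 k,
      fun k => ScLin.scContDiffOn (Γ.up.comp (ScLin.snd (delayBase n).up (sobolevScale n).up.up)) k⟩,
    ⟨fun k => ScLin.scContDiffOn (Λ.comp (ScLin.snd (euclProd 1 (sobolevScale n).up) _)) k,
      fun _ => Λ.map 1, fun _ _ k => Λ.comm 0 k,
      fun k => ScLin.scContDiffOn (Λ.up.comp (ScLin.snd (euclProd 1 (sobolevScale n).up) _)) k⟩,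
    fun _ _ _ => rfl, fun _ _ k => Prod.ext
      (Subsingleton.elim (α := EuclideanSpace ℝ (Fin 0)) _ _) rfl, fun k => ?_, ?_, ?_⟩
  · let z : ScPoint (sobolevScale n).up.up := (derivLin n).up.up.mapPoint
      (((ScLin.snd (ScBanach.const ℝ) (sobolevScale n).up.up).comp (delayBaseUp n)).up.mapPoint q.up)
    exact ((scContDiffOn_const z k).sub
      ((scContDiffOn_delayOp_one X k).comp_affine (ScLin.id (delayBase n).up) q)).sub
      (ScLin.scContDiffOn ((ScLin.snd (ScBanach.const ℝ) (sobolevScale n).up.up).comp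
        (delayBaseUp n)) k)
  · have h1 := hg 0
    simp only [Prod.snd_zero, map_zero, add_zero] at h1
    exact (sub_eq_zero.1 h1).symm
  · let χ₀ : (euclProd 1 (sobolevScale n).up).level 0 → ℝ × sobolev n 2 := χ.map 0
    have hh : ∀ y, Γ.map 0 (delayLevel X 1 (χ₀ y + q₀) - sobolevIncl n 1 (g (χ₀ y))) = (0, y.2) := by
      intro y
      rw [hg]
      have h1 : (ψ.map 0 (χ.map 0 y)).2 = y.2 :=
        congrArg Prod.snd (ψ.map_inverse (bijective_delayChart n) 0 y)
      exact Prod.ext rfl h1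
    -- By `hh` the germ is exactly `(c, w) ↦ (0, w)`, so `B` vanishes identically and the
    -- contraction estimate holds with difference `0` on any ball.
    refine ⟨(hh 0).trans rfl, fun m ε hε => ⟨1, one_pos, fun c w w' _ _ _ => ⟨0, ?_, ?_⟩⟩⟩
    · have h1 : ∀ v : (sobolevScale n).up.level 0, v - (Γ.map 0 (delayLevel X 1 (χ₀ (c, v) + q₀) -
          sobolevIncl n 1 (g (χ₀ (c, v))))).2 = 0 := fun v =>
        sub_eq_zero.2 (congrArg Prod.snd (hh (c, v))).symm
      exact (map_zero _).trans ((congrArg₂ (· - ·) (h1 _) (h1 _)).trans (sub_zero 0)).symm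
    · rw [norm_zero]; positivity

theorem isHWZFredholmSection_delaySectionUp : IsHWZFredholmSection (delaySectionUp X) where
  isSection _ := rfl
  scSmooth k := (scContDiffOn_id k (delayBase n).up).prodMk (scContDiffOn_delayLevel_one X k)
  regularizing m (p : ℝ × sobolev n (m + 2)) h := by
    rw [delayBase_up_toZero] at h
    obtain ⟨z, hz⟩ := h
    change sobolev n (m + 2) at z
    have h1 : sobolevToOne n (m + 1) z = delayLevel X 1 (p.1, sobolevToTwo n m p.2) := hz
    obtain ⟨x', hx'⟩ := delayLevel_regularizing X p.1 p.2 z <|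
      (delayLevel_base_eq (m := m + 1) (m' := 1) X p.1 (sobolevToTwo_base p.2).symm).trans <|
        (congrArg (fun z : sobolev n 1 => z.1 0) h1).symm.trans (sobolevToOne_base z)
    exact ⟨(p.1, x'), Prod.ext rfl hx'⟩
  fredholm p hp := by
    obtain ⟨q, rfl⟩ := hp.exists_scPoint
    exact isHWZFredholmGerm_delayLevel X q

end HWZ

end DelayScale

end

theorem mainTheorem2 (n : ℕ) (X : DelayScale.TimeVectorField n) :
    DelayScale.IsScFredholmSectionSplit (V := ℝ) (E' := (DelayScale.sobolevScale n).up)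
      (F := DelayScale.sobolevScale n) (DelayScale.delaySection X) ∧
    ∃ S₁ : (DelayScale.delayBase n).up.level 0 →
        ((DelayScale.delayBase n).up.prod (DelayScale.sobolevScale n).up).level 0,
      (∀ p, ((DelayScale.delayBase n).prod (DelayScale.sobolevScale n)).incl 0 (S₁ p)
        = DelayScale.delaySection X ((DelayScale.delayBase n).incl 0 p)) ∧
      DelayScale.IsHWZFredholmSection S₁ :=
  ⟨DelayScale.isScFredholmSectionSplit_delaySection X, DelayScale.delaySectionUp X,
    DelayScale.incl_delaySectionUp X, DelayScale.isHWZFredholmSection_delaySectionUp X⟩
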